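/- Let $d,N\ge 0$ be integers, $\alpha\in(0,1]$, and let $\hat X\subset\mathbb R^d$ be compact and convex. Let $f_1,\dots,f_N:\hat X\to\mathbb R$ be of class $\mathcal C^{1,1}$ (differentiable on $\hat X$ with Lipschitz gradient) and quasi-convex, i.e. $\{x\in\hat X: f_i(x)\le\kappa\}$ is convex for every $\kappa\in\mathbb R$. Let $\hat\rho$ be a probability density on $\hat X$ of class $\mathcal C^\alpha$. For $\lambda\in\mathbb R^N$ put $$K(\lambda)=\{x\in\hat X:\ f_i(x)\le\lambda_i\ \text{for all } i\},\qquad \hat G(\lambda)=\int_{K(\lambda)}\hat\rho(x)\,d\mathcal H^d(x).$$ Assume: (ND) there is $\varepsilon_{nd}>0$ with $\|\nabla f_i(x)\|\ge\varepsilon_{nd}$ for all $i$ and all $x\in\hat X$; (T) there are $\lambda_0\in\mathbb R^N$, $\varepsilon_{tr}>0$ and $0<T_{tr}\le 1$ such that for every $\lambda\in\mathbb R^N$ with $\|\lambda-\lambda_0\|_\infty\le T_{tr}$ and every $x\in\partial K(\lambda)$: if $i\ne j$, $f_i(x)=\lambda_i$ and $f_j(x)=\lambda_j$, then $$\left(\frac{\langle\nabla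 f_i(x),\nabla f_j(x)\rangle}{\|\nabla f_i(x)\|\,\|\nabla f_j(x)\|}\right)^2\le 1-\varepsilon_{tr}^2;$$ and if $f_i(x)=\lambda_i$ and $x\in\partial\hat X$, then for every nonzero $u$ in the normal cone $\mathcal N_x\hat X=\{v\in\mathbb R^d:\langle y-x,v\rangle\le0\ \ \forall y\in\hat X\}$, $$\left(\frac{\langle u,\nabla f_i(x)\rangle}{\|u\|\,\|\nabla f_i(x)\|}\right)^2\le 1-\varepsilon_{tr}^2.$$ Then $\hat G$ is of class $\mathcal C^{1,\alpha}$ on the cube $Q=\lambda_0+[-T_{tr},T_{tr}]^N$ (derivatives at boundary points of $Q$ being taken relative to $Q$), and for every $\lambda\in Q$ and every $i$, $$\frac{\partial\hat G}{\partial\lambda_i}(\lambda)=\int_{K(\lambda)\cap f_i^{-1}(\lambda_i)}\frac{\hat\rho(x)}{\|\nabla f_i(x)\|}\,d\mathcal H^{d-1}(x),$$ where the integrand is integrable on that facet. In addition, $\|\hat G\|_{\mathcal C^{1,\alpha}(Q)}$ is bounded by a constant depending only on $d$, $N$, $\alpha$, $\varepsilon_{tr}$, $\varepsilon_{nd}$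 and on upper bounds for $\|\hat\rho\|_{\mathcal C^\alpha(\hat X)}$, $\operatorname{diam}(\hat X)$, $C_M=\max_i\|\nabla f_i\|_\infty$ and $C_L=\max_i\|\nabla f_i\|_{\mathrm{Lip}(\hat X)}$; in particular it does not depend on $T_{tr}$. -/

import Mathlib

open scoped NNReal ENNReal MeasureTheory

noncomputable section

namespace LocReg

/-- `ℝ^d` with its Euclidean norm. -/
abbrev E (d : ℕ) : Type := EuclideanSpace ℝ (Fin d)

/-- `f` is of class `C^{1,1}` on `X`: it is differentiable on `X` and its gradient is Lipschitz on
`X`. (It is used for compact convex sets `X` of positive volume, on which the gradient relative to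
`X` is uniquely determined, at boundary points too.) -/
def IsC11On {d : ℕ} (f : E d → ℝ) (X : Set (E d)) : Prop :=
  DifferentiableOn ℝ f X ∧ ∃ L : ℝ≥0, LipschitzOnWith L (gradientWithin f X) X

/-- The `C^α` norm on a set `s`: supremum norm plus Hölder seminorm, with values in `[0, ∞]`. -/
def cHolderNorm {V W : Type*} [NormedAddCommGroup V] [NormedAddCommGroup W]
    (α : ℝ≥0) (s : Set V) (g : V → W) : ℝ≥0∞ :=
  (⨆ x ∈ s, ‖g x‖ₑ) + eHolderNorm α (s.domRestrict g)

/-- `g` is of class `C^{1,α}` on `s`: it is `C^1` on `s` and its derivative is `α`-Hölder on `s`.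
At boundary points of `s` the derivative is taken relative to `s`. -/
def IsC1HolderOn {V : Type*} [NormedAddCommGroup V] [NormedSpace ℝ V]
    (α : ℝ≥0) (s : Set V) (g : V → ℝ) : Prop :=
  ContDiffOn ℝ 1 g s ∧ MemHolder α (s.domRestrict (fderivWithin ℝ g s))

/-- The `C^{1,α}` norm on `s`: supremum norm of `g` plus `C^α` norm of its derivative. -/
def c1HolderNorm {V : Type*} [NormedAddCommGroup V] [NormedSpace ℝ V]
    (α : ℝ≥0) (s : Set V) (g : V → ℝ) : ℝ≥0∞ :=
  (⨆ x ∈ s, ‖g x‖ₑ) + cHolderNorm α s (fderivWithin ℝ g s)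

/-- `ρ` is a probability density on `X`. -/
def IsProbDensityOn {d : ℕ} (ρ : E d → ℝ) (X : Set (E d)) : Prop :=
  (∀ x ∈ X, 0 ≤ ρ x) ∧ ∫ x in X, ρ x = 1

/-- The normal cone to `X` at `x`. -/
def normalCone {d : ℕ} (X : Set (E d)) (x : E d) : Set (E d) :=
  {v | ∀ y ∈ X, inner ℝ (y - x) v ≤ 0}

/-- The set `K(λ) = {x ∈ X | f_i(x) ≤ λ_i for all i}`. -/
def K {d N : ℕ} (X : Set (E d)) (f : Fin N → E d → ℝ) (lam : Fin N → ℝ) : Set (E d) :=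
  {x | x ∈ X ∧ ∀ i, f i x ≤ lam i}

/-- The facet of `K(λ)` on which `f_i = λ_i`. -/
def facet {d N : ℕ} (X : Set (E d)) (f : Fin N → E d → ℝ) (lam : Fin N → ℝ) (i : Fin N) :
    Set (E d) :=
  {x | x ∈ K X f lam ∧ f i x = lam i}

/-- The function `λ ↦ ∫_{K(λ)} ρ`. -/
def G {d N : ℕ} (X : Set (E d)) (f : Fin N → E d → ℝ) (ρ : E d → ℝ) (lam : Fin N → ℝ) : ℝ :=
  ∫ x in K X f lam, ρ x

/-- The nondegeneracy condition: `εnd > 0` bounds the norms of all gradients from below on `X`. -/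
def NonDegenerate {d N : ℕ} (X : Set (E d)) (f : Fin N → E d → ℝ) (εnd : ℝ) : Prop :=
  0 < εnd ∧ ∀ i, ∀ x ∈ X, εnd ≤ ‖gradientWithin (f i) X x‖

/-- The squared cosine of the angle between two (nonzero) vectors. -/
def cosSq {d : ℕ} (u v : E d) : ℝ := (inner ℝ u v / (‖u‖ * ‖v‖)) ^ 2

/-- The transversality condition near `lam0` with constants `εtr` and `T`. The norm on
`Fin N → ℝ` is the maximum norm. -/
def Transversal {d N : ℕ} (X : Set (E d)) (f : Fin N → E d → ℝ) (lam0 : Fin N → ℝ)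
    (εtr T : ℝ) : Prop :=
  0 < εtr ∧ 0 < T ∧ T ≤ 1 ∧
    ∀ lam : Fin N → ℝ, ‖lam - lam0‖ ≤ T → ∀ x ∈ frontier (K X f lam),
      (∀ i j, i ≠ j → f i x = lam i → f j x = lam j →
        cosSq (gradientWithin (f i) X x) (gradientWithin (f j) X x) ≤ 1 - εtr ^ 2) ∧
      (∀ i, f i x = lam i → x ∈ frontier X →
        ∀ u ∈ normalCone X x, u ≠ 0 →
          cosSq u (gradientWithin (f i) X x) ≤ 1 - εtr ^ 2)

/-- The cube `λ₀ + [-T, T]^N`. -/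
def cube {N : ℕ} (lam0 : Fin N → ℝ) (T : ℝ) : Set (Fin N → ℝ) :=
  {lam | ∀ i, lam i - lam0 i ∈ Set.Icc (-T) T}

end LocReg

end

/-! ### Normal cones, gradients as outward normals, and edge points. -/

namespace LocReg

open Set Metric Filter Topology InnerProductSpace

variable {d N : ℕ}

/-! Raise one level `λ_i` by `δ > 0`. Then `G` changes by the integral of `ρ` over the slab `λ_i <
f_i ≤ λ_i + δ` inside the set cut out by the other constraints. The gradient of `f_i` is Lipschitz
and bounded below. So, in balls of a fixed radius, the level sets of `f_i` are Lipschitz graphs over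
the hyperplane orthogonal to one direction `v`, and the slab can be integrated along lines parallel
to `v`. On a line that stays inside the other constraints, the integral is `δ ρ / ∂_v f_i` up to
`O(δ^(1+α))`. Integrated over the base, this main term is the facet integral, because the area
density of the graph is `‖∇f_i‖ / ∂_v f_i` (`GraphChart.Adapted.integral_level_eq`). On the
remaining lines the error is only `O(δ)`, so the base points of these lines must be shown to fill a
volume `O(δ)`.

Two facts give this. First, `Setup.exists_edge_near`: such a line passes within `O(δ)` of an edge,
i.e. of a point with two normals at a definite angle, of the set at the lower or at the upper level.
To find the edge point, minimise `f_i` plus a quadratic penalty among the slab points where another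
constraint is active. At a minimiser that is not an edge point, `∇f_i` would be almost parallel to
another normal, against transversality. Second, `Setup.card_mul_pow_le_of_subset_edge`: edges are
covered by `O(δ^(2-d))` balls of radius `δ`. Quasi-convexity makes gradients of active constraints
normals of `K(λ)`, and moving outwards along normals does not decrease distances. Hence
`δ`-separated edge points, each carrying a grid of order `δ^(-2)` points spanned by its two normals,
give a `δ`-separated family in a bounded ball, and volume bounds its size. Each ball projects to
volume `O(δ^(d-1))` in the base, so the bad base points have volume `O(δ)` and contribute `O(δ^2)`.

The expansion holds with the facet integral taken at either end of the slab. Comparing the two ends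
gives Hölder dependence of the `i`-th facet integral on `λ_i`. When another `λ_j` grows, the `i`-th
facet gains only points close to an edge, of area `O(δ)`. Changing one coordinate at a time
(`CoordRegular`) yields `C^{1,α}` on the cube. All smallness is measured against a threshold fixed
by the data, and larger increments are covered by crude bounds, so the size of the cube never
enters. -/

/-- A compact convex body with a family of nondegenerate, transversal, quasi-convex functions. -/
structure Setup (X : Set (E d)) (f : Fin N → E d → ℝ) (εtr εnd : ℝ) (D CL : ℝ≥0)
    (lam0 : Fin N → ℝ) (T : ℝ) : Prop where
  compact : IsCompact X
  convex : Convex ℝ X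
  interior_nonempty : (interior X).Nonempty
  diam_le : Metric.diam X ≤ D
  diff : ∀ i, DifferentiableOn ℝ (f i) X
  quasi : ∀ i, QuasiconvexOn ℝ X (f i)
  lip : ∀ i, LipschitzOnWith CL (gradientWithin (f i) X) X
  nd : NonDegenerate X f εnd
  tr : Transversal X f lam0 εtr T

lemma hasFDerivWithinAt_gradientWithin {X : Set (E d)} {f : E d → ℝ}
    (hf : DifferentiableOn ℝ f X) {x : E d} (hx : x ∈ X) :
    HasFDerivWithinAt f (toDual ℝ (E d) (gradientWithin f X x)) X x := by
  rw [toDual_gradientWithin]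
  exact (hf x hx).hasFDerivWithinAt

/-- If the gradient stays `η`-close to `g` on a convex set, then `f - ⟪g, ·⟫` is `η`-Lipschitz. -/
lemma abs_sub_sub_inner_le {X S : Set (E d)} {f : E d → ℝ} (hf : DifferentiableOn ℝ f X)
    (hS : Convex ℝ S) (hSX : S ⊆ X) {g : E d} {η : ℝ}
    (hg : ∀ z ∈ S, ‖gradientWithin f X z - g‖ ≤ η) {x x' : E d} (hx : x ∈ S) (hx' : x' ∈ S) :
    |f x' - f x - inner ℝ g (x' - x)| ≤ η * ‖x' - x‖ := by
  have := hS.norm_image_sub_le_of_norm_hasFDerivWithin_le' (f := f)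
    (f' := fun z => toDual ℝ (E d) (gradientWithin f X z)) (φ := toDual ℝ (E d) g) (C := η)
    (fun z hz => (hasFDerivWithinAt_gradientWithin hf (hSX hz)).mono hSX)
    (fun z hz => by rw [← map_sub, LinearIsometryEquiv.norm_map]; exact hg z hz) hx hx'
  simpa using this

/-- Along the segment the gradient stays within `CL * ‖x' - x‖` of its value at `x`, so the mean
value inequality already gives a quadratic remainder. -/
lemma abs_taylor_le {X : Set (E d)} {f : E d → ℝ} (hf : DifferentiableOn ℝ f X)
    (hX : Convex ℝ X) {CL : ℝ≥0} (hL : LipschitzOnWith CL (gradientWithin f X) X)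
    {x x' : E d} (hx : x ∈ X) (hx' : x' ∈ X) :
    |f x' - f x - inner ℝ (gradientWithin f X x) (x' - x)| ≤ CL * ‖x' - x‖ ^ 2 := by
  have hsub := hX.segment_subset hx hx'
  have := abs_sub_sub_inner_le hf (convex_segment x x') hsub (g := gradientWithin f X x)
    (η := CL * ‖x' - x‖) (fun z hz => by
      rw [← dist_eq_norm]
      refine (hL.dist_le_mul z (hsub hz) x hx).trans ?_
      gcongr
      obtain ⟨s, hs, rfl⟩ := segment_eq_image' ℝ x x' ▸ hz
      rw [dist_eq_norm]
      simp only [add_sub_cancel_left, norm_smul, Real.norm_eq_abs, abs_of_nonneg hs.1]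
      exact mul_le_of_le_one_left (norm_nonneg _) hs.2) (left_mem_segment ℝ x x')
      (right_mem_segment ℝ x x')
  rw [pow_two, ← mul_assoc]
  exact this

lemma nonpos_of_forall_le_mul {a b : ℝ} (h : ∀ s : ℝ, 0 < s → s ≤ 1 → s * a ≤ s ^ 2 * b) :
    a ≤ 0 := by
  by_contra! ha
  have h1 := h 1 one_pos le_rfl
  have hb : 0 < b := by nlinarith
  -- At this `s` the left side is twice the right side; `s ≤ 1` because `h1` says `a ≤ b`.
  have h2 := h (a / (2 * b)) (by positivity) (by rw [div_le_one (by positivity)]; nlinarith)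
  have h3 : (a / (2 * b)) ^ 2 * b = a / (2 * b) * a / 2 := by field_simp
  have : 0 < a / (2 * b) * a := by positivity
  linarith

/-- The segment from `x` to `y` stays in the convex sublevel set at height `f x`, so `f` cannot
increase to first order along it. -/
lemma inner_gradientWithin_nonpos {X : Set (E d)} {f : E d → ℝ} (hf : DifferentiableOn ℝ f X)
    (hX : Convex ℝ X) {CL : ℝ≥0} (hL : LipschitzOnWith CL (gradientWithin f X) X)
    (hq : QuasiconvexOn ℝ X f) {x y : E d} (hx : x ∈ X) (hy : y ∈ X) (hxy : f y ≤ f x) :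
    inner ℝ (gradientWithin f X x) (y - x) ≤ 0 := by
  refine nonpos_of_forall_le_mul (b := CL * ‖y - x‖ ^ 2) fun s hs hs1 => ?_
  have hmem : x + s • (y - x) ∈ {z ∈ X | f z ≤ f x} :=
    (hq (f x)).add_smul_sub_mem ⟨hx, le_rfl⟩ ⟨hy, hxy⟩ ⟨hs.le, hs1⟩
  have ht := abs_taylor_le hf hX hL hx hmem.1
  have hle := hmem.2
  rw [add_sub_cancel_left, inner_smul_right, norm_smul, Real.norm_eq_abs, abs_of_pos hs,
    mul_pow] at ht
  have := (abs_le.1 ht).1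
  nlinarith

/-- Supporting hyperplane: Hahn–Banach separates `x` from the interior, whose closure contains `X`.
-/
lemma exists_mem_normalCone {X : Set (E d)} (hX : Convex ℝ X) (hintg : (interior X).Nonempty)
    {x : E d} (hx : x ∈ frontier X) : ∃ u ∈ normalCone X x, u ≠ 0 := by
  obtain ⟨φ, hφ⟩ := geometric_hahn_banach_open_point hX.interior isOpen_interior hx.2
  refine ⟨(toDual ℝ (E d)).symm φ, fun y hy => ?_, ?_⟩
  · rw [real_inner_comm, toDual_symm_apply, map_sub, sub_nonpos]
    have hcl : y ∈ closure (interior X) := by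
      rw [hX.closure_interior_eq_closure_of_nonempty_interior hintg]
      exact subset_closure hy
    exact closure_minimal (fun z hz => (hφ z hz).le) (isClosed_le φ.continuous continuous_const) hcl
  · obtain ⟨z, hz⟩ := hintg
    intro h0
    have : φ = 0 := by simpa using h0
    simpa [this] using hφ z hz

lemma normalCone_anti {X Y : Set (E d)} (h : X ⊆ Y) (x : E d) : normalCone Y x ⊆ normalCone X x :=
  fun _ hu y hy => hu y (h hy)

lemma smul_mem_normalCone {X : Set (E d)} {x u : E d} (hu : u ∈ normalCone X x) {c : ℝ}
    (hc : 0 ≤ c) : c • u ∈ normalCone X x := fun y hy => by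
  rw [inner_smul_right]; exact mul_nonpos_of_nonneg_of_nonpos hc (hu y hy)

lemma add_mem_normalCone {X : Set (E d)} {x u v : E d} (hu : u ∈ normalCone X x)
    (hv : v ∈ normalCone X x) : u + v ∈ normalCone X x := fun y hy => by
  rw [inner_add_right]; exact add_nonpos (hu y hy) (hv y hy)

/-- A vector making a definite angle with `u` stays away from the line spanned by `u`. -/
lemma mul_norm_le_norm_sub_smul_of_cosSq_le {u g : E d} {ε : ℝ} (hu : u ≠ 0) (hg : g ≠ 0)
    (h : cosSq u g ≤ 1 - ε ^ 2) (c : ℝ) : ε * ‖g‖ ≤ ‖g - c • u‖ := by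
  have hu' : 0 < ‖u‖ := norm_pos_iff.2 hu
  have hg' : 0 < ‖g‖ := norm_pos_iff.2 hg
  refine le_of_sq_le_sq ?_ (norm_nonneg _)
  rw [@norm_sub_sq_real, inner_smul_right, norm_smul, mul_pow, mul_pow, Real.norm_eq_abs, sq_abs,
    real_inner_comm]
  rw [cosSq, div_pow, div_le_iff₀ (by positivity), mul_pow] at h
  set a := inner ℝ u g
  -- Completing the square in `c`: the minimum over the line is attained at the orthogonal
  -- projection of `g`.
  have h1 : 0 ≤ (c * ‖u‖ ^ 2 - a) ^ 2 := sq_nonneg _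
  have h2 : 0 < ‖u‖ ^ 2 := by positivity
  have h3 : ‖u‖ ^ 2 * (ε ^ 2 * ‖g‖ ^ 2) ≤
      ‖u‖ ^ 2 * (‖g‖ ^ 2 - 2 * (c * a) + c ^ 2 * ‖u‖ ^ 2) := by nlinarith
  exact le_of_mul_le_mul_left h3 h2

lemma mem_cube_iff {lam0 lam : Fin N → ℝ} {T : ℝ} (hT : 0 ≤ T) :
    lam ∈ cube lam0 T ↔ ‖lam - lam0‖ ≤ T := by
  rw [pi_norm_le_iff_of_nonneg hT]
  simp only [cube, mem_ofPred_eq, mem_Icc, Pi.sub_apply, Real.norm_eq_abs, abs_le]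

/-- The points of `K(λ)` having two normals with a definite angle between them. -/
def edge (X : Set (E d)) (f : Fin N → E d → ℝ) (ε : ℝ) (lam : Fin N → ℝ) : Set (E d) :=
  {z | z ∈ K X f lam ∧ ∃ u ∈ normalCone (K X f lam) z, ∃ v ∈ normalCone (K X f lam) z,
    ‖u‖ = 1 ∧ ‖v‖ = 1 ∧ inner ℝ u v ^ 2 ≤ 1 - ε ^ 2}

lemma mem_edge_of_cosSq_le {X : Set (E d)} {f : Fin N → E d → ℝ} {ε : ℝ} {lam : Fin N → ℝ}
    {z u v : E d} (hz : z ∈ K X f lam) (hu : u ∈ normalCone (K X f lam) z) (hu0 : u ≠ 0)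
    (hv : v ∈ normalCone (K X f lam) z) (hv0 : v ≠ 0) (h : cosSq u v ≤ 1 - ε ^ 2) :
    z ∈ edge X f ε lam := by
  refine ⟨hz, ‖u‖⁻¹ • u, smul_mem_normalCone hu (by positivity), ‖v‖⁻¹ • v,
    smul_mem_normalCone hv (by positivity), norm_smul_inv_norm hu0, norm_smul_inv_norm hv0, ?_⟩
  rw [inner_smul_left, inner_smul_right]
  refine le_trans (le_of_eq ?_) h
  rw [cosSq, div_eq_mul_inv, mul_inv]
  simp only [conj_trivial]
  ring

namespace Setup

variable {X : Set (E d)} {f : Fin N → E d → ℝ} {εtr εnd : ℝ} {D CL : ℝ≥0}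
  {lam0 lam : Fin N → ℝ} {T : ℝ}

lemma continuousOn (h : Setup X f εtr εnd D CL lam0 T) (i : Fin N) : ContinuousOn (f i) X :=
  (h.diff i).continuousOn

lemma continuousOn_gradientWithin (h : Setup X f εtr εnd D CL lam0 T) (i : Fin N) :
    ContinuousOn (gradientWithin (f i) X) X := (h.lip i).continuousOn

lemma norm_gradientWithin_pos (h : Setup X f εtr εnd D CL lam0 T) (i : Fin N) {x : E d}
    (hx : x ∈ X) : 0 < ‖gradientWithin (f i) X x‖ := h.nd.1.trans_le (h.nd.2 i x hx)

lemma gradientWithin_ne_zero (h : Setup X f εtr εnd D CL lam0 T) (i : Fin N) {x : E d}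
    (hx : x ∈ X) : gradientWithin (f i) X x ≠ 0 := norm_pos_iff.1 (h.norm_gradientWithin_pos i hx)

/-- This is where quasi-convexity enters: `K(λ)` lies in the half-space behind the level set of an
active constraint. -/
lemma gradientWithin_mem_normalCone (h : Setup X f εtr εnd D CL lam0 T) {i : Fin N} {z : E d}
    (hz : z ∈ K X f lam) (hi : f i z = lam i) :
    gradientWithin (f i) X z ∈ normalCone (K X f lam) z := fun y hy => by
  rw [real_inner_comm]
  exact inner_gradientWithin_nonpos (h.diff i) h.convex (h.lip i) (h.quasi i) hz.1 hy.1
    ((hy.2 i).trans hi.ge)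

lemma isCompact_K (h : Setup X f εtr εnd D CL lam0 T) (lam : Fin N → ℝ) :
    IsCompact (K X f lam) := by
  have : K X f lam = X ∩ ⋂ i, (X ∩ f i ⁻¹' Iic (lam i)) := by
    ext x; simp only [K, mem_ofPred_eq, mem_inter_iff, mem_iInter, mem_preimage, mem_Iic]
    exact ⟨fun hx => ⟨hx.1, fun i => ⟨hx.1, hx.2 i⟩⟩, fun hx => ⟨hx.1, fun i => (hx.2 i).2⟩⟩
  rw [this]
  exact h.compact.inter_right (isClosed_iInter fun i =>
    (h.continuousOn i).preimage_isClosed_of_isClosed h.compact.isClosed isClosed_Iic)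

lemma isCompact_facet (h : Setup X f εtr εnd D CL lam0 T) (lam : Fin N → ℝ) (i : Fin N) :
    IsCompact (facet X f lam i) := by
  have : facet X f lam i = K X f lam ∩ (X ∩ f i ⁻¹' {lam i}) := by
    ext x; simp only [facet, K, mem_ofPred_eq, mem_inter_iff, mem_preimage, mem_singleton_iff]; tauto
  rw [this]
  exact (h.isCompact_K lam).inter_right
    ((h.continuousOn i).preimage_isClosed_of_isClosed h.compact.isClosed isClosed_singleton)

/-- Points of the facets lie on the boundary. -/
lemma mem_frontier_K (h : Setup X f εtr εnd D CL lam0 T) {i : Fin N} {z : E d}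
    (hz : z ∈ K X f lam) (hi : f i z = lam i) : z ∈ frontier (K X f lam) := by
  refine ⟨subset_closure hz, fun hintg => ?_⟩
  set g := gradientWithin (f i) X z
  have hg : 0 < ‖g‖ := h.norm_gradientWithin_pos i hz.1
  have hu := h.gradientWithin_mem_normalCone hz hi
  -- If `z` were interior, short steps along `g` would stay in `K(λ)`, although `g` is an outward
  -- normal there.
  have hc : Tendsto (fun s : ℝ => z + s • g) (𝓝[>] 0) (𝓝 z) := by
    have : Continuous (fun s : ℝ => z + s • g) := by fun_prop
    simpa using (this.tendsto 0).mono_left nhdsWithin_le_nhds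
  have hev := hc.eventually (mem_interior_iff_mem_nhds.1 hintg)
  obtain ⟨s, hs, hs0⟩ := (hev.and self_mem_nhdsWithin).exists
  have := hu _ hs
  rw [add_sub_cancel_left, inner_smul_left, real_inner_self_eq_norm_sq] at this
  have hs0 : 0 < s := hs0
  have : 0 < s * ‖g‖ ^ 2 := by positivity
  simp at *
  linarith

/-- A point of `K(λ)` with two active constraints is an edge point. -/
lemma mem_edge (h : Setup X f εtr εnd D CL lam0 T) (hlam : lam ∈ cube lam0 T) {i : Fin N}
    {z : E d} (hz : z ∈ K X f lam) (hi : f i z = lam i)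
    (hact : z ∈ frontier X ∨ ∃ j, j ≠ i ∧ f j z = lam j) : z ∈ edge X f εtr lam := by
  obtain ⟨-, hT0, -, htr⟩ := h.tr
  obtain ⟨h1, h2⟩ := htr lam ((mem_cube_iff hT0.le).1 hlam) z (h.mem_frontier_K hz hi)
  have hgi := h.gradientWithin_mem_normalCone hz hi
  rcases hact with hX | ⟨j, hji, hj⟩
  · obtain ⟨u, hu, hu0⟩ := exists_mem_normalCone h.convex h.interior_nonempty hX
    exact mem_edge_of_cosSq_le hz (normalCone_anti (fun x hx => hx.1) z hu) hu0 hgi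
      (h.gradientWithin_ne_zero i hz.1) (h2 i hi hX u hu hu0)
  · exact mem_edge_of_cosSq_le hz (h.gradientWithin_mem_normalCone hz hj)
      (h.gradientWithin_ne_zero j hz.1) hgi (h.gradientWithin_ne_zero i hz.1) (h1 j i hji hj hi)

end Setup

end LocReg

/-! ### Counting separated edge points, and coverings. -/

namespace LocReg

open Set Metric Filter Topology InnerProductSpace MeasureTheory

variable {d N : ℕ}

/-- Volume bound for the number of `δ`-separated points in a ball. -/
lemma card_mul_pow_le_of_separated {ι : Type*} (s : Finset ι) (p : ι → E d) {c : E d} {δ ρ : ℝ}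
    (hδ : 0 < δ) (hρ : 0 < ρ + δ) (hsep : ∀ i ∈ s, ∀ j ∈ s, i ≠ j → δ ≤ dist (p i) (p j))
    (hp : ∀ i ∈ s, p i ∈ closedBall c ρ) : (s.card : ℝ) * (δ / 2) ^ d ≤ (ρ + δ) ^ d := by
  rcases s.eq_empty_or_nonempty with rfl | ⟨i0, hi0⟩
  · simpa using pow_nonneg hρ.le d

  have hdisj : (s : Set ι).PairwiseDisjoint (fun i => ball (p i) (δ / 2)) := by
    intro i hi j hj hij
    exact ball_disjoint_ball (by linarith [hsep i hi j hj hij])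
  have h1 : volume (⋃ i ∈ s, ball (p i) (δ / 2)) = ∑ i ∈ s, volume (ball (p i) (δ / 2)) :=
    measure_biUnion_finset hdisj fun i _ => measurableSet_ball
  have h2 : volume (⋃ i ∈ s, ball (p i) (δ / 2)) ≤ volume (ball c (ρ + δ)) := by
    refine measure_mono (iUnion₂_subset fun i hi => ball_subset_ball' ?_)
    linarith [mem_closedBall.1 (hp i hi)]
  have hv : ∀ (x : E d) (r : ℝ), 0 < r →
      volume (ball x r) = ENNReal.ofReal (r ^ d) * volume (ball (0 : E d) 1) := fun x r hr => by
    simpa using Measure.addHaar_ball_of_pos (volume : Measure (E d)) x hr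
  rw [h1, hv c _ (by positivity), Finset.sum_congr rfl fun i _ => hv (p i) (δ / 2) (by positivity),
    Finset.sum_const, nsmul_eq_mul, ← mul_assoc] at h2
  have hpos : volume (ball (0 : E d) 1) ≠ 0 := (measure_ball_pos _ _ one_pos).ne'
  have h3 := (ENNReal.mul_le_mul_iff_left hpos measure_ball_lt_top.ne).1 h2
  rw [← ENNReal.ofReal_natCast, ← ENNReal.ofReal_mul (by positivity),
    ENNReal.ofReal_le_ofReal_iff (by positivity)] at h3
  exact h3

/-- Moving outwards along normals of a convex set does not decrease distances. -/
lemma norm_sub_le_of_normalCone {A : Set (E d)} {z z' n n' : E d} (hz : z ∈ A) (hz' : z' ∈ A)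
    (hn : n ∈ normalCone A z) (hn' : n' ∈ normalCone A z') :
    ‖z - z'‖ ≤ ‖(z + n) - (z' + n')‖ := by
  have h1 : 0 ≤ inner ℝ (z - z') n := by
    have := hn z' hz'
    rw [← neg_sub, inner_neg_left] at this
    linarith
  have h2 := hn' z hz
  have h3 : ‖z - z'‖ ^ 2 ≤ ‖z - z'‖ * ‖(z + n) - (z' + n')‖ := by
    refine le_trans ?_ (real_inner_le_norm _ _)
    have : (z + n) - (z' + n') = (z - z') + (n - n') := by abel
    rw [this, inner_add_right, inner_sub_right _ n, real_inner_self_eq_norm_sq]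
    linarith
  rcases (norm_nonneg (z - z')).eq_or_lt with h0 | h0
  · rw [← h0]; positivity
  · rw [pow_two] at h3
    exact le_of_mul_le_mul_left h3 h0

/-- The Gram matrix of `u` and `v` has smallest eigenvalue `1 - |⟪u, v⟫| ≥ ε² / 2`. This separates
distinct points of an integer grid spanned by two normals. -/
lemma le_norm_smul_add_smul {u v : E d} {ε : ℝ} (hu : ‖u‖ = 1) (hv : ‖v‖ = 1)
    (huv : inner ℝ u v ^ 2 ≤ 1 - ε ^ 2) {p q : ℝ} (hpq : 1 ≤ p ^ 2 + q ^ 2) :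
    (ε / 2) ≤ ‖p • u + q • v‖ := by
  refine le_of_sq_le_sq ?_ (norm_nonneg _)
  rw [@norm_add_sq_real, inner_smul_left, inner_smul_right, norm_smul, norm_smul, hu, hv]
  simp only [Real.norm_eq_abs, mul_one, sq_abs, conj_trivial]
  set c := inner ℝ u v
  have hc : |c| ≤ 1 - ε ^ 2 / 2 := by
    refine abs_le_of_sq_le_sq ?_ ?_ <;> nlinarith [sq_nonneg c, sq_nonneg (ε ^ 2), sq_nonneg ε]
  have h1 : |2 * (p * q)| ≤ p ^ 2 + q ^ 2 := by
    rw [abs_le]; constructor <;> nlinarith [sq_nonneg (p + q), sq_nonneg (p - q)]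
  have h2 : -(|c| * (p ^ 2 + q ^ 2)) ≤ 2 * (p * (q * c)) := by
    have : |2 * (p * (q * c))| ≤ |c| * (p ^ 2 + q ^ 2) := by
      rw [show 2 * (p * (q * c)) = c * (2 * (p * q)) by ring, abs_mul]
      gcongr
    exact (abs_le.1 this).1
  nlinarith [sq_nonneg ε]

/-- If the cardinality of `δ`-separated subsets of `A` is bounded, then `A` is covered by a bounded
number of balls of radius `δ`. -/
lemma exists_finset_cover {A : Set (E d)} {δ B : ℝ} (hδ : 0 < δ)
    (hB : ∀ S : Finset (E d), (S : Set (E d)) ⊆ A →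
      (∀ x ∈ S, ∀ y ∈ S, x ≠ y → δ ≤ dist x y) → (S.card : ℝ) ≤ B) :
    ∃ S : Finset (E d), (S : Set (E d)) ⊆ A ∧ (∀ z ∈ A, ∃ x ∈ S, dist z x ≤ δ) ∧
      (S.card : ℝ) ≤ B := by
  classical
  let Q : ℕ → Prop := fun n => ∃ S : Finset (E d), (S : Set (E d)) ⊆ A ∧
    (∀ x ∈ S, ∀ y ∈ S, x ≠ y → δ ≤ dist x y) ∧ S.card = n
  have hQB : ∀ n, Q n → n ≤ ⌊B⌋₊ := by
    rintro n ⟨S, hS, hsep, rfl⟩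
    exact Nat.le_floor (hB S hS hsep)
  have hQ0 : Q 0 := ⟨∅, by simp, by simp, rfl⟩
  -- A separated subset of maximal cardinality is a `δ`-net: an uncovered point could be added to
  -- it.
  obtain ⟨S, hS, hsep, hcard⟩ := Nat.findGreatest_spec (P := Q) (Nat.zero_le ⌊B⌋₊) hQ0
  refine ⟨S, hS, fun z hz => ?_, hB S hS hsep⟩
  by_contra! hfar
  have hzS : z ∉ S := fun hzS => by simpa using hδ.trans (hfar z hzS)
  have hQ : Q (S.card + 1) := by
    refine ⟨insert z S, ?_, ?_, Finset.card_insert_of_notMem hzS⟩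
    · rw [Finset.coe_insert]; exact insert_subset hz hS
    · intro x hx y hy hxy
      rw [Finset.mem_insert] at hx hy
      rcases hx with rfl | hx <;> rcases hy with rfl | hy
      · exact absurd rfl hxy
      · exact (hfar y hy).le
      · rw [dist_comm]; exact (hfar x hx).le
      · exact hsep x hx y hy hxy
  have := Nat.le_findGreatest (hQB _ hQ) hQ
  omega

namespace Setup

variable {X : Set (E d)} {f : Fin N → E d → ℝ} {εtr εnd : ℝ} {D CL : ℝ≥0}
  {lam0 lam : Fin N → ℝ} {T : ℝ}

lemma dist_le (h : Setup X f εtr εnd D CL lam0 T) {x y : E d} (hx : x ∈ X) (hy : y ∈ X) :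
    dist x y ≤ D := (dist_le_diam_of_mem h.compact.isBounded hx hy).trans h.diam_le

/-- The number of `δ`-separated edge points is `O(δ ^ (2 - d))`. -/
lemma card_mul_pow_le_of_subset_edge (h : Setup X f εtr εnd D CL lam0 T) {δ : ℝ} (hδ : 0 < δ)
    (hδ1 : δ ≤ 1) (S : Finset (E d)) (hS : (S : Set (E d)) ⊆ edge X f εtr lam)
    (hsep : ∀ x ∈ S, ∀ y ∈ S, x ≠ y → δ ≤ dist x y) :
    (S.card : ℝ) * δ ^ d ≤ ((D + 3) ^ d * 2 ^ d * 4 / εtr ^ 2) * δ ^ 2 := by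
  have hε := h.tr.1
  rcases S.eq_empty_or_nonempty with rfl | ⟨z0, hz0⟩
  · simp; positivity
  have hS' : ∀ z, z ∈ S → z ∈ edge X f εtr lam := fun z hz => hS hz
  choose! hK u hu v hv hu1 hv1 huv using hS'
  -- The mesh is chosen so that distinct grid points over one edge point are at least `η * (εtr / 2)
  -- = δ` apart. With `m` about `1 / η` the legs have length at most one, and the `m²` points per
  -- edge point produce the gain `δ^(-2)`.
  set η : ℝ := 2 * δ / εtr with hη
  have hη0 : 0 < η := by positivity
  set m : ℕ := ⌊1 / η⌋₊ + 1 with hm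
  have hm1 : 1 / η ≤ m := by rw [hm]; push_cast; exact (Nat.lt_floor_add_one _).le
  have hm2 : ∀ a ∈ Finset.range m, (a : ℝ) * η ≤ 1 := by
    intro a ha
    have h1 : a ≤ ⌊1 / η⌋₊ := by rw [Finset.mem_range] at ha; omega
    have h2 : (a : ℝ) ≤ 1 / η := (Nat.le_floor_iff (by positivity)).1 h1
    rwa [le_div_iff₀ hη0] at h2
  let P : E d × ℕ × ℕ → E d := fun q =>
    q.1 + (((q.2.1 : ℝ) * η) • u q.1 + ((q.2.2 : ℝ) * η) • v q.1)
  have hn : ∀ q ∈ S ×ˢ (Finset.range m ×ˢ Finset.range m),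
      ((q.2.1 : ℝ) * η) • u q.1 + ((q.2.2 : ℝ) * η) • v q.1 ∈ normalCone (K X f lam) q.1 := by
    intro q hq
    rw [Finset.mem_product] at hq
    exact add_mem_normalCone (smul_mem_normalCone (hu _ hq.1) (by positivity))
      (smul_mem_normalCone (hv _ hq.1) (by positivity))
  -- The radius is `D + 2`: the diameter plus two legs of length at most one.
  have key := card_mul_pow_le_of_separated (S ×ˢ (Finset.range m ×ˢ Finset.range m)) P (c := z0)
    (ρ := D + 2) hδ (by positivity) ?_ ?_
  · rw [Finset.card_product, Finset.card_product, Finset.card_range] at key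
    push_cast at key
    have h1 : (S.card : ℝ) * (1 / η * (1 / η)) * (δ / 2) ^ d ≤ (D + 3 : ℝ) ^ d := by
      refine le_trans ?_ (key.trans ?_)
      · gcongr
      · exact pow_le_pow_left₀ (by positivity) (by linarith) d
    have h2 : (S.card : ℝ) * (1 / η * (1 / η)) * (δ / 2) ^ d
        = (S.card : ℝ) * δ ^ d * (εtr ^ 2 / (4 * δ ^ 2 * 2 ^ d)) := by
      rw [hη, div_pow]; field_simp; ring
    rw [h2, ← le_div_iff₀ (by positivity)] at h1
    refine h1.trans (le_of_eq ?_)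
    field_simp
  · intro q hq q' hq' hne
    by_cases hz : q.1 = q'.1
    · have hq1 := (Finset.mem_product.1 hq).1
      have heq : P q - P q' = η • ((((q.2.1 : ℝ) - q'.2.1)) • u q.1
          + ((q.2.2 : ℝ) - q'.2.2) • v q.1) := by
        simp only [P, ← hz]
        module
      have hintg : (1 : ℝ) ≤ ((q.2.1 : ℝ) - q'.2.1) ^ 2 + ((q.2.2 : ℝ) - q'.2.2) ^ 2 := by
        have : (1 : ℤ) ≤ ((q.2.1 : ℤ) - q'.2.1) ^ 2 + ((q.2.2 : ℤ) - q'.2.2) ^ 2 := by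
          by_contra! hlt
          have e3 := sq_nonneg ((q.2.1 : ℤ) - q'.2.1)
          have e4 := sq_nonneg ((q.2.2 : ℤ) - q'.2.2)
          have e1 : ((q.2.1 : ℤ) - q'.2.1) ^ 2 = 0 := by omega
          have e2 : ((q.2.2 : ℤ) - q'.2.2) ^ 2 = 0 := by omega
          rw [sq_eq_zero_iff, sub_eq_zero] at e1 e2
          exact hne (Prod.ext hz (Prod.ext (by exact_mod_cast e1) (by exact_mod_cast e2)))
        exact_mod_cast this
      have := le_norm_smul_add_smul (hu1 _ hq1) (hv1 _ hq1) (huv _ hq1) hintg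
      rw [dist_eq_norm, heq, norm_smul, Real.norm_eq_abs, abs_of_pos hη0]
      calc δ = η * (εtr / 2) := by rw [hη]; field_simp
        _ ≤ _ := by gcongr
    · have hq1 := (Finset.mem_product.1 hq).1
      have hq1' := (Finset.mem_product.1 hq').1
      refine (hsep _ hq1 _ hq1' hz).trans ?_
      rw [dist_eq_norm, dist_eq_norm]
      exact norm_sub_le_of_normalCone (hK _ hq1) (hK _ hq1') (hn q hq) (hn q' hq')
  · intro q hq
    have hq1 := (Finset.mem_product.1 hq).1
    have hq2 := Finset.mem_product.1 (Finset.mem_product.1 hq).2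
    have h1 := h.dist_le (hK _ hq1).1 (hK _ hz0).1
    have h2 : ‖((q.2.1 : ℝ) * η) • u q.1‖ ≤ 1 := by
      rw [norm_smul, hu1 _ hq1, mul_one, Real.norm_eq_abs, abs_of_nonneg (by positivity)]
      exact hm2 _ hq2.1
    have h3 : ‖((q.2.2 : ℝ) * η) • v q.1‖ ≤ 1 := by
      rw [norm_smul, hv1 _ hq1, mul_one, Real.norm_eq_abs, abs_of_nonneg (by positivity)]
      exact hm2 _ hq2.2
    rw [mem_closedBall]
    refine (dist_triangle (P q) q.1 z0).trans ?_
    have h4 : dist (P q) q.1 ≤ 2 := by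
      rw [dist_eq_norm]
      simp only [P, add_sub_cancel_left]
      exact (norm_add_le _ _).trans (by linarith)
    linarith

/-- The edges are covered by `O(δ ^ (2 - d))` balls of radius `δ`. -/
lemma exists_cover_edge (h : Setup X f εtr εnd D CL lam0 T) (lam : Fin N → ℝ) {δ : ℝ} (hδ : 0 < δ)
    (hδ1 : δ ≤ 1) :
    ∃ S : Finset (E d), (S : Set (E d)) ⊆ edge X f εtr lam ∧
      (∀ z ∈ edge X f εtr lam, ∃ x ∈ S, dist z x ≤ δ) ∧
      (S.card : ℝ) * δ ^ d ≤ ((D + 3) ^ d * 2 ^ d * 4 / εtr ^ 2) * δ ^ 2 := by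
  obtain ⟨S, hS, hcov, hcard⟩ := exists_finset_cover (A := edge X f εtr lam) hδ
    (B := ((D + 3) ^ d * 2 ^ d * 4 / εtr ^ 2) * δ ^ 2 / δ ^ d) fun S hS hsep => by
      rw [le_div_iff₀ (by positivity)]
      exact h.card_mul_pow_le_of_subset_edge hδ hδ1 S hS hsep
  exact ⟨S, hS, hcov, by rwa [le_div_iff₀ (by positivity)] at hcard⟩

/-- `X` is covered by a controlled number of balls of radius `r`. -/
lemma exists_net (h : Setup X f εtr εnd D CL lam0 T) {r : ℝ} (hr : 0 < r) :
    ∃ S : Finset (E d), (S : Set (E d)) ⊆ X ∧ (∀ z ∈ X, ∃ x ∈ S, dist z x ≤ r) ∧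
      (S.card : ℝ) ≤ (D + r) ^ d / (r / 2) ^ d := by
  obtain ⟨x0, hx0⟩ := h.interior_nonempty.mono interior_subset
  refine exists_finset_cover hr fun S hS hsep => ?_
  rw [le_div_iff₀ (by positivity)]
  exact card_mul_pow_le_of_separated S id (c := x0) hr (by positivity) hsep
    fun x hx => mem_closedBall.2 (h.dist_le (hS hx) hx0)

end Setup

end LocReg

/-! ### Transversality: slab points with another active constraint are close to edges. -/

namespace LocReg

open Set Metric Filter Topology InnerProductSpace MeasureTheory

variable {d N : ℕ}

/-- A segment missing the frontier would be disconnected by the interior and the complement of the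
closure. -/
lemma segment_inter_frontier_nonempty {V : Type*} [AddCommGroup V] [Module ℝ V]
    [TopologicalSpace V] [ContinuousAdd V] [ContinuousSMul ℝ V] {A : Set V} {a b : V}
    (ha : a ∈ A) (hb : b ∉ A) : (segment ℝ a b ∩ frontier A).Nonempty := by
  by_contra hemp
  rw [not_nonempty_iff_eq_empty, ← disjoint_iff_inter_eq_empty] at hemp
  have hsub : ∀ c ∈ segment ℝ a b, c ∉ frontier A := fun c hc => disjoint_left.1 hemp hc
  have haI : a ∈ interior A := by
    by_contra h0
    exact hsub a (left_mem_segment _ _ _) ⟨subset_closure ha, h0⟩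
  have hbC : b ∉ closure A := fun h0 =>
    hsub b (right_mem_segment _ _ _) ⟨h0, fun h1 => hb (interior_subset h1)⟩
  obtain ⟨c, -, hc1, hc2⟩ := (convex_segment a b).isPreconnected (interior A) (closure A)ᶜ
    isOpen_interior isClosed_closure.isOpen_compl (fun c hc => by
      by_cases h0 : c ∈ closure A
      · left
        by_contra h1
        exact hsub c hc ⟨h0, h1⟩
      · exact Or.inr h0) ⟨a, left_mem_segment _ _ _, haI⟩ ⟨b, right_mem_segment _ _ _, hbC⟩
  exact hc2 (subset_closure (interior_subset hc1))

/-- First-order condition for a local minimum on the boundary of a convex body. -/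
lemma exists_normal_parallel_of_min_frontier {X : Set (E d)} (hX : Convex ℝ X)
    (hcl : IsClosed X) (hintg : (interior X).Nonempty) {z q : E d} (hz : z ∈ frontier X)
    {φ : E d → ℝ} (hφ : HasFDerivWithinAt φ (toDual ℝ (E d) q) X z)
    (hmin : ∀ᶠ z' in 𝓝 z, z' ∈ frontier X → φ z ≤ φ z') :
    ∃ u ∈ normalCone X z, u ≠ 0 ∧ ∃ c : ℝ, q = c • u := by
  by_contra! hno
  obtain ⟨u, hu, hu0⟩ := exists_mem_normalCone hX hintg hz
  have hq0 : q ≠ 0 := by simpa using hno u hu hu0 0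
  have hq : -q ∉ normalCone X z := fun hmem =>
    hno (-q) hmem (neg_ne_zero.2 hq0) (-1) (by simp)
  -- If `q` is parallel to no normal, then `-q` is not a normal, so some direction into the interior
  -- decreases `φ` to first order.
  obtain ⟨y, hy, hyq⟩ : ∃ y ∈ interior X, inner ℝ q (y - z) < 0 := by
    have : ∃ y ∈ X, 0 < inner ℝ (y - z) (-q) := by
      simpa [normalCone] using hq
    obtain ⟨y, hy, hyq⟩ := this
    have hopen : IsOpen {y : E d | inner ℝ q (y - z) < 0} :=
      isOpen_lt (by fun_prop) continuous_const
    have hyc : y ∈ closure (interior X) := by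
      rw [hX.closure_interior_eq_closure_of_nonempty_interior hintg]
      exact subset_closure hy
    have hyq' : inner ℝ q (y - z) < 0 := by
      rw [inner_neg_right, real_inner_comm] at hyq; linarith
    obtain ⟨y', h1, h2⟩ := mem_closure_iff.1 hyc _ hopen hyq'
    exact ⟨y', h2, h1⟩
  have hu2 : 0 < ‖u‖ ^ 2 := by have := norm_pos_iff.2 hu0; positivity
  -- `P` is the nonzero part of `q` orthogonal to the normal `u`. The direction `-P + β • u` still
  -- decreases `φ` when `β` is small, and it leaves `X`.
  set P : E d := q - (inner ℝ q u / ‖u‖ ^ 2) • u with hP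
  have hP0 : P ≠ 0 := fun h0 => hno u hu hu0 _ (sub_eq_zero.1 h0)
  have hPu : inner ℝ P u = 0 := by
    rw [hP, inner_sub_left, inner_smul_left, real_inner_self_eq_norm_sq]
    simp only [conj_trivial]
    field_simp
    ring
  have hPq : inner ℝ q P = ‖P‖ ^ 2 := by
    have : q = P + (inner ℝ q u / ‖u‖ ^ 2) • u := by rw [hP]; abel
    conv_lhs => rw [this]
    rw [inner_add_left, inner_smul_left, real_inner_comm, real_inner_comm P u, hPu,
      real_inner_self_eq_norm_sq]
    simp
  have hP2 : 0 < ‖P‖ ^ 2 := by have := norm_pos_iff.2 hP0; positivity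
  set β : ℝ := ‖P‖ ^ 2 / (2 * (|inner ℝ q u| + 1)) with hβ
  have hβ0 : 0 < β := by positivity
  have hβq : β * inner ℝ q u < ‖P‖ ^ 2 := by
    calc β * inner ℝ q u ≤ β * (|inner ℝ q u| + 1) := by
          gcongr; linarith [le_abs_self (inner ℝ q u)]
      _ = ‖P‖ ^ 2 / 2 := by rw [hβ]; field_simp
      _ < _ := by linarith
  set w : E d := y - z
  set w' : E d := -P + β • u with hw'
  have hqw' : inner ℝ q w' < 0 := by
    rw [hw', inner_add_right, inner_neg_right, inner_smul_right, hPq]; linarith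
  have huw' : 0 < inner ℝ w' u := by
    rw [hw', inner_add_left, inner_neg_left, inner_smul_left, hPu, real_inner_self_eq_norm_sq]
    simp only [conj_trivial]
    positivity
  -- Both directions, hence all their convex combinations, decrease `φ` at rate at least `m`. The
  -- error of the linearisation is kept below half of this on vectors of length at most `M`.
  set m : ℝ := min (-inner ℝ q w) (-inner ℝ q w') with hm
  have hm0 : 0 < m := lt_min (by linarith) (by linarith)
  set M : ℝ := ‖w‖ + ‖w'‖ + 1 with hM
  have hM0 : 0 < M := by positivity
  have hlo := hφ.isLittleO.def (c := m / (2 * M)) (by positivity)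
  rw [eventually_nhdsWithin_iff] at hlo
  obtain ⟨r, hr, hball⟩ := Metric.eventually_nhds_iff.1 (hlo.and hmin)
  set τ : ℝ := min 1 (r / (2 * M)) with hτ
  have hτ0 : 0 < τ := lt_min one_pos (by positivity)
  have ha : z + τ • w ∈ interior X :=
    hX.add_smul_sub_mem_interior' hz.1 hy ⟨hτ0, min_le_left _ _⟩
  have hb : z + τ • w' ∉ X := fun hb => by
    have := hu _ hb
    rw [add_sub_cancel_left, inner_smul_left] at this
    have : 0 < τ * inner ℝ w' u := by positivity
    simp at *
    linarith
  -- Between the inner and the outer point the segment crosses the frontier, at a point where `φ` is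
  -- smaller than at `z`.
  obtain ⟨c, hc, hcf⟩ : (segment ℝ (z + τ • w) (z + τ • w') ∩ frontier X).Nonempty := by
    exact segment_inter_frontier_nonempty (interior_subset ha) hb
  obtain ⟨s, t, hs, ht, hst, rfl⟩ := hc
  have hceq : s • (z + τ • w) + t • (z + τ • w') = z + τ • (s • w + t • w') := by
    have : s = 1 - t := by linarith
    subst this; module
  rw [hceq] at hcf
  set v := s • w + t • w' with hv
  have hvM : ‖v‖ < M := by
    have h1 : ‖v‖ ≤ s * ‖w‖ + t * ‖w'‖ := by
      refine (norm_add_le _ _).trans_eq ?_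
      rw [norm_smul, norm_smul, Real.norm_of_nonneg hs, Real.norm_of_nonneg ht]
    nlinarith [norm_nonneg w, norm_nonneg w']
  have hqv : inner ℝ q v ≤ -m := by
    rw [hv, inner_add_right, inner_smul_right, inner_smul_right]
    have h1 : inner ℝ q w ≤ -m := by linarith [min_le_left (-inner ℝ q w) (-inner ℝ q w')]
    have h2 : inner ℝ q w' ≤ -m := by linarith [min_le_right (-inner ℝ q w) (-inner ℝ q w')]
    nlinarith
  have hd : dist (z + τ • v) z < r := by
    rw [dist_eq_norm, add_sub_cancel_left, norm_smul, Real.norm_of_nonneg hτ0.le]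
    calc τ * ‖v‖ ≤ r / (2 * M) * M := by gcongr; exact min_le_right _ _
      _ = r / 2 := by field_simp
      _ < r := by linarith
  obtain ⟨h1, h2⟩ := hball hd
  have h3 := h1 (hcl.frontier_subset hcf)
  have h4 := h2 hcf
  rw [add_sub_cancel_left, toDual_apply_apply, inner_smul_right, norm_smul,
    Real.norm_of_nonneg hτ0.le, Real.norm_eq_abs] at h3
  have h5 := (abs_le.1 h3).2
  have h6 : m / (2 * M) * (τ * ‖v‖) ≤ τ * m / 2 := by
    calc m / (2 * M) * (τ * ‖v‖) ≤ m / (2 * M) * (τ * M) := by gcongr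
      _ = τ * m / 2 := by field_simp
  have h7 : 0 < τ * m := by positivity
  nlinarith

lemma hasStrictFDerivAt_of_mem_interior {X : Set (E d)} {f : E d → ℝ}
    (hf : DifferentiableOn ℝ f X) {CL : ℝ≥0} (hL : LipschitzOnWith CL (gradientWithin f X) X)
    {z : E d} (hz : z ∈ interior X) :
    HasStrictFDerivAt f (toDual ℝ (E d) (gradientWithin f X z)) z := by
  refine hasStrictFDerivAt_of_hasFDerivAt_of_continuousAt
    (f' := fun z => toDual ℝ (E d) (gradientWithin f X z)) ?_ ?_
  · filter_upwards [isOpen_interior.mem_nhds hz] with y hy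
    exact (hasFDerivWithinAt_gradientWithin hf (interior_subset hy)).hasFDerivAt
      (mem_interior_iff_mem_nhds.1 hy)
  · exact (toDual ℝ (E d)).continuous.continuousAt.comp
      (hL.continuousOn.continuousAt (mem_interior_iff_mem_nhds.1 hz))

lemma update_mem_cube {lam0 lam : Fin N → ℝ} {T s t : ℝ} {i : Fin N} (h : lam ∈ cube lam0 T)
    (hs : Function.update lam i s ∈ cube lam0 T) (h1 : lam i ≤ t) (h2 : t ≤ s) :
    Function.update lam i t ∈ cube lam0 T := by
  intro j
  by_cases hj : j = i
  · subst hj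
    have a := h j
    have b := hs j
    simp only [Function.update_self, mem_Icc] at a b ⊢
    constructor <;> linarith
  · simpa [Function.update_of_ne hj] using h j

namespace Setup

variable {X : Set (E d)} {f : Fin N → E d → ℝ} {εtr εnd : ℝ} {D CL : ℝ≥0}
  {lam0 lam : Fin N → ℝ} {T : ℝ}

/-- A point of the slab `λᵢ ≤ fᵢ ≤ s` at which another constraint is active is close to an edge. -/
lemma exists_edge_near (h : Setup X f εtr εnd D CL lam0 T) {i : Fin N} {s : ℝ} (hs : lam i < s)
    (hlam : lam ∈ cube lam0 T) (hlam' : Function.update lam i s ∈ cube lam0 T) {x : E d}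
    (hx : x ∈ K X f (Function.update lam i s)) (htx : lam i ≤ f i x)
    (hact : x ∈ frontier X ∨ ∃ j, j ≠ i ∧ f j x = lam j) :
    ∃ z ∈ edge X f εtr lam ∪ edge X f εtr (Function.update lam i s),
      dist z x ≤ 4 / (εtr * εnd) * (s - lam i) := by
  set lam' := Function.update lam i s with hl'
  have hl'j : ∀ j, j ≠ i → lam' j = lam j := fun j hj => Function.update_of_ne hj _ _
  have hl'i : lam' i = s := Function.update_self _ _ _
  obtain ⟨hε, hT0, -, htr⟩ := h.tr
  have hnd := h.nd.1
  set δ := s - lam i with hδ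
  have hδ0 : 0 < δ := by linarith
  -- Since `f i` varies by at most `δ` in the slab, the penalty `k² / δ` keeps a minimiser within `δ
  -- / k` of `x`. There the gradient of the penalty is at most `2k = εtr * εnd / 2`, too small to
  -- turn `∇f i` into a parallel of another normal.
  set k := εtr * εnd / 4 with hk
  have hk0 : 0 < k := by positivity
  have hk' : 4 / (εtr * εnd) * δ = δ / k := by rw [hk]; field_simp
  let φ : E d → ℝ := fun z => f i z + k ^ 2 / δ * ‖z - x‖ ^ 2
  let Z : Set (E d) := K X f lam' ∩ ((X ∩ f i ⁻¹' Ici (lam i)) ∩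
    (frontier X ∪ ⋃ j : {j // j ≠ i}, (X ∩ f j ⁻¹' {lam j})))
  have hclX := h.compact.isClosed
  have hZc : IsCompact Z := by
    refine (h.isCompact_K _).inter_right (((h.continuousOn i).preimage_isClosed_of_isClosed hclX
      isClosed_Ici).inter (isClosed_frontier.union (isClosed_iUnion_of_finite fun j =>
      (h.continuousOn j).preimage_isClosed_of_isClosed hclX isClosed_singleton)))
  have hZ : ∀ z, z ∈ K X f lam' → lam i ≤ f i z → (z ∈ frontier X ∨ ∃ j, j ≠ i ∧ f j z = lam j) →
      z ∈ Z := by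
    rintro z h1 h2 h3
    refine ⟨h1, ⟨h1.1, h2⟩, h3.imp id fun ⟨j, hj, hjz⟩ => mem_iUnion.2 ⟨⟨j, hj⟩, h1.1, hjz⟩⟩
  have hφc : ContinuousOn φ Z := by
    refine ((h.continuousOn i).mono fun z hz => hz.1.1).add (Continuous.continuousOn ?_)
    fun_prop
  obtain ⟨z, hzZ, hzmin⟩ := hZc.exists_isMinOn ⟨x, hZ x hx htx hact⟩ hφc
  obtain ⟨hzK, ⟨hzX, hzi⟩, hzact⟩ := hzZ
  replace hzi : lam i ≤ f i z := hzi
  have hzact' : z ∈ frontier X ∨ ∃ j, j ≠ i ∧ f j z = lam j := by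
    refine hzact.imp id fun hz => ?_
    obtain ⟨⟨j, hj⟩, hjz⟩ := mem_iUnion.1 hz
    exact ⟨j, hj, hjz.2⟩
  have hdist : ‖z - x‖ ≤ δ / k := by
    have h1 : φ z ≤ φ x := hzmin (hZ x hx htx hact)
    have h2 : f i x ≤ s := hl'i ▸ hx.2 i
    simp only [φ, sub_self, norm_zero] at h1
    have h3 : k ^ 2 / δ * ‖z - x‖ ^ 2 ≤ δ := by
      rw [hδ] at *
      nlinarith
    refine le_of_sq_le_sq ?_ (by positivity)
    rw [div_pow, le_div_iff₀ (by positivity)]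
    calc ‖z - x‖ ^ 2 * k ^ 2 = (k ^ 2 / δ * ‖z - x‖ ^ 2) * δ := by field_simp
      _ ≤ δ * δ := by gcongr
      _ = δ ^ 2 := by ring
  refine ⟨z, ?_, by rw [dist_eq_norm, hk']; exact hdist⟩
  -- A minimiser on either bounding level would be an edge point, so it lies strictly inside the
  -- slab and the bounds on `f i` do not constrain nearby competitors.
  by_contra hne
  rw [mem_union, not_or] at hne
  obtain ⟨hne1, hne2⟩ := hne
  have hzi' : lam i < f i z := by
    refine hzi.lt_of_ne fun heq => hne1 (h.mem_edge hlam (i := i) ⟨hzX, fun j => ?_⟩ heq.symm hzact')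
    by_cases hj : j = i
    · subst hj; exact heq.ge
    · rw [← hl'j j hj]; exact hzK.2 j
  have hzs : f i z < s := by
    refine (hl'i ▸ hzK.2 i : f i z ≤ s).lt_of_ne fun heq => hne2
      (h.mem_edge hlam' (i := i) hzK (heq.trans hl'i.symm) (hzact'.imp id ?_))
    rintro ⟨j, hj, hjz⟩
    exact ⟨j, hj, by rw [hl'j j hj, hjz]⟩
  set g := gradientWithin (f i) X z with hg
  set q := g + (2 * (k ^ 2 / δ)) • (z - x) with hq
  have hgnd : εnd ≤ ‖g‖ := h.nd.2 i z hzX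
  have hgq : ‖g - q‖ < εtr * ‖g‖ := by
    have h1 : ‖g - q‖ ≤ 2 * k := by
      rw [hq, sub_add_cancel_left, norm_neg, norm_smul, Real.norm_of_nonneg (by positivity)]
      calc 2 * (k ^ 2 / δ) * ‖z - x‖ ≤ 2 * (k ^ 2 / δ) * (δ / k) := by gcongr
        _ = 2 * k := by field_simp
    have h2 : εtr * εnd ≤ εtr * ‖g‖ := by gcongr
    have h3 : 0 < εtr * εnd := by positivity
    linarith
  have hpen : HasStrictFDerivAt (fun z => k ^ 2 / δ * ‖z - x‖ ^ 2)
      (toDual ℝ (E d) ((2 * (k ^ 2 / δ)) • (z - x))) z := by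
    have h1 : HasStrictFDerivAt (fun z => ‖z - x‖ ^ 2) _ z :=
      (hasStrictFDerivAt_norm_sq (z - x)).comp z ((hasStrictFDerivAt_id z).sub_const x)
    refine (h1.const_mul (k ^ 2 / δ)).congr_fderiv ?_
    ext y
    simp
    ring
  -- transversality at the level through `z`
  set lam'' := Function.update lam i (f i z) with hl''
  have hcube : lam'' ∈ cube lam0 T := update_mem_cube hlam hlam' hzi hzs.le
  have hzK'' : z ∈ K X f lam'' := by
    refine ⟨hzX, fun j => ?_⟩
    by_cases hj : j = i
    · subst hj; simp [hl'']
    · rw [hl'', Function.update_of_ne hj, ← hl'j j hj]; exact hzK.2 j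
  have hi'' : f i z = lam'' i := by simp [hl'']
  obtain ⟨htr1, htr2⟩ := htr lam'' ((mem_cube_iff hT0.le).1 hcube) z (h.mem_frontier_K hzK'' hi'')
  have hcont : ∀ j, Tendsto (f j) (𝓝[X] z) (𝓝 (f j z)) := fun j => h.continuousOn j z hzX
  have hevi : ∀ᶠ z' in 𝓝[X] z, lam i < f i z' ∧ f i z' < s :=
    ((hcont i).eventually (lt_mem_nhds hzi')).and ((hcont i).eventually (gt_mem_nhds hzs))
  -- On the frontier of `X` no other constraint with index `≠ i` is active, since two active
  -- constraints would make `z` an edge point of the upper set. So `z` is a local minimum along the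
  -- frontier alone.
  by_cases hzf : z ∈ frontier X
  · have hlt : ∀ j, j ≠ i → f j z < lam j := fun j hj => by
      refine (hl'j j hj ▸ hzK.2 j : f j z ≤ lam j).lt_of_ne fun heq => hne2 ?_
      exact h.mem_edge hlam' (i := j) hzK (by rw [hl'j j hj, heq]) (Or.inl hzf)
    have hev : ∀ᶠ z' in 𝓝[X] z, ∀ j, j ≠ i → f j z' < lam j := by
      rw [eventually_all]
      intro j
      by_cases hj : j = i
      · simp [hj]
      · filter_upwards [(hcont j).eventually (gt_mem_nhds (hlt j hj))] with z' hz' _ using hz'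
    obtain ⟨u, hu, hu0, c, hc⟩ := exists_normal_parallel_of_min_frontier h.convex hclX
      h.interior_nonempty hzf (φ := φ) (q := q) (by
        rw [hq, map_add]
        exact (hasFDerivWithinAt_gradientWithin (h.diff i) hzX).add
          hpen.hasFDerivAt.hasFDerivWithinAt) (by
        have := eventually_nhdsWithin_iff.1 (hev.and hevi)
        filter_upwards [this] with z' hz' hz'f
        have hz'X := hclX.frontier_subset hz'f
        obtain ⟨a, b⟩ := hz' hz'X
        refine hzmin (hZ z' ⟨hz'X, fun j => ?_⟩ b.1.le (Or.inl hz'f))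
        by_cases hj : j = i
        · subst hj; rw [hl'i]; exact b.2.le
        · rw [hl'j j hj]; exact (a j hj).le)
    have := mul_norm_le_norm_sub_smul_of_cosSq_le hu0 (h.gradientWithin_ne_zero i hzX)
      (htr2 i hi'' hzf u hu hu0) c
    rw [← hc] at this
    linarith
  -- In the interior exactly one other constraint `j` is active, and the Lagrange multiplier rule
  -- applies on the level set of `f j`.
  · obtain ⟨j, hji, hjz⟩ := hzact'.resolve_left hzf
    have hzint : z ∈ interior X := by
      by_contra hni
      exact hzf ⟨subset_closure hzX, hni⟩
    have hlt : ∀ l, l ≠ i → l ≠ j → f l z < lam l := fun l hl hlj => by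
      refine (hl'j l hl ▸ hzK.2 l : f l z ≤ lam l).lt_of_ne fun heq => hne2 ?_
      exact h.mem_edge hlam' (i := j) hzK (by rw [hl'j j hji, hjz])
        (Or.inr ⟨l, hlj, by rw [hl'j l hl, heq]⟩)
    have hev : ∀ᶠ z' in 𝓝[X] z, ∀ l, l ≠ i → l ≠ j → f l z' < lam l := by
      rw [eventually_all]
      intro l
      by_cases hl : l = i
      · simp [hl]
      by_cases hlj : l = j
      · simp [hlj]
      · filter_upwards [(hcont l).eventually (gt_mem_nhds (hlt l hl hlj))] with z' hz' _ _ using hz'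
    have hnhds : 𝓝[X] z = 𝓝 z := nhdsWithin_eq_nhds.2 (mem_interior_iff_mem_nhds.1 hzint)
    rw [hnhds] at hev hevi
    have hextr : IsLocalExtrOn φ {z' | f j z' = f j z} z := by
      left
      refine eventually_nhdsWithin_iff.2 ?_
      filter_upwards [hev, hevi, mem_interior_iff_mem_nhds.1 hzint] with z' a b hz'X hz'j
      replace hz'j : f j z' = f j z := hz'j
      refine hzmin (hZ z' ⟨hz'X, fun l => ?_⟩ b.1.le (Or.inr ⟨j, hji, hz'j.trans hjz⟩))
      by_cases hl : l = i
      · subst hl; rw [hl'i]; exact b.2.le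
      · rw [hl'j l hl]
        by_cases hlj : l = j
        · subst hlj; rw [hz'j, hjz]
        · exact (a l hl hlj).le
    obtain ⟨a, b, hab, heq⟩ := hextr.exists_multipliers_of_hasStrictFDerivAt_1d
      (hasStrictFDerivAt_of_mem_interior (h.diff j) (h.lip j) hzint)
      ((hasStrictFDerivAt_of_mem_interior (h.diff i) (h.lip i) hzint).add hpen)
    rw [← map_add, ← hg, ← hq] at heq
    have heq' : a • gradientWithin (f j) X z + b • q = 0 := by
      apply (toDual ℝ (E d)).injective
      simpa using heq
    have hgj := h.gradientWithin_ne_zero j hzX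
    -- The multiplier rule is not degenerate because the gradient of `f j` does not vanish.
    have hb : b ≠ 0 := by
      rintro rfl
      have : a = 0 := by simpa [hgj] using heq'
      exact hab (by simp [this])
    have hqc : q = (-(a / b)) • gradientWithin (f j) X z := by
      have h1 : b • q = b • ((-(a / b)) • gradientWithin (f j) X z) := by
        rw [eq_neg_of_add_eq_zero_right heq', smul_smul, ← neg_smul]
        congr 1
        field_simp
      exact smul_right_injective _ hb h1
    have hj'' : f j z = lam'' j := by rw [hl'', Function.update_of_ne hji, hjz]
    have := mul_norm_le_norm_sub_smul_of_cosSq_le hgj (h.gradientWithin_ne_zero i hzX)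
      (htr1 j i hji hj'' hi'') (-(a / b))
    rw [← hqc] at this
    linarith

end Setup

end LocReg

/-! ### Orthogonal coordinates and an area formula for graphs. -/

namespace LocReg

open Set Metric Filter Topology InnerProductSpace MeasureTheory

variable {d N n : ℕ}

/-- Orthogonal coordinates on `ℝ^(n+1)` adapted to a unit vector `v`. -/
structure Coords (v : E (n + 1)) where
  /-- The isometry onto the orthogonal complement of `v`. -/
  T : E n →ₗᵢ[ℝ] E (n + 1)
  /-- The projection along `v`. -/
  P : E (n + 1) →L[ℝ] E n
  inner_T : ∀ y, inner ℝ v (T y) = 0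
  decomp : ∀ x, T (P x) + (inner ℝ v x : ℝ) • v = x
  mp : MeasurePreserving (fun p : E n × ℝ => T p.1 + p.2 • v)

/-- Extend `v` to an orthonormal basis with `b 0 = v`. `T` fills in the other coordinates, and the
measure statement is a composition of measure-preserving identifications. -/
lemma exists_coords {v : E (n + 1)} (hv : ‖v‖ = 1) : Nonempty (Coords v) := by
  obtain ⟨b, hb⟩ := Orthonormal.exists_orthonormalBasis_extension_of_card_eq (𝕜 := ℝ)
    (E := E (n + 1)) (ι := Fin (n + 1)) (by simp) (v := fun _ => v) (s := {0}) (by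
      refine ⟨fun i => by simpa using hv, fun i j hij => absurd (Subsingleton.elim i j) hij⟩)
  replace hb : b 0 = v := hb 0 rfl
  let T0 : E n →ₗ[ℝ] E (n + 1) :=
    { toFun := fun y => b.repr.symm (WithLp.toLp 2 (Fin.cons 0 y : Fin (n + 1) → ℝ))
      map_add' := fun y y' => by
        rw [← map_add]
        congr 1
        ext j
        refine Fin.cases ?_ (fun j => ?_) j <;> simp
      map_smul' := fun c y => by
        rw [RingHom.id_apply, ← map_smul]
        congr 1
        ext j
        refine Fin.cases ?_ (fun j => ?_) j <;> simp }
  let T : E n →ₗᵢ[ℝ] E (n + 1) := ⟨T0, fun y => by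
    simp only [T0, LinearMap.coe_mk, AddHom.coe_mk, LinearIsometryEquiv.norm_map]
    rw [EuclideanSpace.norm_eq, EuclideanSpace.norm_eq, Fin.sum_univ_succ]
    simp⟩
  let P : E (n + 1) →L[ℝ] E n := LinearMap.toContinuousLinearMap
    { toFun := fun x => WithLp.toLp 2 (fun j : Fin n => b.repr x j.succ)
      map_add' := fun x x' => by ext j; simp
      map_smul' := fun c x => by ext j; simp }
  have hvr : b.repr v = EuclideanSpace.single 0 1 := by
    rw [← hb]; exact b.repr_self 0
  have hsum : ∀ (y : E n) (τ : ℝ), T y + τ • v =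
      b.repr.symm (WithLp.toLp 2 (Fin.cons τ y : Fin (n + 1) → ℝ)) := by
    intro y τ
    apply b.repr.injective
    rw [map_add, map_smul, hvr]
    simp only [T, T0, LinearIsometry.coe_mk, LinearMap.coe_mk, AddHom.coe_mk,
      LinearIsometryEquiv.apply_symm_apply]
    ext j
    refine Fin.cases ?_ (fun j => ?_) j <;> simp
  have hin : ∀ x, inner ℝ v x = b.repr x 0 := fun x => by rw [← hb]; exact (b.repr_apply_apply x 0).symm
  refine ⟨⟨T, P, fun y => ?_, fun x => ?_, ?_⟩⟩
  · rw [hin]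
    simp [T, T0]
  · rw [hsum, LinearIsometryEquiv.symm_apply_eq, hin]
    ext j
    refine Fin.cases ?_ (fun j => ?_) j <;> simp [P]
  · have h1 : MeasurePreserving (Prod.swap : E n × ℝ → ℝ × E n) := Measure.measurePreserving_swap
    have h2 : MeasurePreserving (Prod.map id WithLp.ofLp : ℝ × E n → ℝ × (Fin n → ℝ)) :=
      (MeasurePreserving.id volume).prod (PiLp.volume_preserving_ofLp (Fin n))
    have h3 := (volume_preserving_piFinSuccAbove (fun _ : Fin (n + 1) => ℝ) 0).symm
    have h4 := PiLp.volume_preserving_toLp (Fin (n + 1))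
    have h5 := b.measurePreserving_repr_symm
    have := h5.comp (h4.comp (h3.comp (h2.comp h1)))
    have heq : (fun p : E n × ℝ => T p.1 + p.2 • v) = b.repr.symm ∘ WithLp.toLp 2 ∘
        (MeasurableEquiv.piFinSuccAbove (fun _ => ℝ) 0).symm ∘
        Prod.map id WithLp.ofLp ∘ Prod.swap := by
      funext p
      rw [hsum]
      simp only [Function.comp_apply]
      congr 2
      ext j
      refine Fin.cases ?_ (fun j => ?_) j <;>
        simp [MeasurableEquiv.piFinSuccAbove_symm_apply, Fin.insertNthEquiv]
    rw [heq]
    exact this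

namespace Coords

variable {v : E (n + 1)} (c : Coords v)

lemma norm_sq_eq (hv : ‖v‖ = 1) (x : E (n + 1)) : ‖x‖ ^ 2 = ‖c.P x‖ ^ 2 + inner ℝ v x ^ 2 := by
  conv_lhs => rw [← c.decomp x]
  rw [@norm_add_sq_real, inner_smul_right, real_inner_comm v, c.inner_T, norm_smul, hv,
    LinearIsometry.norm_map]
  simp

lemma inner_T_add (hv : ‖v‖ = 1) (y : E n) (τ : ℝ) : inner ℝ v (c.T y + τ • v) = τ := by
  rw [inner_add_right, c.inner_T, inner_smul_right, real_inner_self_eq_norm_sq, hv]; simp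

lemma P_T_add (hv : ‖v‖ = 1) (y : E n) (τ : ℝ) : c.P (c.T y + τ • v) = y := by
  have := c.decomp (c.T y + τ • v)
  rw [c.inner_T_add hv, add_left_inj] at this
  exact c.T.injective this

lemma norm_P_le (hv : ‖v‖ = 1) (x : E (n + 1)) : ‖c.P x‖ ≤ ‖x‖ := by
  refine le_of_sq_le_sq ?_ (norm_nonneg _)
  rw [c.norm_sq_eq hv x]
  nlinarith [sq_nonneg (inner ℝ v x : ℝ)]

end Coords

/-- Comparison of measures is local. -/
lemma measure_le_of_local {β : Type*} [TopologicalSpace β] [SecondCountableTopology β]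
    [MeasurableSpace β] [OpensMeasurableSpace β] {μ ν : Measure β} {S : Set β}
    (h : ∀ x ∈ S, ∃ U ∈ 𝓝 x, ∀ B ⊆ U, MeasurableSet B → μ B ≤ ν B) {B : Set β}
    (hBS : B ⊆ S) (hB : MeasurableSet B) : μ B ≤ ν B := by
  choose! U hU hUB using h
  obtain ⟨t, htS, htc, ht⟩ := TopologicalSpace.countable_cover_nhdsWithin (s := S)
    (f := fun x => interior (U x))
    fun x hx => mem_nhdsWithin_of_mem_nhds (interior_mem_nhds.2 (hU x hx))
  rcases t.eq_empty_or_nonempty with rfl | hne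
  · have : B = ∅ := subset_eq_empty hBS (subset_eq_empty ht (by simp))
    simp [this]
  obtain ⟨e, he⟩ := htc.exists_eq_range hne
  have heS : ∀ k, e k ∈ S := fun k => htS (he ▸ mem_range_self k)
  -- A countable subcover, made disjoint, allows the local inequalities to be summed.
  let V : ℕ → Set β := disjointed fun k => interior (U (e k))
  have hVm : ∀ k, MeasurableSet (V k) :=
    MeasurableSet.disjointed fun k => isOpen_interior.measurableSet
  have hBV : B = ⋃ k, B ∩ V k := by
    rw [← inter_iUnion, iUnion_disjointed, eq_comm, inter_eq_left]
    refine hBS.trans (ht.trans ?_)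
    rw [he, biUnion_range]
  have hdisj : Pairwise (Function.onFun Disjoint fun k => B ∩ V k) := fun i j hij =>
    (disjoint_disjointed _ hij).mono inter_subset_right inter_subset_right
  rw [hBV, measure_iUnion hdisj fun k => hB.inter (hVm k),
    measure_iUnion hdisj fun k => hB.inter (hVm k)]
  refine ENNReal.tsum_le_tsum fun k => hUB (e k) (heS k) _ ?_ (hB.inter (hVm k))
  exact inter_subset_right.trans ((disjointed_subset _ _).trans interior_subset)

lemma euclideanHausdorffMeasure_image_le {F F' : Type*} [EMetricSpace F] [MeasurableSpace F]
    [BorelSpace F] [EMetricSpace F'] [MeasurableSpace F'] [BorelSpace F'] {Φ : F → F'} {s : Set F}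
    {L : ℝ≥0} (h : LipschitzOnWith L Φ s) (n : ℕ) : μHE[n] (Φ '' s) ≤ (L : ℝ≥0∞) ^ n * μHE[n] s := by
  rw [Measure.euclideanHausdorffMeasure_def, Measure.euclideanHausdorffMeasure_def,
    Measure.smul_apply, Measure.smul_apply, ENNReal.smul_def, ENNReal.smul_def, smul_eq_mul,
    smul_eq_mul, mul_left_comm]
  gcongr
  simpa using h.hausdorffMeasure_image_le (d := n) (by positivity)

/-- A map close to an expanding linear map `A` scales volumes almost like `A`. -/
lemma euclideanHausdorffMeasure_image_of_approximatesLinearOn {Φ : E n → E d}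
    {A : E n →L[ℝ] E d} {s : Set (E n)} {δ : ℝ≥0} (hδ : δ < 1)
    (hA : ∀ y, ‖y‖ ≤ ‖A y‖) (h : ApproximatesLinearOn Φ A s δ) :
    μHE[n] (Φ '' s) ≤ (1 + δ : ℝ≥0) ^ n * (ENNReal.ofReal (A : E n →ₗ[ℝ] E d).normDet * volume s) ∧
    ((1 - δ : ℝ≥0) : ℝ≥0∞) ^ n * (ENNReal.ofReal (A : E n →ₗ[ℝ] E d).normDet * volume s) ≤
      μHE[n] (Φ '' s) := by
  have hvol : μHE[n] (A '' s) = ENNReal.ofReal (A : E n →ₗ[ℝ] E d).normDet * volume s := by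
    simpa using LinearMap.euclideanHausdorffMeasure_image_eq_normDet_mul_volume
      (A : E n →ₗ[ℝ] E d) s
  -- As `A` is expanding, the error is small relative to `‖A (x - y)‖`. Hence the map from the
  -- linear image to the true image is `(1 + δ)`-Lipschitz and its inverse is `(1 - δ)⁻¹`-Lipschitz.
  have happ : ∀ x ∈ s, ∀ y ∈ s, ‖Φ x - Φ y - A (x - y)‖ ≤ δ * ‖A (x - y)‖ := fun x hx y hy =>
    (h x hx y hy).trans (by gcongr; exact hA _)
  have hAinj : Function.Injective A := fun x y hxy => by
    have := hA (x - y)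
    rw [map_sub, hxy, sub_self, norm_zero] at this
    exact sub_eq_zero.1 (norm_le_zero_iff.1 this)
  have hΦinj : InjOn Φ s := fun x hx y hy hxy => by
    have := happ x hx y hy
    rw [hxy, sub_self, zero_sub, norm_neg] at this
    have hlt : (δ : ℝ) < 1 := hδ
    have h0 : ‖A (x - y)‖ ≤ 0 := by nlinarith [norm_nonneg (A (x - y))]
    rw [norm_le_zero_iff, map_sub, sub_eq_zero] at h0
    exact hAinj h0
  rw [← hvol]
  constructor
  · have hl : LipschitzOnWith (1 + δ) (fun z => Φ (Function.invFun A z)) (A '' s) := by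
      refine LipschitzOnWith.of_dist_le_mul ?_
      rintro _ ⟨x, hx, rfl⟩ _ ⟨y, hy, rfl⟩
      rw [Function.leftInverse_invFun hAinj x, Function.leftInverse_invFun hAinj y, dist_eq_norm,
        dist_eq_norm, ← map_sub]
      have := happ x hx y hy
      have h2 := norm_add_le (Φ x - Φ y - A (x - y)) (A (x - y))
      rw [sub_add_cancel] at h2
      push_cast
      linarith
    have := euclideanHausdorffMeasure_image_le hl n
    rw [image_image] at this
    simpa only [Function.leftInverse_invFun hAinj _] using this
  · have hδ' : 0 < 1 - δ := tsub_pos_of_lt hδ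
    have hl : LipschitzOnWith (1 - δ)⁻¹ (fun z => A (Function.invFunOn Φ s z)) (Φ '' s) := by
      refine LipschitzOnWith.of_dist_le_mul ?_
      rintro _ ⟨x, hx, rfl⟩ _ ⟨y, hy, rfl⟩
      rw [hΦinj.leftInvOn_invFunOn hx, hΦinj.leftInvOn_invFunOn hy, dist_eq_norm,
        dist_eq_norm, ← map_sub]
      have := happ x hx y hy
      have h2 := norm_sub_le (Φ x - Φ y) (Φ x - Φ y - A (x - y))
      rw [sub_sub_cancel] at h2
      rw [NNReal.coe_inv, ← div_eq_inv_mul, le_div_iff₀ (by exact_mod_cast hδ'),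
        NNReal.coe_sub hδ.le, NNReal.coe_one]
      linarith
    have := euclideanHausdorffMeasure_image_le hl n
    rw [image_image, image_congr fun x hx => by rw [hΦinj.leftInvOn_invFunOn hx]] at this
    calc _ ≤ ((1 - δ : ℝ≥0) : ℝ≥0∞) ^ n * ((((1 - δ : ℝ≥0)⁻¹ : ℝ≥0) : ℝ≥0∞) ^ n * μHE[n] (Φ '' s)) := by
          gcongr
      _ = μHE[n] (Φ '' s) := by
          rw [← mul_assoc, ← mul_pow, ← ENNReal.coe_mul, mul_inv_cancel₀ hδ'.ne']
          simp

/-- The area formula for a measurable embedding which is continuously differentiable, with expanding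
derivative, on an open set. -/
lemma restrict_comap_euclideanHausdorffMeasure {Φ : E n → E d} (hΦ : MeasurableEmbedding Φ)
    {S : Set (E n)} (hS : IsOpen S) {Φ' : E n → E n →L[ℝ] E d}
    (hst : ∀ y ∈ S, HasStrictFDerivAt Φ (Φ' y) y) (hexp : ∀ y ∈ S, ∀ z, ‖z‖ ≤ ‖Φ' y z‖)
    {J : E n → ℝ} (hJ : ∀ y ∈ S, (Φ' y : E n →ₗ[ℝ] E d).normDet = J y) (hJc : ContinuousOn J S)
    (hJ0 : ∀ y ∈ S, 0 < J y) :
    (Measure.comap Φ μHE[n]).restrict S =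
      (volume.restrict S).withDensity (fun y => ENNReal.ofReal (J y)) := by
  set ν := Measure.comap Φ μHE[n] with hν
  set μ := (volume.restrict S).withDensity (fun y => ENNReal.ofReal (J y)) with hμ
  have hνB : ∀ B, ν B = μHE[n] (Φ '' B) := fun B => hΦ.comap_apply _ B
  have hμB : ∀ B ⊆ S, MeasurableSet B → μ B = ∫⁻ y in B, ENNReal.ofReal (J y) := by
    intro B hBS hB
    rw [hμ, withDensity_apply _ hB, Measure.restrict_restrict hB, inter_eq_left.2 hBS]
  -- The factors `(1 ± δ) ^ n` come from the linear approximation, the single factors `1 ± δ` from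
  -- the oscillation of `J`. They are placed so that nothing is divided in `ℝ≥0∞`, and all tend to
  -- one in the final limit.
  have hloc : ∀ δ : ℝ≥0, 0 < δ → δ < 1 → ∀ y ∈ S, ∃ U ∈ 𝓝 y, ∀ B ⊆ U, MeasurableSet B →
      ((1 - δ : ℝ≥0) • ν) B ≤ (((1 + δ) ^ n : ℝ≥0) • μ) B ∧
      (((1 - δ) ^ n : ℝ≥0) • μ) B ≤ ((1 + δ : ℝ≥0) • ν) B := by
    intro δ hδ0 hδ1 y hy
    obtain ⟨U, hU, hUa⟩ := (hst y hy).approximates_deriv_on_nhds (Or.inr hδ0)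
    have hJy := hJ0 y hy
    have hδ0' : (0 : ℝ) < δ := hδ0
    have hcont := (hJc.continuousAt (hS.mem_nhds hy)).tendsto
    have h1 : ∀ᶠ z in 𝓝 y, (1 - δ) * J y < J z :=
      hcont.eventually (lt_mem_nhds (by nlinarith))
    have h2 : ∀ᶠ z in 𝓝 y, J z < (1 + δ) * J y :=
      hcont.eventually (gt_mem_nhds (by nlinarith))
    refine ⟨_, inter_mem (inter_mem hU (hS.mem_nhds hy)) (h1.and h2), fun B hB hBm => ?_⟩
    obtain ⟨hup, hlow⟩ := euclideanHausdorffMeasure_image_of_approximatesLinearOn hδ1 (hexp y hy)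
      (hUa.mono_set fun z hz => (hB hz).1.1)
    rw [hJ y hy] at hup hlow
    have hcm1 : ((1 - δ : ℝ≥0) : ℝ≥0∞) * (ENNReal.ofReal (J y) * volume B) ≤
        ∫⁻ y in B, ENNReal.ofReal (J y) := by
      rw [← mul_assoc, ← ENNReal.ofReal_coe_nnreal, ← ENNReal.ofReal_mul (by positivity),
        NNReal.coe_sub hδ1.le, NNReal.coe_one, ← setLIntegral_const]
      exact setLIntegral_mono' hBm fun z hz => ENNReal.ofReal_le_ofReal (hB hz).2.1.le
    have hcm2 : ∫⁻ y in B, ENNReal.ofReal (J y) ≤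
        ((1 + δ : ℝ≥0) : ℝ≥0∞) * (ENNReal.ofReal (J y) * volume B) := by
      rw [← mul_assoc, ← ENNReal.ofReal_coe_nnreal, ← ENNReal.ofReal_mul (by positivity),
        NNReal.coe_add, NNReal.coe_one, ← setLIntegral_const]
      exact setLIntegral_mono' hBm fun z hz => ENNReal.ofReal_le_ofReal (hB hz).2.2.le
    simp only [Measure.smul_apply, ENNReal.smul_def, smul_eq_mul]
    rw [hμB B (fun z hz => (hB hz).1.2) hBm, hνB]
    constructor
    · calc ((1 - δ : ℝ≥0) : ℝ≥0∞) * μHE[n] (Φ '' B)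
          ≤ ((1 - δ : ℝ≥0) : ℝ≥0∞) * (((1 + δ : ℝ≥0) : ℝ≥0∞) ^ n *
            (ENNReal.ofReal (J y) * volume B)) := by gcongr
        _ = ((1 + δ : ℝ≥0) : ℝ≥0∞) ^ n * (((1 - δ : ℝ≥0) : ℝ≥0∞) *
            (ENNReal.ofReal (J y) * volume B)) := by ring
        _ ≤ _ := by rw [ENNReal.coe_pow]; gcongr
    · calc (((1 - δ) ^ n : ℝ≥0) : ℝ≥0∞) * ∫⁻ y in B, ENNReal.ofReal (J y)
          ≤ ((1 - δ : ℝ≥0) : ℝ≥0∞) ^ n * (((1 + δ : ℝ≥0) : ℝ≥0∞) *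
            (ENNReal.ofReal (J y) * volume B)) := by rw [ENNReal.coe_pow]; gcongr
        _ = ((1 + δ : ℝ≥0) : ℝ≥0∞) * (((1 - δ : ℝ≥0) : ℝ≥0∞) ^ n *
            (ENNReal.ofReal (J y) * volume B)) := by ring
        _ ≤ _ := by gcongr
  have hglob : ∀ δ : ℝ≥0, 0 < δ → δ < 1 → ∀ B ⊆ S, MeasurableSet B →
      ((1 - δ : ℝ≥0) • ν) B ≤ (((1 + δ) ^ n : ℝ≥0) • μ) B ∧
      (((1 - δ) ^ n : ℝ≥0) • μ) B ≤ ((1 + δ : ℝ≥0) • ν) B := by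
    intro δ hδ0 hδ1 B hBS hB
    constructor
    · exact measure_le_of_local (fun y hy => by
        obtain ⟨U, hU, hUB⟩ := hloc δ hδ0 hδ1 y hy
        exact ⟨U, hU, fun B h1 h2 => (hUB B h1 h2).1⟩) hBS hB
    · exact measure_le_of_local (fun y hy => by
        obtain ⟨U, hU, hUB⟩ := hloc δ hδ0 hδ1 y hy
        exact ⟨U, hU, fun B h1 h2 => (hUB B h1 h2).2⟩) hBS hB
  have hlim : ∀ (p : ℝ≥0 → ℝ≥0) (a : ℝ≥0∞), Continuous p → p 0 = 1 →
      Tendsto (fun δ => (p δ : ℝ≥0∞) * a) (𝓝[>] 0) (𝓝 a) := by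
    intro p a hp hp0
    have h1 : Tendsto (fun δ => (p δ : ℝ≥0∞)) (𝓝[>] 0) (𝓝 1) := by
      have := (ENNReal.continuous_coe.comp hp).tendsto 0
      simp only [Function.comp, hp0, ENNReal.coe_one] at this
      exact this.mono_left nhdsWithin_le_nhds
    simpa using ENNReal.Tendsto.mul_const h1 (Or.inl one_ne_zero) (b := a)
  have hev : ∀ᶠ δ : ℝ≥0 in 𝓝[>] 0, 0 < δ ∧ δ < 1 := by
    filter_upwards [self_mem_nhdsWithin, mem_nhdsWithin_of_mem_nhds (gt_mem_nhds one_pos)]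
      with δ h1 h2 using ⟨h1, h2⟩
  have heq : ∀ B ⊆ S, MeasurableSet B → ν B = μ B := by
    intro B hBS hB
    refine le_antisymm ?_ ?_
    · refine le_of_tendsto_of_tendsto (hlim (fun δ => 1 - δ) (ν B) (by fun_prop) (by simp))
        (hlim (fun δ => (1 + δ) ^ n) (μ B) (by fun_prop) (by simp)) ?_
      filter_upwards [hev] with δ hδ
      exact (hglob δ hδ.1 hδ.2 B hBS hB).1
    · refine le_of_tendsto_of_tendsto (hlim (fun δ => (1 - δ) ^ n) (μ B) (by fun_prop) (by simp))
        (hlim (fun δ => 1 + δ) (ν B) (by fun_prop) (by simp)) ?_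
      filter_upwards [hev] with δ hδ
      exact (hglob δ hδ.1 hδ.2 B hBS hB).2
  have hμS : μ = μ.restrict S := by
    rw [hμ, restrict_withDensity hS.measurableSet, Measure.restrict_restrict hS.measurableSet,
      inter_self]
  rw [hμS]
  ext B hB
  rw [Measure.restrict_apply hB, Measure.restrict_apply hB]
  exact heq _ inter_subset_right (hB.inter hS.measurableSet)

namespace Coords

variable {v : E (n + 1)} (c : Coords v)

/-- The derivative of a graph in the direction `v` over the orthogonal complement of `v`. -/
noncomputable def graphDeriv (a : E n) : E n →L[ℝ] E (n + 1) :=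
  c.T.toContinuousLinearMap + (toDual ℝ (E n) a).smulRight v

lemma graphDeriv_apply (a y : E n) : c.graphDeriv a y = c.T y + (inner ℝ a y : ℝ) • v := by
  simp [graphDeriv]

lemma inner_graphDeriv (hv : ‖v‖ = 1) (a y z : E n) :
    inner ℝ (c.graphDeriv a y) (c.graphDeriv a z) = inner ℝ y z + inner ℝ a y * inner ℝ a z := by
  rw [graphDeriv_apply, graphDeriv_apply, inner_add_left, inner_add_right, inner_add_right,
    inner_smul_left, inner_smul_right, inner_smul_left, inner_smul_right, c.inner_T,
    real_inner_comm v, c.inner_T, LinearIsometry.inner_map_map, real_inner_self_eq_norm_sq v, hv]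
  simp

lemma norm_le_norm_graphDeriv (hv : ‖v‖ = 1) (a y : E n) : ‖y‖ ≤ ‖c.graphDeriv a y‖ := by
  refine le_of_sq_le_sq ?_ (norm_nonneg _)
  rw [← real_inner_self_eq_norm_sq, ← real_inner_self_eq_norm_sq, c.inner_graphDeriv hv]
  nlinarith [sq_nonneg (inner ℝ a y : ℝ)]

/-- The Gram operator is the identity plus the rank-one map `y ↦ ⟪a, y⟫ a`, of determinant `1 +
‖a‖²`. -/
lemma normDet_graphDeriv (hv : ‖v‖ = 1) (a : E n) :
    (c.graphDeriv a : E n →ₗ[ℝ] E (n + 1)).normDet = √(1 + ‖a‖ ^ 2) := by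
  have h1 := LinearMap.normDet_sq (c.graphDeriv a : E n →ₗ[ℝ] E (n + 1))
  have h2 : LinearMap.adjoint (c.graphDeriv a : E n →ₗ[ℝ] E (n + 1)) ∘ₗ
      (c.graphDeriv a : E n →ₗ[ℝ] E (n + 1)) =
      LinearMap.transvection ((toDual ℝ (E n) a : E n →L[ℝ] ℝ) : E n →ₗ[ℝ] ℝ) a := by
    ext1 y
    refine ext_inner_right ℝ fun z => ?_
    rw [LinearMap.comp_apply, LinearMap.adjoint_inner_left]
    have := c.inner_graphDeriv hv a y z
    simp only [ContinuousLinearMap.coe_coe, LinearMap.transvection.apply, toDual_apply_apply,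
      inner_add_left, inner_smul_left, conj_trivial] at this ⊢
    exact this
  rw [h2, LinearMap.transvection.det] at h1
  simp only [ContinuousLinearMap.coe_coe, toDual_apply_apply, real_inner_self_eq_norm_sq] at h1
  rw [← h1]
  simp [Real.sqrt_sq (LinearMap.normDet_nonneg _)]

end Coords

end LocReg

/-! ### Graph charts: level sets as Lipschitz graphs. -/

namespace LocReg

open Set Metric Filter Topology InnerProductSpace MeasureTheory

variable {d N n : ℕ}

/-- A function on `ℝ^(n+1)` whose level sets are Lipschitz graphs in the direction `v`. -/
structure GraphChart (n : ℕ) where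
  /-- The vertical direction. -/
  v : E (n + 1)
  norm_v : ‖v‖ = 1
  /-- Coordinates adapted to `v`. -/
  c : Coords v
  /-- The function. -/
  F : E (n + 1) → ℝ
  /-- The mean slope of `F` in the direction `v`. -/
  γ : ℝ
  γ_pos : 0 < γ
  abs_F_le : ∀ x x', |F x' - F x - γ * inner ℝ v (x' - x)| ≤ γ / 4 * ‖x' - x‖

namespace GraphChart

variable (G : GraphChart n)

/-- The point with coordinates `(y, τ)`. -/
noncomputable def line (y : E n) (τ : ℝ) : E (n + 1) := G.c.T y + τ • G.v

lemma continuous_line : Continuous fun p : E n × ℝ => G.line p.1 p.2 :=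
  (G.c.T.continuous.comp continuous_fst).add (continuous_snd.smul continuous_const)

lemma P_line (y : E n) (τ : ℝ) : G.c.P (G.line y τ) = y := G.c.P_T_add G.norm_v y τ

lemma line_P (x : E (n + 1)) : G.line (G.c.P x) (inner ℝ G.v x) = x := G.c.decomp x

lemma inner_line (y : E n) (τ : ℝ) : inner ℝ G.v (G.line y τ) = τ := G.c.inner_T_add G.norm_v y τ

lemma line_sub_line (y : E n) (a b : ℝ) : G.line y b - G.line y a = (b - a) • G.v := by
  rw [line, line]; module

lemma dist_line (y : E n) (a b : ℝ) : dist (G.line y a) (G.line y b) = |a - b| := by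
  rw [dist_eq_norm, line_sub_line, norm_smul, G.norm_v, mul_one, Real.norm_eq_abs]

lemma dist_P_le (x x' : E (n + 1)) : dist (G.c.P x) (G.c.P x') ≤ dist x x' := by
  rw [dist_eq_norm, dist_eq_norm, ← map_sub]
  exact G.c.norm_P_le G.norm_v _

lemma abs_F_line_le (y : E n) (a b : ℝ) :
    |F G (G.line y b) - G.F (G.line y a) - G.γ * (b - a)| ≤ G.γ / 4 * |b - a| := by
  have := G.abs_F_le (G.line y a) (G.line y b)
  rw [inner_sub_right, inner_line, inner_line] at this
  rwa [← dist_eq_norm, dist_line] at this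

/-- The admitted error `γ / 4` leaves a vertical slope of at least `3γ / 4`. Therefore each vertical
line meets each level exactly once, and slabs have thickness comparable to the increment of the
level. -/
lemma le_F_line_sub (y : E n) {a b : ℝ} (h : a ≤ b) :
    3 / 4 * G.γ * (b - a) ≤ G.F (G.line y b) - G.F (G.line y a) := by
  have := (abs_le.1 (G.abs_F_line_le y a b)).1
  rw [abs_of_nonneg (by linarith)] at this
  linarith

lemma continuous_F : Continuous G.F := by
  have : LipschitzWith (G.γ + G.γ / 4).toNNReal G.F := by
    refine LipschitzWith.of_dist_le_mul fun x x' => ?_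
    have hγ := G.γ_pos
    rw [Real.coe_toNNReal _ (by positivity), Real.dist_eq, dist_eq_norm]
    have h1 := G.abs_F_le x' x
    have h2 : |G.γ * inner ℝ G.v (x - x')| ≤ G.γ * ‖x - x'‖ := by
      rw [abs_mul, abs_of_pos hγ]
      gcongr
      simpa [G.norm_v] using abs_real_inner_le_norm G.v (x - x')
    have h3 := abs_add_le (G.F x - G.F x' - G.γ * inner ℝ G.v (x - x')) (G.γ * inner ℝ G.v (x - x'))
    rw [sub_add_cancel] at h3
    linarith
  exact this.continuous

lemma strictMono_F_line (y : E n) : StrictMono fun τ => G.F (G.line y τ) := fun a b hab => by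
  have := G.le_F_line_sub y hab.le
  have : 0 < 3 / 4 * G.γ * (b - a) := by have := G.γ_pos; have := sub_pos.2 hab; positivity
  dsimp only
  linarith

lemma exists_height (y : E n) (t : ℝ) : ∃ τ, G.F (G.line y τ) = t := by
  have hc : Continuous fun τ => G.F (G.line y τ) :=
    G.continuous_F.comp (G.continuous_line.comp (Continuous.prodMk_right y))
  have hγ := G.γ_pos
  -- At this distance above and below, the minimal slope has already carried `F` past `t`, so the
  -- intermediate value theorem applies.
  set u := |t - G.F (G.line y 0)| / (3 / 4 * G.γ) with hu
  have hu0 : 0 ≤ u := by positivity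
  have h1 := G.le_F_line_sub y hu0
  have h2 := G.le_F_line_sub y (neg_nonpos.2 hu0)
  have h3 : 3 / 4 * G.γ * u = |t - G.F (G.line y 0)| := by rw [hu]; field_simp
  have h4 := abs_le.1 (le_refl |t - G.F (G.line y 0)|)
  exact mem_range_of_exists_le_of_exists_ge hc ⟨-u, by linarith⟩ ⟨u, by linarith⟩

/-- The height at which `F` takes the value `t` above `y`. -/
noncomputable def height (y : E n) (t : ℝ) : ℝ := (G.exists_height y t).choose

/-- The point above `y` at which `F` takes the value `t`. -/
noncomputable def pt (t : ℝ) (y : E n) : E (n + 1) := G.line y (G.height y t)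

lemma F_pt (t : ℝ) (y : E n) : G.F (G.pt t y) = t := (G.exists_height y t).choose_spec

lemma P_pt (t : ℝ) (y : E n) : G.c.P (G.pt t y) = y := G.P_line _ _

lemma height_eq {y : E n} {t τ : ℝ} (h : G.F (G.line y τ) = t) : G.height y t = τ :=
  (G.strictMono_F_line y).injective ((G.F_pt t y).trans h.symm)

lemma pt_P {x : E (n + 1)} {t : ℝ} (h : G.F x = t) : G.pt t (G.c.P x) = x := by
  rw [pt, G.height_eq (τ := inner ℝ G.v x) (by rw [line_P, h]), line_P]

lemma height_le_iff {y : E n} {t τ : ℝ} : G.height y t ≤ τ ↔ t ≤ G.F (G.line y τ) := by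
  have h := (G.strictMono_F_line y).le_iff_le (a := G.height y t) (b := τ)
  rw [show G.F (G.line y (G.height y t)) = t from G.F_pt t y] at h
  exact h.symm

lemma le_height_iff {y : E n} {t τ : ℝ} : τ ≤ G.height y t ↔ G.F (G.line y τ) ≤ t := by
  have h := (G.strictMono_F_line y).le_iff_le (a := τ) (b := G.height y t)
  rw [show G.F (G.line y (G.height y t)) = t from G.F_pt t y] at h
  exact h.symm

lemma height_mono (y : E n) {t s : ℝ} (h : t ≤ s) : G.height y t ≤ G.height y s := by
  rw [height_le_iff]
  exact h.trans (G.F_pt s y).ge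

lemma height_sub_le (y : E n) {t s : ℝ} (h : t ≤ s) :
    3 / 4 * G.γ * (G.height y s - G.height y t) ≤ s - t := by
  have h1 := G.le_F_line_sub y (G.height_mono y h)
  have h2 := G.F_pt s y
  have h3 := G.F_pt t y
  rw [pt] at h2 h3
  rwa [h2, h3] at h1

lemma norm_T_add_smul_le (y : E n) (τ : ℝ) : ‖G.c.T y + τ • G.v‖ ≤ ‖y‖ + |τ| := by
  refine (norm_add_le _ _).trans ?_
  rw [LinearIsometry.norm_map, norm_smul, G.norm_v, mul_one, Real.norm_eq_abs]

/-- On one level the increment of `F` vanishes, so `γ |Δh| ≤ (γ / 4) (‖Δy‖ + |Δh|)`, which absorbs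
the height term on the right. -/
lemma abs_height_sub_le (t : ℝ) (y y' : E n) : |G.height y t - G.height y' t| ≤ ‖y - y'‖ := by
  have h1 := G.abs_F_le (G.pt t y') (G.pt t y)
  have hγ := G.γ_pos
  rw [F_pt, F_pt, sub_self, zero_sub, abs_neg, abs_mul, abs_of_pos hγ] at h1
  have h2 : G.pt t y - G.pt t y' = G.c.T (y - y') + (G.height y t - G.height y' t) • G.v := by
    rw [pt, pt, line, line, map_sub]; module
  have h3 : inner ℝ G.v (G.pt t y - G.pt t y') = G.height y t - G.height y' t := by
    rw [h2, G.c.inner_T_add G.norm_v]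
  rw [h3] at h1
  have h4 := G.norm_T_add_smul_le (y - y') (G.height y t - G.height y' t)
  rw [← h2] at h4
  have h5 : G.γ * |G.height y t - G.height y' t| ≤
      G.γ * ((‖y - y'‖ + |G.height y t - G.height y' t|) / 4) := by
    refine h1.trans ?_
    rw [div_mul_eq_mul_div, ← mul_div_assoc]
    gcongr
  have h6 := le_of_mul_le_mul_left h5 hγ
  linarith [norm_nonneg (y - y')]

lemma lipschitzWith_pt (t : ℝ) : LipschitzWith 2 (G.pt t) := by
  refine LipschitzWith.of_dist_le_mul fun y y' => ?_
  rw [dist_eq_norm, dist_eq_norm]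
  have h2 : G.pt t y - G.pt t y' = G.c.T (y - y') + (G.height y t - G.height y' t) • G.v := by
    rw [pt, pt, line, line, map_sub]; module
  rw [h2]
  have := G.abs_height_sub_le t y y'
  refine (G.norm_T_add_smul_le _ _).trans ?_
  push_cast
  linarith

lemma injective_pt (t : ℝ) : Function.Injective (G.pt t) := fun y y' h => by
  rw [← G.P_pt t y, h, G.P_pt]

lemma measurableEmbedding_pt (t : ℝ) : MeasurableEmbedding (G.pt t) :=
  (G.lipschitzWith_pt t).continuous.measurableEmbedding (G.injective_pt t)

lemma measurePreserving_line :
    MeasurePreserving (fun p : E n × ℝ => G.line p.1 p.2) := G.c.mp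

lemma measurableEmbedding_line : MeasurableEmbedding fun p : E n × ℝ => G.line p.1 p.2 := by
  refine G.continuous_line.measurableEmbedding fun p q h => ?_
  have h1 := congrArg G.c.P h
  have h2 := congrArg (inner ℝ G.v) h
  simp only [P_line, inner_line] at h1 h2
  exact Prod.ext h1 h2

/-- The part of a level set lying in a ball has area at most of the order of the area of a disc. -/
lemma measure_level_inter_closedBall_le {A : Set (E (n + 1))} {t : ℝ} (z : E (n + 1)) {r : ℝ}
    (hA : ∀ x ∈ A, G.F x = t ∧ dist x z ≤ r) :
    μHE[n] A ≤ 2 ^ n * volume (closedBall (0 : E n) r) := by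
  have hsub : A ⊆ G.pt t '' closedBall (G.c.P z) r := fun x hx =>
    ⟨G.c.P x, mem_closedBall.2 ((G.dist_P_le x z).trans (hA x hx).2), G.pt_P (hA x hx).1⟩
  calc μHE[n] A ≤ μHE[n] (G.pt t '' closedBall (G.c.P z) r) := measure_mono hsub
    _ ≤ ((2 : ℝ≥0) : ℝ≥0∞) ^ n * μHE[n] (closedBall (G.c.P z) r) :=
        euclideanHausdorffMeasure_image_le ((G.lipschitzWith_pt t).lipschitzOnWith) n
    _ = 2 ^ n * volume (closedBall (0 : E n) r) := by
        rw [EuclideanSpace.euclideanHausdorffMeasure_eq_volume,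
          Measure.addHaar_closedBall_center]
        rfl

lemma inner_T_eq (w : E (n + 1)) (y : E n) : inner ℝ w (G.c.T y) = inner ℝ (G.c.P w) y := by
  conv_lhs => rw [← G.c.decomp w]
  rw [inner_add_left, inner_smul_left, G.c.inner_T, LinearIsometry.inner_map_map]
  simp

/-- The slope of the level set at a point where `F` has gradient `w`. -/
noncomputable def slope (w : E (n + 1)) : E n := (-(inner ℝ w G.v)⁻¹ : ℝ) • G.c.P w

/-- Implicit differentiation: along the level set the linear part of `F` is an error term, and
dividing by `⟪w, v⟫` isolates the height. The Lipschitz bound for `pt` expresses the error in terms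
of the base points. -/
lemma hasStrictFDerivAt_pt {t : ℝ} {y : E n} {w : E (n + 1)}
    (hF : HasStrictFDerivAt G.F (toDual ℝ (E (n + 1)) w) (G.pt t y)) (hw : 0 < inner ℝ w G.v) :
    HasStrictFDerivAt (G.pt t) (G.c.graphDeriv (G.slope w)) y := by
  have hh : HasStrictFDerivAt (fun y => G.height y t) (toDual ℝ (E n) (G.slope w)) y := by
    rw [hasStrictFDerivAt_iff_isLittleO]
    have hcont : Tendsto (fun q : E n × E n => (G.pt t q.1, G.pt t q.2)) (𝓝 (y, y))
        (𝓝 (G.pt t y, G.pt t y)) := by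
      have hc := (G.lipschitzWith_pt t).continuous
      exact (Continuous.prodMk (hc.comp continuous_fst) (hc.comp continuous_snd)).tendsto (y, y)
    have h1 := (hasStrictFDerivAt_iff_isLittleO.1 hF).comp_tendsto hcont
    have h2 : (fun q : E n × E n => G.pt t q.1 - G.pt t q.2) =O[𝓝 (y, y)] fun q => q.1 - q.2 := by
      refine Asymptotics.IsBigO.of_bound 2 (Eventually.of_forall fun q => ?_)
      rw [← dist_eq_norm, ← dist_eq_norm]
      exact (G.lipschitzWith_pt t).dist_le_mul _ _
    have h3 := (h1.trans_isBigO h2).const_mul_left (-(inner ℝ w G.v)⁻¹ : ℝ)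
    refine h3.congr_left fun q => ?_
    simp only [Function.comp_apply, F_pt, sub_self, zero_sub, toDual_apply_apply]
    have h4 : G.pt t q.1 - G.pt t q.2 =
        G.c.T (q.1 - q.2) + (G.height q.1 t - G.height q.2 t) • G.v := by
      rw [pt, pt, line, line, map_sub]; module
    rw [h4, inner_add_right, inner_smul_right, inner_T_eq, slope, inner_smul_left]
    simp only [conj_trivial]
    field_simp
    ring
  exact (G.c.T.toContinuousLinearMap.hasStrictFDerivAt).add (hh.smul_const G.v)

/-- This is the area density of the graph. Its numerator cancels the norm of the gradient in the
facet integrand. -/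
lemma sqrt_one_add_norm_slope_sq {w : E (n + 1)} (hw : 0 < inner ℝ w G.v) :
    √(1 + ‖G.slope w‖ ^ 2) = ‖w‖ / inner ℝ w G.v := by
  rw [Real.sqrt_eq_iff_mul_self_eq (by positivity) (by positivity), slope, norm_smul, mul_pow,
    div_mul_div_comm, ← pow_two ‖w‖, G.c.norm_sq_eq G.norm_v w, real_inner_comm w G.v,
    Real.norm_eq_abs, sq_abs]
  field_simp
  ring

end GraphChart

end LocReg

/-! ### Charts adapted to a constraint, and the facet integral in graph coordinates. -/

namespace LocReg

open Set Metric Filter Topology InnerProductSpace MeasureTheory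

variable {d N n : ℕ}

/-- The chart `G` straightens the level sets of `f` in the part of `X` close to `p`. -/
structure GraphChart.Adapted (G : GraphChart n) (X : Set (E (n + 1))) (f : E (n + 1) → ℝ)
    (p : E (n + 1)) (r : ℝ) : Prop where
  eq : ∀ x ∈ X, dist x p ≤ 2 * r → G.F x = f x
  grad : ∀ x ∈ X, dist x p ≤ 2 * r → ‖gradientWithin f X x - G.γ • G.v‖ ≤ G.γ / 4

/-- Within distance `2r` of `p` the gradient varies by at most `4 CL r ≤ ‖g‖ / 4`. So `f i - ⟪g, ·⟫`
is `‖g‖ / 4`-Lipschitz on the convex set `X ∩ closedBall p (2r)`. Extending it to the whole space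
gives a chart defined also beyond the boundary of `X`. -/
lemma Setup.exists_chart {X : Set (E (n + 1))} {f : Fin N → E (n + 1) → ℝ} {εtr εnd : ℝ}
    {D CL : ℝ≥0} {lam0 : Fin N → ℝ} {T : ℝ} (h : Setup X f εtr εnd D CL lam0 T) (i : Fin N)
    {r : ℝ} (hr : 16 * CL * r ≤ εnd) {p x0 : E (n + 1)} (hx0 : x0 ∈ X)
    (hx0p : dist x0 p ≤ 2 * r) :
    ∃ G : GraphChart n, G.Adapted X (f i) p r ∧ εnd ≤ G.γ := by
  set g := gradientWithin (f i) X x0 with hg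
  have hg0 := h.norm_gradientWithin_pos i hx0
  have hgnd : εnd ≤ ‖g‖ := h.nd.2 i x0 hx0
  set v : E (n + 1) := ‖g‖⁻¹ • g with hv
  have hv1 : ‖v‖ = 1 := norm_smul_inv_norm (norm_pos_iff.1 hg0)
  have hgv : ‖g‖ • v = g := by rw [hv, smul_smul, mul_inv_cancel₀ hg0.ne', one_smul]
  have hgrad : ∀ x ∈ X, dist x p ≤ 2 * r → ‖gradientWithin (f i) X x - g‖ ≤ ‖g‖ / 4 := by
    intro x hx hxp
    rw [← dist_eq_norm]
    refine ((h.lip i).dist_le_mul x hx x0 hx0).trans ?_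
    have : dist x x0 ≤ 4 * r := by
      refine (dist_triangle_right x x0 p).trans ?_
      linarith
    calc CL * dist x x0 ≤ CL * (4 * r) := by gcongr
      _ ≤ ‖g‖ / 4 := by linarith
  set B := X ∩ closedBall p (2 * r) with hB
  have hBc : Convex ℝ B := h.convex.inter (convex_closedBall p _)
  have hlip : LipschitzOnWith (‖g‖ / 4).toNNReal (fun x => f i x - inner ℝ g x) B := by
    refine LipschitzOnWith.of_dist_le_mul fun x hx x' hx' => ?_
    rw [Real.coe_toNNReal _ (by positivity), Real.dist_eq, dist_eq_norm]
    have := abs_sub_sub_inner_le (h.diff i) hBc inter_subset_left (g := g) (η := ‖g‖ / 4)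
      (fun z hz => hgrad z hz.1 (mem_closedBall.1 hz.2)) hx' hx
    rw [inner_sub_right] at this
    convert! this using 2
    ring
  obtain ⟨e, he, heq⟩ := hlip.extend_real
  obtain ⟨c⟩ := exists_coords hv1
  refine ⟨⟨v, hv1, c, fun x => e x + inner ℝ g x, ‖g‖, hg0, fun x x' => ?_⟩, ⟨fun x hx hxp => ?_,
    fun x hx hxp => ?_⟩, hgnd⟩
  · have h1 := he.dist_le_mul x' x
    rw [Real.coe_toNNReal _ (by positivity), Real.dist_eq, dist_eq_norm] at h1
    have h2 : ‖g‖ * inner ℝ v (x' - x) = inner ℝ g (x' - x) := by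
      conv_rhs => rw [← hgv, inner_smul_left]
      simp only [conj_trivial]
    rw [h2, inner_sub_right]
    convert! h1 using 2
    ring
  · have := heq ⟨hx, mem_closedBall.2 hxp⟩
    dsimp only at this ⊢
    linarith
  · dsimp only
    rw [hgv]
    exact hgrad x hx hxp

namespace GraphChart.Adapted

variable {G : GraphChart n} {X : Set (E (n + 1))} {f : E (n + 1) → ℝ} {p : E (n + 1)} {r : ℝ}

lemma le_inner (hG : G.Adapted X f p r) {x : E (n + 1)} (hx : x ∈ X) (hxp : dist x p ≤ 2 * r) :
    3 / 4 * G.γ ≤ inner ℝ (gradientWithin f X x) G.v := by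
  have h1 := hG.grad x hx hxp
  have h2 := abs_real_inner_le_norm (gradientWithin f X x - G.γ • G.v) G.v
  rw [G.norm_v, mul_one, inner_sub_left, inner_smul_left, real_inner_self_eq_norm_sq,
    G.norm_v] at h2
  have h3 := (abs_le.1 (h2.trans h1)).1
  simp only [conj_trivial, one_pow, mul_one] at h3
  linarith

lemma inner_pos (hG : G.Adapted X f p r) {x : E (n + 1)} (hx : x ∈ X) (hxp : dist x p ≤ 2 * r) :
    0 < inner ℝ (gradientWithin f X x) G.v := by
  have := hG.le_inner hx hxp
  have := G.γ_pos
  linarith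

/-- In graph coordinates, the surface measure with density `1 / ‖∇f‖` becomes Lebesgue measure
with density `1 / ∂f/∂v`. -/
lemma integral_level_eq (hG : G.Adapted X f p r) (hf : DifferentiableOn ℝ f X)
    {CL : ℝ≥0} (hL : LipschitzOnWith CL (gradientWithin f X) X) (hr : 0 < r) {A : Set (E (n + 1))}
    {t : ℝ} (hA : MeasurableSet A) (hAX : A ⊆ X) (hAt : ∀ x ∈ A, f x = t)
    (hnull : μHE[n] (A ∩ frontier X) = 0) {φ : E (n + 1) → ℝ} (hφ : ∀ x, r ≤ dist x p → φ x = 0) :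
    ∫ x in A, φ x / ‖gradientWithin f X x‖ ∂μHE[n] =
      ∫ y, A.indicator (fun x => φ x / inner ℝ (gradientWithin f X x) G.v) (G.pt t y) := by
  set Φ := G.pt t with hΦ
  have hΦc : Continuous Φ := (G.lipschitzWith_pt t).continuous
  have hΦe : MeasurableEmbedding Φ := G.measurableEmbedding_pt t
  -- On `O` the chart function agrees with `f` and is strictly differentiable. What is lost outside
  -- `O` is invisible: `φ` vanishes away from `p`, and the frontier part is null.
  set O : Set (E (n + 1)) := interior X ∩ ball p (2 * r) with hO
  have hOo : IsOpen O := isOpen_interior.inter isOpen_ball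
  set S : Set (E n) := Φ ⁻¹' O with hS
  have hSo : IsOpen S := hOo.preimage hΦc
  have hOX : ∀ x ∈ O, x ∈ X ∧ dist x p ≤ 2 * r := fun x hx =>
    ⟨interior_subset hx.1, (mem_ball.1 hx.2).le⟩
  set A' := A ∩ O with hA'
  have hA'm : MeasurableSet A' := hA.inter hOo.measurableSet
  have hdiff : ∀ x, x ∉ A ∩ frontier X → x ∈ A \ A' → φ x = 0 := by
    intro x hx hxA
    refine hφ x ?_
    by_contra! hlt
    refine hxA.2 ⟨hxA.1, ?_, mem_ball.2 (by linarith)⟩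
    by_contra hni
    exact hx ⟨hxA.1, subset_closure (hAX hxA.1), hni⟩
  have h1 : ∫ x in A, φ x / ‖gradientWithin f X x‖ ∂μHE[n] =
      ∫ x in A', φ x / ‖gradientWithin f X x‖ ∂μHE[n] := by
    refine setIntegral_eq_of_subset_of_ae_sdiff_eq_zero hA.nullMeasurableSet inter_subset_left ?_
    filter_upwards [measure_eq_zero_iff_ae_notMem.1 hnull] with x hx hxA
    rw [hdiff x hx hxA, zero_div]
  have hA'r : A' ⊆ range Φ := fun x hx =>
    ⟨G.c.P x, G.pt_P ((hG.eq x (hAX hx.1) (hOX x hx.2).2).trans (hAt x hx.1))⟩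
  have h2 : ∫ x in A', φ x / ‖gradientWithin f X x‖ ∂μHE[n] =
      ∫ y in Φ ⁻¹' A', φ (Φ y) / ‖gradientWithin f X (Φ y)‖ ∂(Measure.comap Φ μHE[n]) := by
    have hmap := hΦe.setIntegral_map (μ := Measure.comap Φ μHE[n])
      (fun x => φ x / ‖gradientWithin f X x‖) A'
    rw [← hmap, hΦe.map_comap, Measure.restrict_restrict hA'm,
      inter_eq_left.2 hA'r]
  have hA'S : Φ ⁻¹' A' ⊆ S := fun y hy => hy.2
  have hA'pm : MeasurableSet (Φ ⁻¹' A') := hΦc.measurable hA'm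
  set w : E n → E (n + 1) := fun y => gradientWithin f X (Φ y) with hw
  have hwpos : ∀ y ∈ S, 0 < inner ℝ (w y) G.v := fun y hy =>
    hG.inner_pos (hOX _ hy).1 (hOX _ hy).2
  have hwc : ContinuousOn w S := hL.continuousOn.comp hΦc.continuousOn fun y hy => (hOX _ hy).1
  set J : E n → ℝ := fun y => ‖w y‖ / inner ℝ (w y) G.v with hJ
  have hJc : ContinuousOn J S :=
    hwc.norm.div (hwc.inner continuousOn_const) fun y hy => (hwpos y hy).ne'
  have hJ0 : ∀ y ∈ S, 0 < J y := fun y hy => by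
    refine div_pos (norm_pos_iff.2 fun h0 => ?_) (hwpos y hy)
    have := hwpos y hy
    rw [h0, inner_zero_left] at this
    exact lt_irrefl _ this
  have harea := restrict_comap_euclideanHausdorffMeasure hΦe hSo
    (Φ' := fun y => G.c.graphDeriv (G.slope (w y))) (J := J)
    (fun y hy => by
      refine G.hasStrictFDerivAt_pt ?_ (hwpos y hy)
      refine (hasStrictFDerivAt_of_mem_interior hf hL hy.1).congr_of_eventuallyEq ?_
      filter_upwards [hOo.mem_nhds hy] with x hx
      exact (hG.eq x (hOX x hx).1 (hOX x hx).2).symm)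
    (fun y _ z => G.c.norm_le_norm_graphDeriv G.norm_v _ z)
    (fun y hy => by
      rw [G.c.normDet_graphDeriv G.norm_v, G.sqrt_one_add_norm_slope_sq (hwpos y hy)])
    hJc hJ0
  -- The area density `‖w‖ / ⟪w, v⟫` cancels the factor `1 / ‖w‖`.
  have h3 : ∫ y in Φ ⁻¹' A', φ (Φ y) / ‖w y‖ ∂(Measure.comap Φ μHE[n]) =
      ∫ y in Φ ⁻¹' A', φ (Φ y) / inner ℝ (w y) G.v := by
    have : (Measure.comap Φ μHE[n]).restrict (Φ ⁻¹' A') =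
        (volume.restrict (Φ ⁻¹' A')).withDensity (fun y => ENNReal.ofReal (J y)) := by
      rw [← inter_eq_left.2 hA'S, ← Measure.restrict_restrict hA'pm, harea,
        restrict_withDensity hA'pm, Measure.restrict_restrict hA'pm]
    rw [this, integral_withDensity_eq_integral_toReal_smul₀ _
      (Eventually.of_forall fun y => ENNReal.ofReal_lt_top)]
    · refine setIntegral_congr_fun hA'pm fun y hy => ?_
      have h5 := hwpos y (hA'S hy)
      have h6 : ‖w y‖ ≠ 0 := fun h0 => by
        have := hJ0 y (hA'S hy)
        simp [hJ, h0] at this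
      rw [ENNReal.toReal_ofReal (hJ0 y (hA'S hy)).le, smul_eq_mul]
      simp only [hJ]
      field_simp
    · exact ((hJc.mono hA'S).aemeasurable hA'pm).ennreal_ofReal
  rw [h1, h2, h3]
  have h4 : ∫ y in Φ ⁻¹' A, φ (Φ y) / inner ℝ (w y) G.v =
      ∫ y in Φ ⁻¹' A', φ (Φ y) / inner ℝ (w y) G.v := by
    refine setIntegral_eq_of_subset_of_ae_sdiff_eq_zero (hΦc.measurable hA).nullMeasurableSet
      (fun y hy => hy.1) ?_
    -- The projection to the base is 1-Lipschitz and so preserves null sets.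
    have hnull' : volume (Φ ⁻¹' (A ∩ frontier X)) = 0 := by
      rw [← EuclideanSpace.euclideanHausdorffMeasure_eq_volume]
      have hsub : Φ ⁻¹' (A ∩ frontier X) ⊆ G.c.P '' (A ∩ frontier X) := fun y hy =>
        ⟨Φ y, hy, G.P_pt t y⟩
      have hl : LipschitzOnWith 1 G.c.P (A ∩ frontier X) :=
        LipschitzOnWith.of_dist_le_mul fun x _ x' _ => by
          rw [NNReal.coe_one, one_mul]; exact G.dist_P_le x x'
      refine measure_mono_null hsub (le_antisymm ?_ zero_le)
      refine (euclideanHausdorffMeasure_image_le hl n).trans ?_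
      rw [hnull, mul_zero]
    filter_upwards [measure_eq_zero_iff_ae_notMem.1 hnull'] with y hy hyA
    rw [hdiff (Φ y) hy hyA, zero_div]
  rw [← h4, ← integral_indicator (hΦc.measurable hA)]
  rfl

end GraphChart.Adapted

end LocReg

/-! ### Area of facets and of their parts near edges. -/

namespace LocReg

open Set Metric Filter Topology InnerProductSpace MeasureTheory

variable {d N n : ℕ}

/-- The volume of the unit ball. -/
noncomputable def unitBallVolume (n : ℕ) : ℝ := (volume (closedBall (0 : E n) 1)).toReal

lemma volume_closedBall_eq (x : E n) {r : ℝ} (hr : 0 ≤ r) :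
    volume (closedBall x r) = ENNReal.ofReal (unitBallVolume n * r ^ n) := by
  have h := Measure.addHaar_closedBall' (volume : Measure (E n)) x hr
  rw [finrank_euclideanSpace_fin] at h
  rw [h, mul_comm, unitBallVolume, ENNReal.ofReal_mul ENNReal.toReal_nonneg,
    ENNReal.ofReal_toReal measure_closedBall_lt_top.ne]

lemma unitBallVolume_nonneg (n : ℕ) : 0 ≤ unitBallVolume n := ENNReal.toReal_nonneg

/-- The constant in the covering bound for the edges. -/
noncomputable def edgeConst (n : ℕ) (εtr : ℝ) (D : ℝ≥0) : ℝ :=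
  2 * ((D + 3) ^ (n + 1) * 2 ^ (n + 1) * 4 / εtr ^ 2)

lemma edgeConst_nonneg (n : ℕ) (εtr : ℝ) (D : ℝ≥0) : 0 ≤ edgeConst n εtr D := by
  unfold edgeConst; positivity

/-- A radius at which the level sets are graphs. -/
noncomputable def chartRadius (εnd : ℝ) (CL : ℝ≥0) : ℝ :=
  min 1 (εnd / (16 * (CL + 1)))

lemma chartRadius_pos {εnd : ℝ} (hε : 0 < εnd) (CL : ℝ≥0) :
    0 < chartRadius εnd CL := lt_min one_pos (by positivity)

lemma mul_chartRadius_le {εnd : ℝ} (hε : 0 < εnd) (CL : ℝ≥0) :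
    16 * CL * chartRadius εnd CL ≤ εnd := by
  calc 16 * CL * chartRadius εnd CL ≤ 16 * (CL + 1) * (εnd / (16 * (CL + 1))) := by
        have := chartRadius_pos hε CL
        gcongr
        · linarith
        · exact min_le_right _ _
    _ = εnd := by field_simp

namespace Setup

variable {X : Set (E (n + 1))} {f : Fin N → E (n + 1) → ℝ} {εtr εnd : ℝ} {D CL : ℝ≥0}
  {lam0 lam : Fin N → ℝ} {T : ℝ}

/-- The edges at both ends of a slab are covered at once, which explains the factor two in
`edgeConst`. One power of `δ` is cancelled because the bound will be compared with `n`-dimensional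
volumes, `d = n + 1`. -/
lemma exists_cover_edges (h : Setup X f εtr εnd D CL lam0 T) (lam lam' : Fin N → ℝ) {δ : ℝ}
    (hδ : 0 < δ) (hδ1 : δ ≤ 1) :
    ∃ S : Finset (E (n + 1)), (∀ x ∈ S, x ∈ X) ∧
      (∀ z ∈ edge X f εtr lam ∪ edge X f εtr lam', ∃ x ∈ S, dist z x ≤ δ) ∧
      (S.card : ℝ) * δ ^ n ≤ edgeConst n εtr D * δ := by
  classical
  obtain ⟨S, hS, hcov, hcard⟩ := h.exists_cover_edge lam hδ hδ1
  obtain ⟨S', hS', hcov', hcard'⟩ := h.exists_cover_edge lam' hδ hδ1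
  refine ⟨S ∪ S', fun x hx => ?_, fun z hz => ?_, ?_⟩
  · rcases Finset.mem_union.1 hx with hx | hx
    · exact (hS hx).1.1
    · exact (hS' hx).1.1
  · rcases hz with hz | hz
    · obtain ⟨x, hx, hxz⟩ := hcov z hz
      exact ⟨x, Finset.mem_union_left _ hx, hxz⟩
    · obtain ⟨x, hx, hxz⟩ := hcov' z hz
      exact ⟨x, Finset.mem_union_right _ hx, hxz⟩
  · have h1 : ((S ∪ S').card : ℝ) ≤ S.card + S'.card := by exact_mod_cast Finset.card_union_le S S'
    have h2 : ((S ∪ S').card : ℝ) * δ ^ n * δ ≤ edgeConst n εtr D * δ * δ := by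
      calc ((S ∪ S').card : ℝ) * δ ^ n * δ ≤ (S.card + S'.card) * δ ^ n * δ := by gcongr
        _ = S.card * δ ^ (n + 1) + S'.card * δ ^ (n + 1) := by ring
        _ ≤ _ := by
          refine (add_le_add hcard hcard').trans (le_of_eq ?_)
          rw [edgeConst]; ring
    exact le_of_mul_le_mul_right h2 hδ

/-- The area of a part of a level set covered by small balls. -/
lemma measure_level_le_of_cover (h : Setup X f εtr εnd D CL lam0 T) {r ρ : ℝ}
    (hr : 16 * CL * r ≤ εnd) (hρ : 0 ≤ ρ) (hρr : ρ ≤ r) {i : Fin N} {t : ℝ} {A : Set (E (n + 1))}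
    (hA : ∀ x ∈ A, x ∈ X ∧ f i x = t) {S : Finset (E (n + 1))} (hSX : ∀ z ∈ S, z ∈ X)
    (hcov : ∀ x ∈ A, ∃ z ∈ S, dist x z ≤ ρ) :
    μHE[n] A ≤ ENNReal.ofReal (S.card * (2 ^ n * (unitBallVolume n * ρ ^ n))) := by
  have hsub : A ⊆ ⋃ z ∈ S, A ∩ closedBall z ρ := fun x hx => by
    obtain ⟨z, hz, hzx⟩ := hcov x hx
    exact mem_iUnion₂.2 ⟨z, hz, hx, mem_closedBall.2 hzx⟩
  have hball : ∀ z ∈ S, μHE[n] (A ∩ closedBall z ρ) ≤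
      ENNReal.ofReal (2 ^ n * (unitBallVolume n * ρ ^ n)) := by
    intro z hz
    obtain ⟨G, hG, -⟩ := h.exists_chart i hr (hSX z hz) (p := z)
      (by rw [dist_self]; linarith)
    refine (G.measure_level_inter_closedBall_le z (t := t) (r := ρ) ?_).trans ?_
    · rintro x ⟨hx, hxz⟩
      refine ⟨?_, mem_closedBall.1 hxz⟩
      rw [hG.eq x (hA x hx).1 (by linarith [mem_closedBall.1 hxz]), (hA x hx).2]
    · rw [volume_closedBall_eq _ hρ, ENNReal.ofReal_mul (p := 2 ^ n) (by positivity)]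
      refine le_of_eq ?_
      congr 1
      rw [ENNReal.ofReal_pow (by norm_num)]
      simp
  calc μHE[n] A ≤ ∑ z ∈ S, μHE[n] (A ∩ closedBall z ρ) :=
        (measure_mono hsub).trans (measure_biUnion_finset_le _ _)
    _ ≤ ∑ z ∈ S, ENNReal.ofReal (2 ^ n * (unitBallVolume n * ρ ^ n)) :=
        Finset.sum_le_sum hball
    _ = _ := by
        rw [Finset.sum_const, nsmul_eq_mul, ← ENNReal.ofReal_natCast,
          ← ENNReal.ofReal_mul (by positivity)]

/-- The area of the part of a level set close to the edges. -/
lemma measure_near_edge_le (h : Setup X f εtr εnd D CL lam0 T) {r : ℝ} (hr : 16 * CL * r ≤ εnd)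
    {i : Fin N} {t : ℝ} {A : Set (E (n + 1))} (hA : ∀ x ∈ A, x ∈ X ∧ f i x = t) {L δ : ℝ}
    (hL : 0 ≤ L) (hδ : 0 < δ) (hδ1 : δ ≤ 1) (hLr : (L + 1) * δ ≤ r) {lam lam' : Fin N → ℝ}
    (hnear : ∀ x ∈ A, ∃ z ∈ edge X f εtr lam ∪ edge X f εtr lam', dist z x ≤ L * δ) :
    μHE[n] A ≤ ENNReal.ofReal
      (edgeConst n εtr D * (2 ^ n * unitBallVolume n * (L + 1) ^ n) * δ) := by
  obtain ⟨S, hSX, hcov, hcard⟩ := h.exists_cover_edges lam lam' hδ hδ1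
  refine (h.measure_level_le_of_cover hr (ρ := (L + 1) * δ) (by positivity) hLr hA hSX
    fun x hx => ?_).trans (ENNReal.ofReal_le_ofReal ?_)
  · obtain ⟨z, hz, hzx⟩ := hnear x hx
    obtain ⟨x', hx', hzx'⟩ := hcov z hz
    refine ⟨x', hx', ?_⟩
    have := dist_triangle_left x x' z
    linarith
  · have := unitBallVolume_nonneg n
    calc S.card * (2 ^ n * (unitBallVolume n * ((L + 1) * δ) ^ n))
        = S.card * δ ^ n * (2 ^ n * unitBallVolume n * (L + 1) ^ n) := by rw [mul_pow]; ring
      _ ≤ edgeConst n εtr D * δ * (2 ^ n * unitBallVolume n * (L + 1) ^ n) := by gcongr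
      _ = _ := by ring

/-- The facets meet the boundary of `X` in a null set. -/
lemma measure_facet_inter_frontier (h : Setup X f εtr εnd D CL lam0 T) (hlam : lam ∈ cube lam0 T)
    (i : Fin N) : μHE[n] (facet X f lam i ∩ frontier X) = 0 := by
  set r := chartRadius εnd CL
  have hr0 : 0 < r := chartRadius_pos h.nd.1 CL
  set C := edgeConst n εtr D * (2 ^ n * unitBallVolume n * (0 + 1) ^ n)
  -- These points are themselves edge points, so the near-edge estimate applies with `L = 0` at
  -- every small scale.
  have hbound : ∀ δ : ℝ, 0 < δ → δ ≤ r →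
      μHE[n] (facet X f lam i ∩ frontier X) ≤ ENNReal.ofReal (C * δ) := by
    intro δ hδ hδr
    refine h.measure_near_edge_le (mul_chartRadius_le h.nd.1 CL) (i := i) (t := lam i)
      (fun x hx => ⟨hx.1.1.1, hx.1.2⟩) (L := 0) (lam := lam) (lam' := lam) le_rfl hδ
      (hδr.trans (min_le_left _ _)) (by simpa using hδr) fun x hx => ?_
    exact ⟨x, Or.inl (h.mem_edge hlam hx.1.1 hx.1.2 (Or.inl hx.2)), by simp⟩
  have hlim : Tendsto (fun δ : ℝ => ENNReal.ofReal (C * δ)) (𝓝[>] 0) (𝓝 0) := by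
    have : Continuous fun δ : ℝ => ENNReal.ofReal (C * δ) :=
      ENNReal.continuous_ofReal.comp (continuous_const_mul C)
    simpa using (this.tendsto 0).mono_left nhdsWithin_le_nhds
  refine le_antisymm (ge_of_tendsto hlim ?_) zero_le
  filter_upwards [Ioc_mem_nhdsGT hr0] with δ hδ using hbound δ hδ.1 hδ.2

/-- The facets have bounded area. -/
lemma measure_facet_le (h : Setup X f εtr εnd D CL lam0 T) (lam : Fin N → ℝ) (i : Fin N) :
    μHE[n] (facet X f lam i) ≤ ENNReal.ofReal
      ((D + chartRadius εnd CL) ^ (n + 1) / (chartRadius εnd CL / 2) ^ (n + 1) *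
        (2 ^ n * (unitBallVolume n * chartRadius εnd CL ^ n))) := by
  set r := chartRadius εnd CL
  have hr0 : 0 < r := chartRadius_pos h.nd.1 CL
  obtain ⟨S, hSX, hcov, hcard⟩ := h.exists_net hr0
  have := unitBallVolume_nonneg n
  refine (h.measure_level_le_of_cover (mul_chartRadius_le h.nd.1 CL) hr0.le le_rfl (i := i)
    (t := lam i) (fun x hx => ⟨hx.1.1, hx.2⟩) (fun z hz => hSX hz)
    fun x hx => hcov x hx.1.1).trans (ENNReal.ofReal_le_ofReal ?_)
  gcongr

end Setup

end LocReg

/-! ### The slab along a single vertical line. -/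

namespace LocReg

open Set Metric Filter Topology InnerProductSpace MeasureTheory

variable {d N n : ℕ}

/-- The points of `X` satisfying all constraints but the `i`-th. -/
def others (X : Set (E d)) (f : Fin N → E d → ℝ) (lam : Fin N → ℝ) (i : Fin N) : Set (E d) :=
  {x | x ∈ X ∧ ∀ j, j ≠ i → f j x ≤ lam j}

lemma mem_K_update_iff {X : Set (E d)} {f : Fin N → E d → ℝ} {lam : Fin N → ℝ} {i : Fin N} {a : ℝ}
    {x : E d} : x ∈ K X f (Function.update lam i a) ↔ x ∈ others X f lam i ∧ f i x ≤ a := by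
  constructor
  · rintro ⟨hx, hf⟩
    refine ⟨⟨hx, fun j hj => ?_⟩, by simpa using hf i⟩
    simpa [Function.update_of_ne hj] using hf j
  · rintro ⟨⟨hx, hf⟩, hi⟩
    refine ⟨hx, fun j => ?_⟩
    by_cases hj : j = i
    · subst hj; simpa using hi
    · rw [Function.update_of_ne hj]; exact hf j hj

lemma mem_K_iff {X : Set (E d)} {f : Fin N → E d → ℝ} {lam : Fin N → ℝ} (i : Fin N)
    {x : E d} : x ∈ K X f lam ↔ x ∈ others X f lam i ∧ f i x ≤ lam i := by
  rw [← mem_K_update_iff, Function.update_eq_self]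

lemma mem_facet_update_iff {X : Set (E d)} {f : Fin N → E d → ℝ} {lam : Fin N → ℝ} {i : Fin N}
    {a : ℝ} {x : E d} :
    x ∈ facet X f (Function.update lam i a) i ↔ x ∈ others X f lam i ∧ f i x = a := by
  rw [facet, mem_ofPred_eq, mem_K_update_iff, Function.update_self]
  exact ⟨fun hx => ⟨hx.1.1, hx.2⟩, fun hx => ⟨⟨hx.1, hx.2.le⟩, hx.2⟩⟩

lemma mem_slab_iff {X : Set (E d)} {f : Fin N → E d → ℝ} {lam : Fin N → ℝ} {i : Fin N}
    {s : ℝ} {x : E d} :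
    x ∈ K X f (Function.update lam i s) \ K X f lam ↔
      x ∈ others X f lam i ∧ lam i < f i x ∧ f i x ≤ s := by
  rw [Set.mem_sdiff, mem_K_update_iff, mem_K_iff i]
  constructor
  · rintro ⟨⟨h1, h2⟩, h3⟩
    exact ⟨h1, not_le.1 fun h4 => h3 ⟨h1, h4⟩, h2⟩
  · rintro ⟨h1, h2, h3⟩
    exact ⟨⟨h1, h3⟩, fun h4 => absurd h4.2 (not_le.2 h2)⟩

/-- A bounded Hölder function supported close to `p`. -/
structure IsLocalDensity (X : Set (E d)) (p : E d) (r : ℝ) (α : ℝ≥0) (R H : ℝ)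
    (φ : E d → ℝ) : Prop where
  zero : ∀ x, r ≤ dist x p → φ x = 0
  bound : ∀ x ∈ X, |φ x| ≤ R
  holder : ∀ x ∈ X, ∀ x' ∈ X, |φ x - φ x'| ≤ H * dist x x' ^ (α : ℝ)

lemma le_rpow_of_le_one {δ : ℝ} (hδ0 : 0 < δ) (hδ1 : δ ≤ 1) {α : ℝ≥0} (hα1 : α ≤ 1) :
    δ ≤ δ ^ (α : ℝ) := by
  conv_lhs => rw [← Real.rpow_one δ]
  exact Real.rpow_le_rpow_of_exponent_ge hδ0 hδ1 (by exact_mod_cast hα1)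

lemma continuousOn_of_holder {X : Set (E d)} {α : ℝ≥0} (hα : 0 < α) {H : ℝ} {φ : E d → ℝ}
    (h : ∀ x ∈ X, ∀ x' ∈ X, |φ x - φ x'| ≤ H * dist x x' ^ (α : ℝ)) : ContinuousOn φ X := by
  intro x hx
  rw [ContinuousWithinAt, tendsto_iff_dist_tendsto_zero]
  have hc : Tendsto (fun x' => H * dist x' x ^ (α : ℝ)) (𝓝[X] x) (𝓝 0) := by
    have : Continuous fun x' => H * dist x' x ^ (α : ℝ) := by
      have : Continuous fun x' => dist x' x ^ (α : ℝ) :=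
        (continuous_id.dist continuous_const).rpow_const fun _ => Or.inr α.2
      fun_prop
    have h2 := (this.tendsto x).mono_left (nhdsWithin_le_nhds (s := X))
    simpa [Real.zero_rpow (NNReal.coe_ne_zero.2 hα.ne')] using h2
  refine tendsto_of_tendsto_of_tendsto_of_le_of_le' tendsto_const_nhds hc
    (Eventually.of_forall fun _ => dist_nonneg) ?_
  filter_upwards [self_mem_nhdsWithin] with x' hx'
  rw [Real.dist_eq]
  exact h x' hx' x hx

namespace Setup

lemma isClosed_others {X : Set (E d)} {f : Fin N → E d → ℝ} {εtr εnd : ℝ} {D CL : ℝ≥0}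
    {lam0 : Fin N → ℝ} {T : ℝ} (h : Setup X f εtr εnd D CL lam0 T) (lam : Fin N → ℝ)
    (i : Fin N) : IsClosed (others X f lam i) := by
  have : others X f lam i = X ∩ ⋂ j : {j // j ≠ i}, (X ∩ f j ⁻¹' Iic (lam j)) := by
    ext x
    simp only [others, mem_ofPred_eq, mem_inter_iff, mem_iInter, mem_preimage, mem_Iic]
    exact ⟨fun hx => ⟨hx.1, fun j => ⟨hx.1, hx.2 j j.2⟩⟩,
      fun hx => ⟨hx.1, fun j hj => (hx.2 ⟨j, hj⟩).2⟩⟩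
  rw [this]
  exact h.compact.isClosed.inter (isClosed_iInter fun j =>
    (h.continuousOn j).preimage_isClosed_of_isClosed h.compact.isClosed isClosed_Iic)

/-- If all these constraints were strict at an interior point of `X`, they would persist nearby. -/
lemma active_of_mem_frontier_others {X : Set (E d)} {f : Fin N → E d → ℝ} {εtr εnd : ℝ}
    {D CL : ℝ≥0} {lam0 : Fin N → ℝ} {T : ℝ} (h : Setup X f εtr εnd D CL lam0 T)
    {lam : Fin N → ℝ} {i : Fin N} {z : E d} (hz : z ∈ frontier (others X f lam i)) :
    z ∈ frontier X ∨ ∃ j, j ≠ i ∧ f j z = lam j := by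
  have hzm := (h.isClosed_others lam i).frontier_subset hz
  by_contra! hno
  obtain ⟨h1, h2⟩ := hno
  have hzint : z ∈ interior X := by
    by_contra h0
    exact h1 ⟨subset_closure hzm.1, h0⟩
  have hnhds := mem_interior_iff_mem_nhds.1 hzint
  refine hz.2 (mem_interior_iff_mem_nhds.2 ?_)
  have hev : ∀ᶠ x in 𝓝 z, ∀ j, j ≠ i → f j x < lam j := by
    rw [eventually_all]
    intro j
    by_cases hj : j = i
    · simp [hj]
    · filter_upwards [((h.continuousOn j).continuousAt hnhds).eventually
        (gt_mem_nhds ((hzm.2 j hj).lt_of_ne (h2 j hj)))] with x hx _ using hx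
  filter_upwards [hev, hnhds] with x hx hxX
  exact ⟨hxX, fun j hj => (hx j hj).le⟩

variable {X : Set (E (n + 1))} {f : Fin N → E (n + 1) → ℝ} {εtr εnd : ℝ} {D CL : ℝ≥0}
  {lam0 lam : Fin N → ℝ} {T : ℝ}

/-- Comparison, along a line, of the integral over the slab `λᵢ < fᵢ ≤ s` with the value on a level
set: the error is of higher order unless the line passes close to an edge. -/
lemma line_estimate (h : Setup X f εtr εnd D CL lam0 T) {i : Fin N} {r : ℝ} {p : E (n + 1)}
    {G : GraphChart n} (hG : G.Adapted X (f i) p r) (hγ : εnd ≤ G.γ) {α : ℝ≥0} (hα0 : 0 < α)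
    (hα1 : α ≤ 1) {R H : ℝ} (hR : 0 ≤ R) (hH : 0 ≤ H) {φ : E (n + 1) → ℝ}
    (hφ : IsLocalDensity X p r α R H φ) {s : ℝ} (hs : lam i < s) (hlam : lam ∈ cube lam0 T)
    (hlam' : Function.update lam i s ∈ cube lam0 T) (hδ : 4 * (s - lam i) ≤ 3 * εnd * r)
    (hδ1 : s - lam i ≤ 1) {b : ℝ} (hb : b = lam i ∨ b = s) (y : E n) {I J : ℝ}
    (hI : I = ∫ τ, (K X f (Function.update lam i s) \ K X f lam).indicator φ (G.line y τ))
    (hJ : J = (facet X f (Function.update lam i b) i).indicator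
      (fun x => φ x / inner ℝ (gradientWithin (f i) X x) G.v) (G.pt b y)) :
    I - (s - lam i) * J = 0 ∨
    (dist y (G.c.P p) ≤ 2 * r ∧ |I - (s - lam i) * J| ≤
      (H * (4 / (3 * εnd)) * (4 / (3 * εnd)) ^ (α : ℝ) + R * CL * (4 / (3 * εnd)) ^ 3) *
        ((s - lam i) * (s - lam i) ^ (α : ℝ))) ∨
    ((∃ z ∈ edge X f εtr lam ∪ edge X f εtr (Function.update lam i s),
      dist (G.c.P z) y ≤ 4 / (εtr * εnd) * (s - lam i)) ∧
      |I - (s - lam i) * J| ≤ 2 * R * (4 / (3 * εnd)) * (s - lam i)) := by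
  set W := K X f (Function.update lam i s) \ K X f lam with hW
  set t := lam i with ht
  set δ := s - t with hδdef
  have hδ0 : 0 < δ := by linarith
  -- The reciprocal of the smallest vertical slope `3 εnd / 4`: the line meets the slab in length `Δ
  -- ≤ m δ ≤ r`.
  set m := 4 / (3 * εnd) with hm
  have hnd := h.nd.1
  have hm0 : 0 < m := by positivity
  set a := G.height y t with ha
  set a' := G.height y s with ha'
  have haa' : a ≤ a' := G.height_mono y hs.le
  set Δ := a' - a with hΔ
  have hΔ0 : 0 ≤ Δ := by linarith
  have hΔm : Δ ≤ m * δ := by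
    have h1 := G.height_sub_le y hs.le
    have h2 : 3 / 4 * εnd * Δ ≤ δ := le_trans (by gcongr) h1
    rw [hm, div_mul_eq_mul_div, le_div_iff₀ (by positivity)]
    linarith
  have hΔr : Δ ≤ r := by
    refine hΔm.trans ?_
    rw [hm, div_mul_eq_mul_div, div_le_iff₀ (by positivity)]
    linarith
  have hslab : ∀ τ, W.indicator φ (G.line y τ) ≠ 0 →
      τ ∈ Ioc a a' ∧ G.line y τ ∈ others X f lam i ∧ φ (G.line y τ) ≠ 0 := by
    intro τ hτ
    have hmem : G.line y τ ∈ W := mem_of_indicator_ne_zero hτ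
    rw [indicator_of_mem hmem] at hτ
    obtain ⟨h1, h2, h3⟩ := mem_slab_iff.1 hmem
    have hd : dist (G.line y τ) p < r := by
      by_contra! hge
      exact hτ (hφ.zero _ hge)
    have hF := hG.eq _ h1.1 (by linarith [dist_nonneg (x := G.line y τ) (y := p)])
    refine ⟨⟨?_, ?_⟩, h1, hτ⟩
    · rw [← not_le, G.le_height_iff, hF, not_le]; exact h2
    · rw [G.le_height_iff, hF]; exact h3
  have hI' : I = ∫ τ in Ioc a a', W.indicator φ (G.line y τ) := by
    rw [hI, setIntegral_eq_integral_of_forall_compl_eq_zero]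
    intro τ hτ
    by_contra h0
    exact hτ (hslab τ h0).1
  set e := G.height y b with he
  have heI : e ∈ Icc a a' := by
    rcases hb with rfl | rfl
    · exact left_mem_Icc.2 haa'
    · exact right_mem_Icc.2 haa'
  have hpt : G.pt b y = G.line y e := rfl
  -- If the line misses the support of `φ` inside the slab and the other constraints, both terms
  -- vanish.
  by_cases hex : ∃ τ ∈ Icc a a', G.line y τ ∈ others X f lam i ∧ φ (G.line y τ) ≠ 0
  swap
  · left
    push Not at hex
    have hI0 : I = 0 := by
      rw [hI']
      refine setIntegral_eq_zero_of_forall_eq_zero fun τ hτ => ?_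
      by_contra h0
      obtain ⟨h1, h2, h3⟩ := hslab τ h0
      exact h3 (hex τ (Ioc_subset_Icc_self h1) h2)
    have hJ0 : J = 0 := by
      rw [hJ, indicator_apply_eq_zero]
      intro hmem
      rw [hpt] at hmem ⊢
      rw [hex e heI (mem_facet_update_iff.1 hmem).1, zero_div]
    rw [hI0, hJ0]; ring
  right
  obtain ⟨τ0, hτ0, hτ0C, hτ0φ⟩ := hex
  have hd0 : dist (G.line y τ0) p < r := by
    by_contra! hge
    exact hτ0φ (hφ.zero _ hge)
  have hnear : ∀ τ ∈ Icc a a', dist (G.line y τ) p ≤ 2 * r := by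
    intro τ hτ
    have h1 := dist_triangle (G.line y τ) (G.line y τ0) p
    rw [G.dist_line] at h1
    have h2 : |τ - τ0| ≤ Δ := abs_sub_le_iff.2 ⟨by linarith [hτ.2, hτ0.1], by linarith [hτ.1, hτ0.2]⟩
    linarith
  have hFf : ∀ τ ∈ Icc a a', G.line y τ ∈ X → G.F (G.line y τ) = f i (G.line y τ) :=
    fun τ hτ hX => hG.eq _ hX (hnear τ hτ)
  have hgrad : ∀ τ ∈ Icc a a', G.line y τ ∈ X →
      1 ≤ m * inner ℝ (gradientWithin (f i) X (G.line y τ)) G.v := by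
    intro τ hτ hX
    have h1 := hG.le_inner hX (hnear τ hτ)
    have h2 : 3 / 4 * εnd ≤ 3 / 4 * G.γ := by gcongr
    calc (1 : ℝ) = m * (3 / 4 * εnd) := by rw [hm]; field_simp
      _ ≤ _ := by gcongr; linarith
  have hvol : (volume : Measure ℝ).real (Ioc a a') = Δ := by
    rw [Real.volume_real_Ioc_of_le haa']
  -- If the line stays inside the other constraints, Hölder continuity freezes `φ` and a Taylor
  -- expansion gives the thickness. Otherwise the line is near an edge and only crude bounds are
  -- used.
  by_cases hall : ∀ τ ∈ Icc a a', G.line y τ ∈ others X f lam i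
  · left
    refine ⟨?_, ?_⟩
    · have := G.dist_P_le (G.line y τ0) p
      rw [G.P_line] at this
      linarith [dist_nonneg (x := G.line y τ0) (y := p)]
    have hXall : ∀ τ ∈ Icc a a', G.line y τ ∈ X := fun τ hτ => (hall τ hτ).1
    have hIφ : I = ∫ τ in Ioc a a', φ (G.line y τ) := by
      rw [hI']
      refine setIntegral_congr_fun measurableSet_Ioc fun τ hτ => ?_
      have hτ' := Ioc_subset_Icc_self hτ
      refine indicator_of_mem (mem_slab_iff.2 ⟨hall τ hτ', ?_, ?_⟩) φ
      · rw [← hFf τ hτ' (hXall τ hτ'), ← not_le, ← G.le_height_iff, not_le]; exact hτ.1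
      · rw [← hFf τ hτ' (hXall τ hτ'), ← G.le_height_iff]; exact hτ.2
    set xb := G.line y e with hxb
    have hxbX : xb ∈ X := hXall e heI
    set g := inner ℝ (gradientWithin (f i) X xb) G.v with hg
    have hmg : 1 ≤ m * g := hgrad e heI hxbX
    have hg0 : 0 < g := by
      by_contra! hle
      nlinarith
    have hJφ : J = φ xb / g := by
      rw [hJ, hpt, indicator_of_mem (mem_facet_update_iff.2 ⟨hall e heI, ?_⟩)]
      rw [← hFf e heI hxbX]
      exact G.F_pt b y
    have hcont : ContinuousOn (fun τ => φ (G.line y τ)) (Icc a a') :=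
      (continuousOn_of_holder hα0 hφ.holder).comp
        (G.continuous_line.comp (Continuous.prodMk_right y)).continuousOn hXall
    have hintg : IntegrableOn (fun τ => φ (G.line y τ)) (Ioc a a') :=
      (hcont.integrableOn_Icc).mono_set Ioc_subset_Icc_self
    have h1 : |I - Δ * φ xb| ≤ H * (m * δ) ^ (α : ℝ) * Δ := by
      have h2 : I - Δ * φ xb = ∫ τ in Ioc a a', (φ (G.line y τ) - φ xb) := by
        rw [integral_sub hintg (integrableOn_const (by simp)), setIntegral_const, hvol, hIφ,
          smul_eq_mul]
      rw [h2, ← Real.norm_eq_abs]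
      refine (norm_setIntegral_le_of_norm_le_const (C := H * (m * δ) ^ (α : ℝ)) (by simp)
        fun τ hτ => ?_).trans_eq (by rw [hvol])
      have hτ' := Ioc_subset_Icc_self hτ
      refine (hφ.holder _ (hXall τ hτ') _ hxbX).trans ?_
      rw [hxb, G.dist_line]
      have h3 : |τ - e| ≤ m * δ :=
        abs_sub_le_iff.2 ⟨by linarith [hτ.2, heI.1], by linarith [hτ.1, heI.2]⟩
      gcongr
    -- Across the interval `f i` rises by exactly `δ`; Taylor's formula is taken at whichever end
    -- `b` selects.
    have h2 : |Δ * g - δ| ≤ CL * Δ ^ 2 := by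
      have hfa : f i (G.line y a) = t := by
        rw [← hFf a (left_mem_Icc.2 haa') (hXall a (left_mem_Icc.2 haa'))]; exact G.F_pt t y
      have hfa' : f i (G.line y a') = s := by
        rw [← hFf a' (right_mem_Icc.2 haa') (hXall a' (right_mem_Icc.2 haa'))]; exact G.F_pt s y
      rcases hb with hb | hb
      · have hea : e = a := by rw [he, hb]
        have := abs_taylor_le (h.diff i) h.convex (h.lip i) hxbX
          (hXall a' (right_mem_Icc.2 haa'))
        rw [hxb, G.line_sub_line, inner_smul_right, norm_smul, G.norm_v, mul_one, ← hxb, ← hg,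
          hfa', hea, Real.norm_eq_abs, sq_abs, show f i xb = t by rw [hxb, hea, hfa]] at this
        rw [abs_sub_comm]
        exact this
      · have hea : e = a' := by rw [he, hb]
        have := abs_taylor_le (h.diff i) h.convex (h.lip i) hxbX
          (hXall a (left_mem_Icc.2 haa'))
        rw [hxb, G.line_sub_line, inner_smul_right, norm_smul, G.norm_v, mul_one, ← hxb, ← hg,
          hfa, hea, Real.norm_eq_abs, sq_abs, show f i xb = s by rw [hxb, hea, hfa']] at this
        convert! this using 1
        · congr 1; rw [hδdef, hΔ]; ring
        · rw [hΔ]; ring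
    have h3 : |Δ * φ xb - δ * J| ≤ R * (CL * (m * δ) ^ 2 * m) := by
      have h4 : Δ * φ xb - δ * J = φ xb * ((Δ * g - δ) / g) := by rw [hJφ]; field_simp
      rw [h4, abs_mul, abs_div, abs_of_pos hg0]
      refine mul_le_mul (hφ.bound _ hxbX) ?_ (by positivity) hR
      rw [div_le_iff₀ hg0]
      calc |Δ * g - δ| ≤ CL * Δ ^ 2 := h2
        _ ≤ CL * (m * δ) ^ 2 := by gcongr
        _ = CL * (m * δ) ^ 2 * 1 := by ring
        _ ≤ CL * (m * δ) ^ 2 * (m * g) := by gcongr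
        _ = _ := by ring
    have h4 := le_rpow_of_le_one hδ0 hδ1 hα1
    calc |I - δ * J| ≤ |I - Δ * φ xb| + |Δ * φ xb - δ * J| := abs_sub_le _ _ _
      _ ≤ H * (m * δ) ^ (α : ℝ) * (m * δ) + R * (CL * (m * δ) ^ 2 * m) :=
          add_le_add (h1.trans (by gcongr)) h3
      _ = H * m * m ^ (α : ℝ) * (δ * δ ^ (α : ℝ)) + R * CL * m ^ 3 * (δ * δ) := by
          rw [Real.mul_rpow hm0.le hδ0.le]; ring
      _ ≤ H * m * m ^ (α : ℝ) * (δ * δ ^ (α : ℝ)) + R * CL * m ^ 3 * (δ * δ ^ (α : ℝ)) := by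
          gcongr
      _ = _ := by ring
  · right
    push Not at hall
    obtain ⟨τ2, hτ2, hτ2C⟩ := hall
    refine ⟨?_, ?_⟩
    -- On leaving the other constraints the line crosses their frontier inside the slab. At that
    -- point another constraint is active, so an edge is near, and projecting to the base does not
    -- increase distances.
    · obtain ⟨z, hzs, hzf⟩ := segment_inter_frontier_nonempty hτ0C hτ2C
      obtain ⟨q, q', hq, hq', hqq, hz⟩ := hzs
      have hzl : z = G.line y (q * τ0 + q' * τ2) := by
        have : q = 1 - q' := by linarith
        rw [← hz, this, GraphChart.line, GraphChart.line, GraphChart.line]; module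
      set τ := q * τ0 + q' * τ2 with hτ
      have hτI : τ ∈ Icc a a' := by
        have : segment ℝ τ0 τ2 ⊆ Icc a a' := (convex_Icc a a').segment_subset hτ0 hτ2
        exact this ⟨q, q', hq, hq', hqq, by simp [hτ]⟩
      have hzC := (h.isClosed_others lam i).frontier_subset hzf
      have hact := h.active_of_mem_frontier_others hzf
      have hfz : G.F (G.line y τ) = f i z := by rw [hzl]; exact hFf τ hτI (hzl ▸ hzC.1)
      obtain ⟨w, hw, hwz⟩ := h.exists_edge_near hs hlam hlam' (x := z)
        (mem_K_update_iff.2 ⟨hzC, by rw [← hfz, ← G.le_height_iff]; exact hτI.2⟩)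
        (by rw [← hfz, ← G.height_le_iff]; exact hτI.1) hact
      refine ⟨w, hw, ?_⟩
      have := G.dist_P_le w z
      rw [hzl, G.P_line, ← hzl] at this
      exact this.trans hwz
    · have h1 : |I| ≤ R * Δ := by
        rw [hI', ← Real.norm_eq_abs]
        refine (norm_setIntegral_le_of_norm_le_const (C := R) (by simp)
          fun τ hτ => ?_).trans_eq (by rw [hvol])
        by_cases hmem : G.line y τ ∈ W
        · rw [indicator_of_mem hmem]; exact hφ.bound _ hmem.1.1
        · rw [indicator_of_notMem hmem]; simpa using hR
      have h2 : |J| ≤ R * m := by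
        rw [hJ, hpt]
        by_cases hmem : G.line y e ∈ facet X f (Function.update lam i b) i
        · rw [indicator_of_mem hmem, abs_div]
          have hX : G.line y e ∈ X := hmem.1.1
          have h3 := hgrad e heI hX
          have h4 : 0 < inner ℝ (gradientWithin (f i) X (G.line y e)) G.v :=
            hG.inner_pos hX (hnear e heI)
          rw [abs_of_pos h4, div_le_iff₀ h4]
          calc |φ (G.line y e)| ≤ R * 1 := by rw [mul_one]; exact hφ.bound _ hX
            _ ≤ R * (m * _) := by gcongr
            _ = _ := by ring
        · rw [indicator_of_notMem hmem, abs_zero]; positivity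
      calc |I - δ * J| ≤ |I| + |δ * J| := abs_sub _ _
        _ ≤ R * (m * δ) + δ * (R * m) := by
          rw [abs_mul, abs_of_pos hδ0]
          exact add_le_add (h1.trans (by gcongr)) (by gcongr)
        _ = _ := by ring

end Setup

end LocReg

/-! ### One-variable expansion for a localized density. -/

namespace LocReg

open Set Metric Filter Topology InnerProductSpace MeasureTheory

variable {d N n : ℕ}

/-- The constant in the first order expansion of the integral of a local density. -/
noncomputable def localConst (n : ℕ) (α : ℝ≥0) (εtr εnd : ℝ) (D CL : ℝ≥0) (R H : ℝ) : ℝ :=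
  (H * (4 / (3 * εnd)) * (4 / (3 * εnd)) ^ (α : ℝ) + R * CL * (4 / (3 * εnd)) ^ 3) *
      (unitBallVolume n * (2 * chartRadius εnd CL) ^ n) +
    2 * R * (4 / (3 * εnd)) *
      (edgeConst n εtr D * (unitBallVolume n * (4 / (εtr * εnd) + 1) ^ n))

lemma localConst_nonneg (n : ℕ) (α : ℝ≥0) {εtr εnd : ℝ} (h1 : 0 < εtr) (h2 : 0 < εnd)
    (D CL : ℝ≥0) {R H : ℝ} (hR : 0 ≤ R) (hH : 0 ≤ H) : 0 ≤ localConst n α εtr εnd D CL R H := by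
  have := chartRadius_pos h2 CL
  have := unitBallVolume_nonneg n
  have := edgeConst_nonneg n εtr D
  unfold localConst
  positivity

namespace Setup

variable {X : Set (E (n + 1))} {f : Fin N → E (n + 1) → ℝ} {εtr εnd : ℝ} {D CL : ℝ≥0}
  {lam0 lam : Fin N → ℝ} {T : ℝ}

lemma integrable_pt_facet (h : Setup X f εtr εnd D CL lam0 T) {i : Fin N} {r : ℝ}
    (hr : 0 < r) {p : E (n + 1)} {G : GraphChart n} (hG : G.Adapted X (f i) p r)
    {φ : E (n + 1) → ℝ} (hφ : ∀ x, r ≤ dist x p → φ x = 0) (hφc : ContinuousOn φ X)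
    (lam : Fin N → ℝ) (b : ℝ) :
    Integrable fun y => (facet X f lam i).indicator
      (fun x => φ x / inner ℝ (gradientWithin (f i) X x) G.v) (G.pt b y) := by
  set ψ := fun x => φ x / inner ℝ (gradientWithin (f i) X x) G.v with hψ
  have hptc := (G.lipschitzWith_pt b).continuous
  set B := G.pt b ⁻¹' (facet X f lam i ∩ closedBall p r) with hB
  have hBc : IsCompact B := by
    refine isCompact_of_isClosed_isBounded
      (((h.isCompact_facet lam i).isClosed.inter isClosed_closedBall).preimage hptc)
      ((isBounded_closedBall (x := G.c.P p) (r := r)).subset fun y hy => ?_)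
    have := G.dist_P_le (G.pt b y) p
    rw [G.P_pt] at this
    exact mem_closedBall.2 (this.trans (mem_closedBall.1 hy.2))
  have hψc : ContinuousOn ψ (facet X f lam i ∩ closedBall p r) := by
    have hsub : facet X f lam i ∩ closedBall p r ⊆ X := fun x hx => hx.1.1.1
    refine (hφc.mono hsub).div (((h.continuousOn_gradientWithin i).mono hsub).inner
      continuousOn_const) fun x hx => ?_
    exact (hG.inner_pos hx.1.1.1 (by linarith [mem_closedBall.1 hx.2])).ne'
  have hintg : IntegrableOn (fun y => ψ (G.pt b y)) B :=
    (hψc.comp hptc.continuousOn fun y hy => hy).integrableOn_compact hBc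
  have heq : (fun y => (facet X f lam i).indicator ψ (G.pt b y)) =
      B.indicator fun y => ψ (G.pt b y) := by
    ext y
    by_cases hy : G.pt b y ∈ facet X f lam i
    · rw [indicator_of_mem hy]
      by_cases hy2 : G.pt b y ∈ closedBall p r
      · rw [indicator_of_mem (show y ∈ B from ⟨hy, hy2⟩)]
      · rw [indicator_of_notMem (fun hyB => hy2 hyB.2)]
        rw [mem_closedBall, not_le] at hy2
        rw [hψ]
        dsimp only
        rw [hφ _ hy2.le, zero_div]
    · rw [indicator_of_notMem hy, indicator_of_notMem fun hyB => hy hyB.1]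
  rw [heq, integrable_indicator_iff hBc.measurableSet]
  exact hintg

/-- First order expansion of the integral of a local density in one variable. -/
lemma local_estimate (h : Setup X f εtr εnd D CL lam0 T) (i : Fin N) {p : E (n + 1)}
    (hp : p ∈ X) {α : ℝ≥0} (hα0 : 0 < α)
    (hα1 : α ≤ 1) {R H : ℝ} (hR : 0 ≤ R) (hH : 0 ≤ H) {φ : E (n + 1) → ℝ}
    (hφ : IsLocalDensity X p (chartRadius εnd CL) α R H φ) {s : ℝ} (hs : lam i < s)
    (hlam : lam ∈ cube lam0 T) (hlam' : Function.update lam i s ∈ cube lam0 T)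
    (hδ : 4 * (s - lam i) ≤ 3 * εnd * chartRadius εnd CL)
    (hδ1 : s - lam i ≤ 1) {b : ℝ} (hb : b = lam i ∨ b = s) :
    |(∫ x in K X f (Function.update lam i s), φ x) - (∫ x in K X f lam, φ x) -
      (s - lam i) * ∫ x in facet X f (Function.update lam i b) i,
        φ x / ‖gradientWithin (f i) X x‖ ∂μHE[n]| ≤
      localConst n α εtr εnd D CL R H * ((s - lam i) * (s - lam i) ^ (α : ℝ)) := by
  set r := chartRadius εnd CL with hrdef
  have hnd := h.nd.1
  have htr := h.tr.1
  have hr0 : 0 < r := chartRadius_pos hnd CL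
  obtain ⟨G, hG, hγ⟩ := h.exists_chart i (mul_chartRadius_le hnd CL) hp (p := p)
    (by rw [dist_self]; positivity)
  rw [← hrdef] at hG
  set δ := s - lam i with hδdef
  have hδ0 : 0 < δ := sub_pos.2 hs
  set m := 4 / (3 * εnd) with hm
  have hm0 : 0 < m := by positivity
  set L := 4 / (εtr * εnd) with hL
  have hL0 : 0 < L := by positivity
  have hφc := continuousOn_of_holder hα0 hφ.holder
  set K' := K X f (Function.update lam i s) with hK'
  have hK'c : IsCompact K' := h.isCompact_K _
  have hKc : IsCompact (K X f lam) := h.isCompact_K _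
  have hKK' : K X f lam ⊆ K' := fun x hx =>
    mem_K_update_iff.2 ⟨((mem_K_iff i).1 hx).1, (((mem_K_iff i).1 hx).2).trans hs.le⟩
  have hφK' : IntegrableOn φ K' := (hφc.mono fun x hx => hx.1).integrableOn_compact hK'c
  set W := K' \ K X f lam with hW
  have hWm : MeasurableSet W := hK'c.measurableSet.diff hKc.measurableSet
  have hWint : Integrable (W.indicator φ) :=
    (integrable_indicator_iff hWm).2 (hφK'.mono_set sdiff_subset)
  have hlineint : Integrable (fun q : E n × ℝ => W.indicator φ (G.line q.1 q.2)) :=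
    (G.measurePreserving_line.integrable_comp_emb G.measurableEmbedding_line).2 hWint
  set I : E n → ℝ := fun y => ∫ τ, W.indicator φ (G.line y τ) with hI
  have hIint : Integrable I := hlineint.integral_prod_left
  have h1 : (∫ x in K', φ x) - (∫ x in K X f lam, φ x) = ∫ y, I y := by
    rw [← setIntegral_sdiff hKc.measurableSet hφK' hKK', ← hW,
      ← integral_indicator hWm,
      ← G.measurePreserving_line.integral_comp G.measurableEmbedding_line,
      Measure.volume_eq_prod, integral_prod _ (by rw [← Measure.volume_eq_prod]; exact hlineint)]
  have hlamb : Function.update lam i b ∈ cube lam0 T := by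
    rcases hb with rfl | rfl
    · rwa [Function.update_eq_self]
    · exact hlam'
  set J : E n → ℝ := fun y => (facet X f (Function.update lam i b) i).indicator
    (fun x => φ x / inner ℝ (gradientWithin (f i) X x) G.v) (G.pt b y) with hJ
  have hJint : Integrable J := h.integrable_pt_facet hr0 hG hφ.zero hφc _ b
  have h2 : ∫ x in facet X f (Function.update lam i b) i,
      φ x / ‖gradientWithin (f i) X x‖ ∂μHE[n] = ∫ y, J y := by
    refine hG.integral_level_eq (h.diff i) (h.lip i) hr0
      (h.isCompact_facet _ i).isClosed.measurableSet (fun x hx => hx.1.1)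
      (fun x hx => (mem_facet_update_iff.1 hx).2) (h.measure_facet_inter_frontier hlamb i) hφ.zero
  rw [h1, h2, ← integral_const_mul, ← integral_sub hIint (hJint.const_mul δ)]
  obtain ⟨S, hSX, hcov, hcard⟩ := h.exists_cover_edges lam (Function.update lam i s) hδ0 hδ1
  set Bad : Set (E n) := ⋃ x ∈ S, closedBall (G.c.P x) ((L + 1) * δ) with hBad
  have hBadm : MeasurableSet Bad :=
    S.measurableSet_biUnion fun x _ => isClosed_closedBall.measurableSet
  have hV := unitBallVolume_nonneg n
  have hE := edgeConst_nonneg n εtr D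
  have hBadvol : volume Bad ≤
      ENNReal.ofReal (edgeConst n εtr D * (unitBallVolume n * (L + 1) ^ n) * δ) := by
    calc volume Bad ≤ ∑ x ∈ S, volume (closedBall (G.c.P x) ((L + 1) * δ)) :=
          measure_biUnion_finset_le _ _
      _ = ENNReal.ofReal (S.card * (unitBallVolume n * ((L + 1) * δ) ^ n)) := by
        rw [Finset.sum_congr rfl fun x _ => volume_closedBall_eq _ (by positivity),
          Finset.sum_const, nsmul_eq_mul, ← ENNReal.ofReal_natCast,
          ← ENNReal.ofReal_mul (by positivity)]
      _ ≤ _ := by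
        refine ENNReal.ofReal_le_ofReal ?_
        calc S.card * (unitBallVolume n * ((L + 1) * δ) ^ n)
            = S.card * δ ^ n * (unitBallVolume n * (L + 1) ^ n) := by rw [mul_pow]; ring
          _ ≤ edgeConst n εtr D * δ * (unitBallVolume n * (L + 1) ^ n) := by gcongr
          _ = _ := by ring
  have hBadreal : volume.real Bad ≤ edgeConst n εtr D * (unitBallVolume n * (L + 1) ^ n) * δ :=
    ENNReal.toReal_le_of_le_ofReal (by positivity) hBadvol
  set Good := closedBall (G.c.P p) (2 * r) with hGood
  have hGoodreal : volume.real Good = unitBallVolume n * (2 * r) ^ n := by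
    rw [Measure.real, hGood, volume_closedBall_eq _ (by positivity),
      ENNReal.toReal_ofReal (by positivity)]
  set c1 := (H * m * m ^ (α : ℝ) + R * CL * m ^ 3) * (δ * δ ^ (α : ℝ)) with hc1
  set c2 := 2 * R * m * δ with hc2
  have hc10 : 0 ≤ c1 := by positivity
  have hc20 : 0 ≤ c2 := by positivity
  have hgint1 : Integrable (Good.indicator fun _ => c1) :=
    (integrable_indicator_iff isClosed_closedBall.measurableSet).2
      (integrableOn_const measure_closedBall_lt_top.ne)
  have hgint2 : Integrable (Bad.indicator fun _ => c2) :=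
    (integrable_indicator_iff hBadm).2
      (integrableOn_const (hBadvol.trans_lt ENNReal.ofReal_lt_top).ne)
  -- The error is `O(δ^(1+α))` on a set of bounded volume plus `O(δ)` on a set of volume `O(δ)`.
  have hpt : ∀ y, ‖I y - δ * J y‖ ≤
      Good.indicator (fun _ => c1) y + Bad.indicator (fun _ => c2) y := by
    intro y
    have hi1 : 0 ≤ Good.indicator (fun _ => c1) y := indicator_nonneg (fun _ _ => hc10) y
    have hi2 : 0 ≤ Bad.indicator (fun _ => c2) y := indicator_nonneg (fun _ _ => hc20) y
    rw [Real.norm_eq_abs]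
    rcases h.line_estimate hG hγ hα0 hα1 hR hH hφ hs hlam hlam' hδ hδ1 hb y
      (I := I y) (J := J y) rfl rfl with h0 | ⟨hy, hle⟩ | ⟨⟨z, hz, hzy⟩, hle⟩
    · rw [h0, abs_zero]; positivity
    · rw [indicator_of_mem (show y ∈ Good from mem_closedBall.2 hy)]
      exact hle.trans (le_add_of_nonneg_right hi2)
    · have hyB : y ∈ Bad := by
        obtain ⟨x, hx, hzx⟩ := hcov z hz
        refine mem_iUnion₂.2 ⟨x, hx, mem_closedBall.2 ?_⟩
        have h3 := dist_triangle_left y (G.c.P x) (G.c.P z)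
        have h4 := G.dist_P_le z x
        linarith
      rw [indicator_of_mem hyB]
      exact hle.trans (le_add_of_nonneg_left hi1)
  have h3 := norm_integral_le_of_norm_le (hgint1.add hgint2) (Eventually.of_forall hpt)
  rw [Real.norm_eq_abs] at h3
  refine h3.trans ?_
  have h4 : ∫ y, (Good.indicator (fun _ => c1) + Bad.indicator fun _ => c2) y =
      volume.real Good * c1 + volume.real Bad * c2 := by
    rw [integral_add' hgint1 hgint2, integral_indicator isClosed_closedBall.measurableSet,
      integral_indicator hBadm, setIntegral_const, setIntegral_const, smul_eq_mul, smul_eq_mul]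
  rw [h4, hGoodreal]
  calc unitBallVolume n * (2 * r) ^ n * c1 + volume.real Bad * c2
      ≤ unitBallVolume n * (2 * r) ^ n * c1 +
        (edgeConst n εtr D * (unitBallVolume n * (L + 1) ^ n) * δ) * c2 := by gcongr
    _ = unitBallVolume n * (2 * r) ^ n * c1 +
        (2 * R * m) * (edgeConst n εtr D * (unitBallVolume n * (L + 1) ^ n)) * (δ * δ) := by
      rw [hc2]; ring
    _ ≤ unitBallVolume n * (2 * r) ^ n * c1 +
        (2 * R * m) * (edgeConst n εtr D * (unitBallVolume n * (L + 1) ^ n)) *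
          (δ * δ ^ (α : ℝ)) := by
      have := le_rpow_of_le_one hδ0 hδ1 hα1
      gcongr
    _ = _ := by rw [localConst, hc1]; ring

end Setup

end LocReg

/-! ### Partition of unity and summation of the local expansions. -/

namespace LocReg

open Set Metric Filter Topology InnerProductSpace MeasureTheory

variable {d N n : ℕ}

lemma le_mul_rpow_of_le {α : ℝ≥0} (hα1 : α ≤ 1) {D t : ℝ} (ht : 0 ≤ t) (htD : t ≤ D) :
    t ≤ (D + 1) * t ^ (α : ℝ) := by
  rcases ht.eq_or_lt with rfl | ht0
  · positivity
  have hp : 0 ≤ t ^ (α : ℝ) := by positivity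
  rcases le_total t 1 with h1 | h1
  · nlinarith [le_rpow_of_le_one ht0 h1 hα1]
  · have : 1 ≤ t ^ (α : ℝ) := Real.one_le_rpow h1 α.coe_nonneg
    nlinarith

/-- The number of functions in the partition of unity. -/
noncomputable def netCard (d : ℕ) (D : ℝ≥0) (r : ℝ) : ℝ := (D + r / 2) ^ d / (r / 2 / 2) ^ d

lemma netCard_nonneg (d : ℕ) (D : ℝ≥0) {r : ℝ} (hr : 0 < r) : 0 ≤ netCard d D r := by
  unfold netCard; positivity

namespace Setup

/-- Tent functions of radius `r` centred on an `r / 2`-net have sum at least `r / 2` on `X`.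
Dividing by the sum keeps a Lipschitz constant controlled by the size of the net. -/
lemma exists_partition {X : Set (E d)} {f : Fin N → E d → ℝ} {εtr εnd : ℝ} {D CL : ℝ≥0}
    {lam0 : Fin N → ℝ} {T : ℝ} (h : Setup X f εtr εnd D CL lam0 T) {r : ℝ} (hr : 0 < r) :
    ∃ (S : Finset (E d)) (χ : E d → E d → ℝ), (∀ p ∈ S, p ∈ X) ∧ (S.card : ℝ) ≤ netCard d D r ∧
      (∀ p x, r ≤ dist x p → χ p x = 0) ∧ (∀ x ∈ X, ∑ p ∈ S, χ p x = 1) ∧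
      (∀ p ∈ S, ∀ x ∈ X, |χ p x| ≤ 1) ∧
      ∀ p ∈ S, ∀ x ∈ X, ∀ x' ∈ X,
        |χ p x - χ p x'| ≤ (1 + netCard d D r) * (2 / r) * dist x x' := by
  obtain ⟨S, hSX, hcov, hcard⟩ := h.exists_net (half_pos hr)
  set ψ : E d → E d → ℝ := fun p x => max 0 (r - dist x p) with hψ
  have hψ0 : ∀ p x, 0 ≤ ψ p x := fun p x => le_max_left _ _
  have hψz : ∀ p x, r ≤ dist x p → ψ p x = 0 := fun p x hx => max_eq_left (by linarith)
  have hψlip : ∀ p x x', |ψ p x - ψ p x'| ≤ dist x x' := by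
    intro p x x'
    refine (abs_max_sub_max_le_max 0 (r - dist x p) 0 (r - dist x' p)).trans ?_
    rw [sub_self, abs_zero, sub_sub_sub_cancel_left, abs_sub_comm]
    exact max_le dist_nonneg (abs_dist_sub_le x x' p)
  set Ψ : E d → ℝ := fun x => ∑ p ∈ S, ψ p x with hΨ
  have hΨr : ∀ x ∈ X, r / 2 ≤ Ψ x := by
    intro x hx
    obtain ⟨p, hp, hpx⟩ := hcov x hx
    have h1 : r / 2 ≤ ψ p x := le_max_of_le_right (by linarith)
    exact h1.trans (Finset.single_le_sum (fun q _ => hψ0 q x) hp)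
  have hψΨ : ∀ p ∈ S, ∀ x, ψ p x ≤ Ψ x := fun p hp x =>
    Finset.single_le_sum (f := fun q => ψ q x) (fun q _ => hψ0 q x) hp
  have hΨlip : ∀ x x', |Ψ x - Ψ x'| ≤ netCard d D r * dist x x' := by
    intro x x'
    rw [hΨ]
    dsimp only
    rw [← Finset.sum_sub_distrib]
    calc |∑ p ∈ S, (ψ p x - ψ p x')| ≤ ∑ p ∈ S, |ψ p x - ψ p x'| := Finset.abs_sum_le_sum_abs _ _
      _ ≤ ∑ p ∈ S, dist x x' := Finset.sum_le_sum fun p _ => hψlip p x x'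
      _ = S.card * dist x x' := by rw [Finset.sum_const, nsmul_eq_mul]
      _ ≤ _ := by gcongr; exact hcard
  have hM := netCard_nonneg d D hr
  refine ⟨S, fun p x => ψ p x / Ψ x, fun p hp => hSX hp, hcard,
    fun p x hx => by dsimp only; rw [hψz p x hx, zero_div], fun x hx => ?_, fun p hp x hx => ?_,
    fun p hp x hx x' hx' => ?_⟩
  · have : 0 < Ψ x := lt_of_lt_of_le (by positivity) (hΨr x hx)
    rw [← Finset.sum_div, div_self this.ne']
  · have : 0 < Ψ x := lt_of_lt_of_le (by positivity) (hΨr x hx)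
    rw [abs_of_nonneg (div_nonneg (hψ0 p x) this.le)]
    exact div_le_one_of_le₀ (hψΨ p hp x) this.le
  · have hx0 : 0 < Ψ x := lt_of_lt_of_le (by positivity) (hΨr x hx)
    have hx0' : 0 < Ψ x' := lt_of_lt_of_le (by positivity) (hΨr x' hx')
    have h1 : ψ p x / Ψ x - ψ p x' / Ψ x' =
        ((ψ p x - ψ p x') + ψ p x' / Ψ x' * (Ψ x' - Ψ x)) / Ψ x := by field_simp; ring
    have h2 : ψ p x' / Ψ x' ≤ 1 := div_le_one_of_le₀ (hψΨ p hp x') hx0'.le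
    have h3 : 0 ≤ ψ p x' / Ψ x' := div_nonneg (hψ0 p x') hx0'.le
    rw [h1, abs_div, abs_of_pos hx0, div_le_iff₀ hx0]
    have h4 : |Ψ x' - Ψ x| ≤ netCard d D r * dist x x' := by
      rw [abs_sub_comm]; exact hΨlip x x'
    calc |(ψ p x - ψ p x') + ψ p x' / Ψ x' * (Ψ x' - Ψ x)|
        ≤ |ψ p x - ψ p x'| + |ψ p x' / Ψ x' * (Ψ x' - Ψ x)| := abs_add_le _ _
      _ ≤ dist x x' + 1 * (netCard d D r * dist x x') := by
        rw [abs_mul, abs_of_nonneg h3]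
        exact add_le_add (hψlip p x x') (mul_le_mul h2 h4 (abs_nonneg _) zero_le_one)
      _ = (1 + netCard d D r) * (2 / r) * dist x x' * (r / 2) := by field_simp
      _ ≤ _ := by
        have := hΨr x hx
        gcongr

end Setup

/-- A Hölder function bounded by `R`, with Hölder constant `R`. -/
structure IsDensity (X : Set (E d)) (α : ℝ≥0) (R : ℝ) (ρ : E d → ℝ) : Prop where
  bound : ∀ x ∈ X, |ρ x| ≤ R
  holder : ∀ x ∈ X, ∀ x' ∈ X, |ρ x - ρ x'| ≤ R * dist x x' ^ (α : ℝ)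

/-- The Hölder constant of the localized densities. -/
noncomputable def localHolder (d : ℕ) (D : ℝ≥0) (r R : ℝ) : ℝ :=
  R + R * ((1 + netCard d D r) * (2 / r) * (D + 1))

lemma localHolder_nonneg (d : ℕ) (D : ℝ≥0) {r R : ℝ} (hr : 0 < r) (hR : 0 ≤ R) :
    0 ≤ localHolder d D r R := by
  have := netCard_nonneg d D hr
  unfold localHolder
  positivity

/-- The integral over a facet giving the partial derivative. -/
noncomputable def facetIntegral (X : Set (E (n + 1))) (f : Fin N → E (n + 1) → ℝ)
    (ρ : E (n + 1) → ℝ) (lam : Fin N → ℝ) (i : Fin N) : ℝ :=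
  ∫ x in facet X f lam i, ρ x / ‖gradientWithin (f i) X x‖ ∂μHE[n]

namespace Setup

lemma exists_localization {X : Set (E d)} {f : Fin N → E d → ℝ} {εtr εnd : ℝ} {D CL : ℝ≥0}
    {lam0 : Fin N → ℝ} {T : ℝ} (h : Setup X f εtr εnd D CL lam0 T) {r : ℝ} (hr : 0 < r)
    {α : ℝ≥0} (hα1 : α ≤ 1) {R : ℝ} {ρ : E d → ℝ} (hρ : IsDensity X α R ρ) :
    ∃ (S : Finset (E d)) (φ : E d → E d → ℝ), (∀ p ∈ S, p ∈ X) ∧ (S.card : ℝ) ≤ netCard d D r ∧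
      (∀ p ∈ S, IsLocalDensity X p r α R (localHolder d D r R) (φ p)) ∧
      ∀ x ∈ X, ρ x = ∑ p ∈ S, φ p x := by
  obtain ⟨S, χ, hSX, hcard, hzero, hsum, hone, hlip⟩ := h.exists_partition hr
  have hM := netCard_nonneg d D hr
  refine ⟨S, fun p x => χ p x * ρ x, hSX, hcard, fun p hp => ⟨fun x hx => ?_, fun x hx => ?_,
    fun x hx x' hx' => ?_⟩, fun x hx => ?_⟩
  · dsimp only
    rw [hzero p x hx, zero_mul]
  · rw [abs_mul]
    calc |χ p x| * |ρ x| ≤ 1 * R :=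
          mul_le_mul (hone p hp x hx) (hρ.bound x hx) (abs_nonneg _) zero_le_one
      _ = R := one_mul R
  · have hd := le_mul_rpow_of_le hα1 dist_nonneg (h.dist_le hx hx')
    -- Product rule for Hölder functions; the Lipschitz cut-off is Hölder because `X` has bounded
    -- diameter.
    have h1 : χ p x * ρ x - χ p x' * ρ x' =
      χ p x * (ρ x - ρ x') + (χ p x - χ p x') * ρ x' := by ring
    rw [h1]
    calc |χ p x * (ρ x - ρ x') + (χ p x - χ p x') * ρ x'|
        ≤ |χ p x * (ρ x - ρ x')| + |(χ p x - χ p x') * ρ x'| := abs_add_le _ _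
      _ ≤ 1 * (R * dist x x' ^ (α : ℝ)) +
          ((1 + netCard d D r) * (2 / r) * ((D + 1) * dist x x' ^ (α : ℝ))) * R := by
        rw [abs_mul, abs_mul]
        refine add_le_add (mul_le_mul (hone p hp x hx) (hρ.holder x hx x' hx') (abs_nonneg _)
          zero_le_one) (mul_le_mul ((hlip p hp x hx x' hx').trans ?_) (hρ.bound x' hx')
          (abs_nonneg _) (by positivity))
        gcongr
      _ = _ := by rw [localHolder]; ring
  · rw [← Finset.sum_mul, hsum x hx, one_mul]

variable {X : Set (E (n + 1))} {f : Fin N → E (n + 1) → ℝ} {εtr εnd : ℝ} {D CL : ℝ≥0}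
  {lam0 lam : Fin N → ℝ} {T : ℝ}

lemma norm_div_norm_gradientWithin_le (h : Setup X f εtr εnd D CL lam0 T) {R : ℝ}
    {φ : E (n + 1) → ℝ} (hφ : ∀ x ∈ X, |φ x| ≤ R) (i : Fin N) {x : E (n + 1)} (hx : x ∈ X) :
    ‖φ x / ‖gradientWithin (f i) X x‖‖ ≤ R / εnd := by
  have := h.nd.1
  rw [norm_div, norm_norm, Real.norm_eq_abs]
  have hR : 0 ≤ R := (abs_nonneg _).trans (hφ x hx)
  exact div_le_div₀ hR (hφ x hx) this (h.nd.2 i x hx)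

lemma integrableOn_facet (h : Setup X f εtr εnd D CL lam0 T) {R : ℝ}
    {φ : E (n + 1) → ℝ} (hφ : ∀ x ∈ X, |φ x| ≤ R) (hφc : ContinuousOn φ X)
    (lam : Fin N → ℝ) (i : Fin N) :
    IntegrableOn (fun x => φ x / ‖gradientWithin (f i) X x‖) (facet X f lam i) μHE[n] := by
  have hm := (h.isCompact_facet lam i).isClosed.measurableSet
  have hsub : facet X f lam i ⊆ X := fun x hx => hx.1.1
  have : IsFiniteMeasure ((μHE[n] : Measure (E (n + 1))).restrict (facet X f lam i)) :=
    ⟨by rw [Measure.restrict_apply_univ]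
        exact (h.measure_facet_le lam i).trans_lt ENNReal.ofReal_lt_top⟩
  refine Integrable.of_bound ?_ (R / εnd) ?_
  · refine ContinuousOn.aestronglyMeasurable ?_ hm
    exact ((hφc.mono hsub).div ((h.continuousOn_gradientWithin i).mono hsub).norm
      fun x hx => (h.norm_gradientWithin_pos i (hsub hx)).ne')
  · exact (ae_restrict_mem hm).mono fun x hx =>
      h.norm_div_norm_gradientWithin_le hφ i (hsub hx)

/-- First order expansion of `G` in one variable, for small increments. -/
lemma expansion_of_small (h : Setup X f εtr εnd D CL lam0 T) (i : Fin N) {α : ℝ≥0} (hα0 : 0 < α)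
    (hα1 : α ≤ 1) {R : ℝ} (hR : 0 ≤ R) {ρ : E (n + 1) → ℝ} (hρ : IsDensity X α R ρ) {s : ℝ}
    (hs : lam i < s) (hlam : lam ∈ cube lam0 T) (hlam' : Function.update lam i s ∈ cube lam0 T)
    (hδ : 4 * (s - lam i) ≤ 3 * εnd * chartRadius εnd CL) (hδ1 : s - lam i ≤ 1) {b : ℝ}
    (hb : b = lam i ∨ b = s) :
    |G X f ρ (Function.update lam i s) - G X f ρ lam -
      (s - lam i) * facetIntegral X f ρ (Function.update lam i b) i| ≤
      netCard (n + 1) D (chartRadius εnd CL) * localConst n α εtr εnd D CL R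
        (localHolder (n + 1) D (chartRadius εnd CL) R) * ((s - lam i) * (s - lam i) ^ (α : ℝ)) := by
  have hr := chartRadius_pos h.nd.1 CL
  set r := chartRadius εnd CL
  obtain ⟨S, φ, hSX, hcard, hφ, hsum⟩ := h.exists_localization hr hα1 hρ
  have hφc : ∀ p ∈ S, ContinuousOn (φ p) X := fun p hp =>
    continuousOn_of_holder hα0 (hφ p hp).holder
  have hGsum : ∀ lam, G X f ρ lam = ∑ p ∈ S, ∫ x in K X f lam, φ p x := by
    intro lam
    have hKc := h.isCompact_K lam
    rw [G, ← integral_finsetSum _ fun p hp =>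
      ((hφc p hp).mono fun x hx => hx.1).integrableOn_compact hKc]
    exact setIntegral_congr_fun hKc.measurableSet fun x hx => hsum x hx.1
  have hFsum : facetIntegral X f ρ (Function.update lam i b) i =
      ∑ p ∈ S, ∫ x in facet X f (Function.update lam i b) i,
        φ p x / ‖gradientWithin (f i) X x‖ ∂μHE[n] := by
    rw [facetIntegral, ← integral_finsetSum _ fun p hp =>
      h.integrableOn_facet (hφ p hp).bound (hφc p hp) _ i]
    refine setIntegral_congr_fun (h.isCompact_facet _ i).isClosed.measurableSet fun x hx => ?_
    rw [hsum x hx.1.1, Finset.sum_div]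
  rw [hGsum, hGsum, hFsum, Finset.mul_sum, ← Finset.sum_sub_distrib, ← Finset.sum_sub_distrib]
  have hH := localHolder_nonneg (n + 1) D hr hR
  have hδ0 : 0 < s - lam i := sub_pos.2 hs
  have hC := localConst_nonneg n α h.tr.1 h.nd.1 D CL hR hH
  refine (Finset.abs_sum_le_sum_abs _ _).trans ((Finset.sum_le_sum fun p hp =>
    h.local_estimate i (hSX p hp) hα0 hα1 hR hH (hφ p hp) hs hlam hlam' hδ hδ1 hb).trans ?_)
  rw [Finset.sum_const, nsmul_eq_mul, ← mul_assoc]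
  gcongr

/-- A bound for the integrals over the facets. -/
lemma abs_setIntegral_facet_le (h : Setup X f εtr εnd D CL lam0 T) {R : ℝ} (hR : 0 ≤ R)
    {ρ : E (n + 1) → ℝ} (hρ : ∀ x ∈ X, |ρ x| ≤ R) (i : Fin N) {A : Set (E (n + 1))} {c : ℝ}
    (hc : 0 ≤ c) (hAX : A ⊆ X) (hA : μHE[n] A ≤ ENNReal.ofReal c) :
    |∫ x in A, ρ x / ‖gradientWithin (f i) X x‖ ∂μHE[n]| ≤ R / εnd * c := by
  have := h.nd.1
  rw [← Real.norm_eq_abs]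
  refine (norm_setIntegral_le_of_norm_le_const (hA.trans_lt ENNReal.ofReal_lt_top)
    fun x hx => h.norm_div_norm_gradientWithin_le hρ i (hAX hx)).trans ?_
  gcongr
  exact ENNReal.toReal_le_of_le_ofReal hc hA

/-- Dependence of the facet integrals on the other variables, for small increments. -/
lemma abs_facetIntegral_sub_le_of_ne (h : Setup X f εtr εnd D CL lam0 T) {i j : Fin N}
    (hij : i ≠ j) {α : ℝ≥0} (hα0 : 0 < α)
    {R : ℝ} (hR : 0 ≤ R) {ρ : E (n + 1) → ℝ} (hρ : IsDensity X α R ρ) {s : ℝ}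
    (hs : lam j < s) (hlam : lam ∈ cube lam0 T) (hlam' : Function.update lam j s ∈ cube lam0 T)
    (hδ : (4 / (εtr * εnd) + 1) * (s - lam j) ≤ chartRadius εnd CL) (hδ1 : s - lam j ≤ 1) :
    |facetIntegral X f ρ (Function.update lam j s) i - facetIntegral X f ρ lam i| ≤
      R / εnd * (edgeConst n εtr D * (2 ^ n * unitBallVolume n * (4 / (εtr * εnd) + 1) ^ n) *
        (s - lam j)) := by
  have hnd := h.nd.1
  have htr := h.tr.1
  have hδ0 : 0 < s - lam j := sub_pos.2 hs
  have hV := unitBallVolume_nonneg n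
  have hE := edgeConst_nonneg n εtr D
  have hsub : facet X f lam i ⊆ facet X f (Function.update lam j s) i := fun x hx =>
    ⟨mem_K_update_iff.2 ⟨((mem_K_iff j).1 hx.1).1, ((mem_K_iff j).1 hx.1).2.trans hs.le⟩, by
      rw [Function.update_of_ne hij]; exact hx.2⟩
  rw [facetIntegral, facetIntegral, ← setIntegral_sdiff
    (h.isCompact_facet lam i).isClosed.measurableSet
    (h.integrableOn_facet hρ.bound (continuousOn_of_holder hα0 hρ.holder) _ i) hsub]
  -- The new points of the facet lie in the slab of `f j` with the constraint `i` active, hence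
  -- close to an edge.
  have hA : ∀ x ∈ facet X f (Function.update lam j s) i \ facet X f lam i,
      x ∈ K X f (Function.update lam j s) ∧ f i x = lam i ∧ lam j ≤ f j x := by
    intro x hx
    have h1 : f i x = lam i := by
      have := hx.1.2
      rwa [Function.update_of_ne hij] at this
    refine ⟨hx.1.1, h1, ?_⟩
    by_contra! hlt
    exact hx.2 ⟨(mem_K_iff j).2 ⟨(mem_K_update_iff.1 hx.1.1).1, hlt.le⟩, h1⟩
  refine h.abs_setIntegral_facet_le hR hρ.bound i (by positivity) (fun x hx => hx.1.1.1)
    (h.measure_near_edge_le (mul_chartRadius_le hnd CL) (i := i) (t := lam i)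
      (fun x hx => ⟨hx.1.1.1, (hA x hx).2.1⟩) (by positivity) hδ0 hδ1 hδ (lam := lam)
      (lam' := Function.update lam j s) fun x hx => ?_)
  exact h.exists_edge_near hs hlam hlam' (hA x hx).1 (hA x hx).2.2
    (Or.inr ⟨i, hij, (hA x hx).2.1⟩)

end Setup

end LocReg

/-! ### Uniform constants for the coordinatewise estimates. -/

namespace LocReg

open Set Metric Filter Topology InnerProductSpace MeasureTheory

variable {d N n : ℕ}

/-- `g` consists of the partial derivatives of `F`, in a quantitative sense: along each coordinate
direction they are `α`-Hölder and give the first order expansion of `F`. -/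
structure CoordRegular (Q : Set (Fin N → ℝ)) (α : ℝ≥0) (C : ℝ) (F : (Fin N → ℝ) → ℝ)
    (g : (Fin N → ℝ) → Fin N → ℝ) : Prop where
  bound : ∀ lam ∈ Q, ∀ i, |g lam i| ≤ C
  holder : ∀ lam ∈ Q, ∀ j s, Function.update lam j s ∈ Q → ∀ i,
    |g (Function.update lam j s) i - g lam i| ≤ C * |s - lam j| ^ (α : ℝ)
  expansion : ∀ lam ∈ Q, ∀ j s, Function.update lam j s ∈ Q →
    |F (Function.update lam j s) - F lam - (s - lam j) * g lam j| ≤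
      C * (|s - lam j| * |s - lam j| ^ (α : ℝ))

/-- It suffices to consider positive increments, with expansions at both ends. -/
lemma CoordRegular.of_lt {Q : Set (Fin N → ℝ)} {α : ℝ≥0} (hα0 : 0 < α) {C : ℝ}
    {F : (Fin N → ℝ) → ℝ} {g : (Fin N → ℝ) → Fin N → ℝ}
    (hb : ∀ lam ∈ Q, ∀ i, |g lam i| ≤ C)
    (hh : ∀ lam ∈ Q, ∀ j s, lam j < s → Function.update lam j s ∈ Q → ∀ i,
      |g (Function.update lam j s) i - g lam i| ≤ C * (s - lam j) ^ (α : ℝ))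
    (he : ∀ lam ∈ Q, ∀ j s, lam j < s → Function.update lam j s ∈ Q →
      ∀ b, b = lam j ∨ b = s →
      |F (Function.update lam j s) - F lam - (s - lam j) * g (Function.update lam j b) j| ≤
        C * ((s - lam j) * (s - lam j) ^ (α : ℝ))) : CoordRegular Q α C F g := by
  have hα : (α : ℝ) ≠ 0 := NNReal.coe_ne_zero.2 hα0.ne'
  refine ⟨hb, fun lam hlam j s hs i => ?_, fun lam hlam j s hs => ?_⟩
  · rcases lt_trichotomy (lam j) s with hlt | heq | hgt
    · rw [abs_of_pos (sub_pos.2 hlt)]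
      exact hh lam hlam j s hlt hs i
    · rw [← heq, Function.update_eq_self, sub_self, sub_self, abs_zero, Real.zero_rpow hα, mul_zero]
    · have := hh _ hs j (lam j) (by rwa [Function.update_self]) (by simpa using hlam) i
      rw [Function.update_idem, Function.update_eq_self, Function.update_self] at this
      rwa [abs_sub_comm, abs_sub_comm s, abs_of_pos (sub_pos.2 hgt)]
  · rcases lt_trichotomy (lam j) s with hlt | heq | hgt
    · have := he lam hlam j s hlt hs (lam j) (Or.inl rfl)
      rw [Function.update_eq_self] at this
      rwa [abs_of_pos (sub_pos.2 hlt)]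
    · rw [← heq, Function.update_eq_self]
      simp
    -- A decreasing step is read from its lower end, so the derivative is needed at the upper end;
    -- this is why both choices of `b` are assumed.
    · have := he _ hs j (lam j) (by rwa [Function.update_self]) (by simpa using hlam) (lam j)
        (Or.inr rfl)
      rw [Function.update_idem, Function.update_eq_self, Function.update_self] at this
      rw [abs_sub_comm s, abs_of_pos (sub_pos.2 hgt), abs_sub_comm]
      convert! this using 2
      ring

lemma abs_G_le_one {X : Set (E d)} {f : Fin N → E d → ℝ} {ρ : E d → ℝ} (hX : IsCompact X)
    (hρc : ContinuousOn ρ X) (hρ : IsProbDensityOn ρ X) (lam : Fin N → ℝ)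
    (hK : MeasurableSet (K X f lam)) : |G X f ρ lam| ≤ 1 := by
  have hsub : K X f lam ⊆ X := fun x hx => hx.1
  rw [G, abs_of_nonneg (setIntegral_nonneg hK fun x hx => hρ.1 x hx.1), ← hρ.2]
  refine setIntegral_mono_set (hρc.integrableOn_compact hX) ?_ hsub.eventuallyLE
  exact (ae_restrict_mem hX.measurableSet).mono fun x hx => hρ.1 x hx

/-- The quantitative differentiability of `G`, with a uniform constant. -/
lemma exists_coordRegular (n N : ℕ) {α : ℝ≥0} (hα0 : 0 < α) (hα1 : α ≤ 1) {εtr εnd : ℝ}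
    (htr : 0 < εtr) (hnd : 0 < εnd) (R D CL : ℝ≥0) :
    ∃ C : ℝ, ∀ (X : Set (E (n + 1))) (f : Fin N → E (n + 1) → ℝ) (ρ : E (n + 1) → ℝ)
      (lam0 : Fin N → ℝ) (T : ℝ), Setup X f εtr εnd D CL lam0 T → IsDensity X α R ρ →
      IsProbDensityOn ρ X →
      CoordRegular (cube lam0 T) α C (G X f ρ) (facetIntegral X f ρ) := by
  set r := chartRadius εnd CL with hrdef
  have hr : 0 < r := chartRadius_pos hnd CL
  have hV := unitBallVolume_nonneg n
  have hE := edgeConst_nonneg n εtr D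
  set L := 4 / (εtr * εnd) with hL
  have hL0 : 0 < L := by positivity
  set C1 := netCard (n + 1) D r * localConst n α εtr εnd D CL R (localHolder (n + 1) D r R)
    with hC1
  have hC10 : 0 ≤ C1 := mul_nonneg (netCard_nonneg _ _ hr)
    (localConst_nonneg n α htr hnd D CL R.coe_nonneg (localHolder_nonneg _ _ hr R.coe_nonneg))
  set C2 := R / εnd * (edgeConst n εtr D * (2 ^ n * unitBallVolume n * (L + 1) ^ n)) with hC2
  have hC20 : 0 ≤ C2 := by positivity
  set B := R / εnd * ((D + r) ^ (n + 1) / (r / 2) ^ (n + 1) *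
    (2 ^ n * (unitBallVolume n * r ^ n))) with hB
  have hB0 : 0 ≤ B := by positivity
  -- Below this threshold every smallness condition of the local estimates holds. It depends only on
  -- the data, not on the cube.
  set δ0 := min 1 (min (3 * εnd * r / 4) (r / (L + 1))) with hδ0
  have hδ0p : 0 < δ0 := lt_min one_pos (lt_min (by positivity) (by positivity))
  have hδ01 : δ0 ≤ 1 := min_le_left _ _
  have hδ0a : δ0 ≤ 3 * εnd * r / 4 := (min_le_right _ _).trans (min_le_left _ _)
  have hδ0b : δ0 ≤ r / (L + 1) := (min_le_right _ _).trans (min_le_right _ _)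
  have hC3 : 0 ≤ 2 * B / δ0 := by positivity
  have hC4 : 0 ≤ 2 / δ0 ^ 2 := by positivity
  set C := 2 * C1 + C2 + B + 2 * B / δ0 + 2 / δ0 ^ 2 with hC
  refine ⟨C, fun X f ρ lam0 T h hρ hρp => ?_⟩
  have hbound : ∀ lam i, |facetIntegral X f ρ lam i| ≤ B := fun lam i =>
    h.abs_setIntegral_facet_le R.coe_nonneg hρ.bound i (by positivity) (fun x hx => hx.1.1)
      (h.measure_facet_le lam i)
  have hG1 : ∀ lam, |G X f ρ lam| ≤ 1 := fun lam =>
    abs_G_le_one h.compact (continuousOn_of_holder hα0 hρ.holder) hρp lam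
      (h.isCompact_K lam).measurableSet
  refine CoordRegular.of_lt hα0 (fun lam _ i => (hbound lam i).trans (by linarith))
    (fun lam hlam j s hs hs' i => ?_) (fun lam hlam j s hs hs' b hb => ?_)
  all_goals
    have hδp : 0 < s - lam j := sub_pos.2 hs
    set δ := s - lam j with hδ
    have hαp : 0 < δ ^ (α : ℝ) := Real.rpow_pos_of_pos hδp _
  · rcases le_or_gt δ δ0 with hle | hgt
    · by_cases hij : i = j
      · subst hij
        have hsm : 4 * (s - lam i) ≤ 3 * εnd * chartRadius εnd CL := by linarith
        have h1 := h.expansion_of_small i hα0 hα1 R.coe_nonneg hρ hs hlam hs' hsm (hle.trans hδ01)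
          (Or.inl rfl)
        have h2 := h.expansion_of_small i hα0 hα1 R.coe_nonneg hρ hs hlam hs' hsm (hle.trans hδ01)
          (Or.inr rfl)
        rw [Function.update_eq_self, ← hδ, ← hrdef, ← hC1] at h1
        rw [← hδ, ← hrdef, ← hC1] at h2
        set g := facetIntegral X f ρ lam i
        set g' := facetIntegral X f ρ (Function.update lam i s) i
        set a := G X f ρ (Function.update lam i s) - G X f ρ lam
        -- Both expansions approximate the same increment of `G`, so their slopes agree up to
        -- `O(δ^α)`.
        have h3 : δ * |g' - g| ≤ δ * (2 * C1 * δ ^ (α : ℝ)) := by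
          calc δ * |g' - g| = |(a - δ * g) - (a - δ * g')| := by
                rw [← abs_of_pos hδp, ← abs_mul, abs_of_pos hδp]; congr 1; ring
            _ ≤ |a - δ * g| + |a - δ * g'| := abs_sub _ _
            _ ≤ _ := by linarith
        refine (le_of_mul_le_mul_left h3 hδp).trans ?_
        gcongr
        linarith
      · have hsm : (L + 1) * (s - lam j) ≤ r := by
          have := hle.trans hδ0b
          rw [le_div_iff₀ (by positivity)] at this
          linarith
        refine (h.abs_facetIntegral_sub_le_of_ne hij hα0 R.coe_nonneg hρ hs hlam hs' hsm
          (hle.trans hδ01)).trans ?_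
        rw [← mul_assoc, ← hδ, ← hL, ← hC2]
        have := le_rpow_of_le_one hδp (hle.trans hδ01) hα1
        calc C2 * δ ≤ C2 * δ ^ (α : ℝ) := by gcongr
          _ ≤ C * δ ^ (α : ℝ) := by gcongr; linarith
    -- Beyond the threshold, `δ^α` is bounded below and the crude bound `B` on the facet integrals
    -- suffices.
    · have h1 : δ0 ≤ δ ^ (α : ℝ) := (le_rpow_of_le_one hδ0p hδ01 hα1).trans (by gcongr)
      calc |facetIntegral X f ρ (Function.update lam j s) i - facetIntegral X f ρ lam i|
          ≤ |facetIntegral X f ρ (Function.update lam j s) i| + |facetIntegral X f ρ lam i| :=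
            abs_sub _ _
        _ ≤ 2 * B / δ0 * δ0 := by
            rw [div_mul_cancel₀ _ hδ0p.ne']; linarith [hbound (Function.update lam j s) i,
              hbound lam i]
        _ ≤ C * δ ^ (α : ℝ) := by gcongr; linarith
  · rcases le_or_gt δ δ0 with hle | hgt
    · refine (h.expansion_of_small j hα0 hα1 R.coe_nonneg hρ hs hlam hs' (by linarith) (hle.trans hδ01)
        hb).trans ?_
      rw [← hδ, ← hrdef, ← hC1]
      gcongr
      linarith
    · have h1 : δ0 ≤ δ ^ (α : ℝ) := (le_rpow_of_le_one hδ0p hδ01 hα1).trans (by gcongr)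
      set g := facetIntegral X f ρ (Function.update lam j b) j
      have hg : |g| ≤ B := hbound _ _
      calc |G X f ρ (Function.update lam j s) - G X f ρ lam - δ * g|
          ≤ |G X f ρ (Function.update lam j s)| + |G X f ρ lam| + |δ * g| :=
            (abs_sub _ _).trans (add_le_add_left (abs_sub _ _) _)
        _ ≤ 1 + 1 + δ * B := by
            rw [abs_mul, abs_of_pos hδp]
            gcongr
            · exact hG1 _
            · exact hG1 _
        _ = 2 / δ0 ^ 2 * (δ0 * δ0) + B / δ0 * (δ * δ0) := by field_simp; ring
        _ ≤ 2 / δ0 ^ 2 * (δ * δ ^ (α : ℝ)) + B / δ0 * (δ * δ ^ (α : ℝ)) := by gcongr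
        _ = (2 / δ0 ^ 2 + B / δ0) * (δ * δ ^ (α : ℝ)) := by ring
        _ ≤ C * (δ * δ ^ (α : ℝ)) := by
            gcongr
            have h3 : B / δ0 ≤ 2 * B / δ0 := by gcongr; linarith
            linarith

end LocReg

/-! ### From coordinatewise estimates to `C^{1,α}` on the cube. -/

namespace LocReg

open Set Metric Filter Topology InnerProductSpace MeasureTheory

variable {d N n : ℕ}

/-- The linear form on `ℝ^N` with coefficients `a`. -/
noncomputable def linForm (a : Fin N → ℝ) : (Fin N → ℝ) →L[ℝ] ℝ :=
  ∑ i, a i • ContinuousLinearMap.proj (R := ℝ) (φ := fun _ : Fin N => ℝ) i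

lemma linForm_apply (a v : Fin N → ℝ) : linForm a v = ∑ i, a i * v i := by
  simp [linForm]

lemma linForm_single (a : Fin N → ℝ) (i : Fin N) : linForm a (Pi.single i 1) = a i := by
  rw [linForm_apply, Finset.sum_eq_single i (fun j _ hj => by rw [Pi.single_eq_of_ne hj, mul_zero])
    (by simp), Pi.single_eq_same, mul_one]

lemma norm_linForm_le {a : Fin N → ℝ} {c : ℝ} (hc : 0 ≤ c) (ha : ∀ i, |a i| ≤ c) :
    ‖linForm a‖ ≤ N * c := by
  refine ContinuousLinearMap.opNorm_le_bound _ (by positivity) fun v => ?_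
  rw [linForm_apply, Real.norm_eq_abs]
  calc |∑ i, a i * v i| ≤ ∑ i, |a i * v i| := Finset.abs_sum_le_sum_abs _ _
    _ ≤ ∑ _i : Fin N, c * ‖v‖ := Finset.sum_le_sum fun i _ => by
        rw [abs_mul]
        exact mul_le_mul (ha i) (norm_le_pi_norm v i) (abs_nonneg _) hc
    _ = _ := by rw [Finset.sum_const, Finset.card_univ, Fintype.card_fin, nsmul_eq_mul]; ring

lemma linForm_sub (a b : Fin N → ℝ) : linForm a - linForm b = linForm (a - b) := by
  ext v
  simp [linForm_apply, sub_mul, Finset.sum_sub_distrib]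

lemma piecewise_mem_cube {lam0 lam lam' : Fin N → ℝ} {T : ℝ} (hlam : lam ∈ cube lam0 T)
    (hlam' : lam' ∈ cube lam0 T) (A : Finset (Fin N)) : A.piecewise lam' lam ∈ cube lam0 T := by
  intro i
  by_cases hi : i ∈ A
  · rw [Finset.piecewise_eq_of_mem _ _ _ hi]; exact hlam' i
  · rw [Finset.piecewise_eq_of_notMem _ _ _ hi]; exact hlam i

lemma cube_eq_closedBall (lam0 : Fin N → ℝ) {T : ℝ} (hT : 0 < T) :
    cube lam0 T = closedBall lam0 T := by
  ext lam
  rw [mem_cube_iff hT.le, mem_closedBall, dist_eq_norm]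

lemma uniqueDiffOn_cube (lam0 : Fin N → ℝ) {T : ℝ} (hT : 0 < T) :
    UniqueDiffOn ℝ (cube lam0 T) := by
  rw [cube_eq_closedBall lam0 hT]
  exact uniqueDiffOn_convex (convex_closedBall lam0 T)
    ⟨lam0, ball_subset_interior_closedBall (mem_ball_self hT)⟩

namespace CoordRegular

variable {lam0 lam lam' : Fin N → ℝ} {T : ℝ} {α : ℝ≥0} {C : ℝ} {F : (Fin N → ℝ) → ℝ}
  {g : (Fin N → ℝ) → Fin N → ℝ}

/-- Coordinates are changed one at a time; the intermediate points stay in the cube because it is a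
product. -/
lemma abs_sub_le_piecewise (h : CoordRegular (cube lam0 T) α C F g) (hC : 0 ≤ C)
    (hlam : lam ∈ cube lam0 T) (hlam' : lam' ∈ cube lam0 T) (A : Finset (Fin N)) (i : Fin N) :
    |g (A.piecewise lam' lam) i - g lam i| ≤ A.card * (C * ‖lam' - lam‖ ^ (α : ℝ)) := by
  induction A using Finset.induction_on with
  | empty => simp
  | insert k A hk ih =>
    have hmem := piecewise_mem_cube hlam hlam' A
    have hmem' := piecewise_mem_cube hlam hlam' (insert k A)
    rw [Finset.piecewise_insert] at hmem' ⊢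
    have h1 := h.holder _ hmem k (lam' k) hmem' i
    rw [Finset.piecewise_eq_of_notMem _ _ _ hk] at h1
    have h2 : |lam' k - lam k| ≤ ‖lam' - lam‖ := norm_le_pi_norm (lam' - lam) k
    have h3 : C * |lam' k - lam k| ^ (α : ℝ) ≤ C * ‖lam' - lam‖ ^ (α : ℝ) := by gcongr
    rw [Finset.card_insert_of_notMem hk]
    push_cast
    have h4 := abs_sub_le (g (Function.update (A.piecewise lam' lam) k (lam' k)) i)
      (g (A.piecewise lam' lam) i) (g lam i)
    linarith

lemma abs_sub_le (h : CoordRegular (cube lam0 T) α C F g) (hC : 0 ≤ C)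
    (hlam : lam ∈ cube lam0 T) (hlam' : lam' ∈ cube lam0 T) (i : Fin N) :
    |g lam' i - g lam i| ≤ N * C * ‖lam' - lam‖ ^ (α : ℝ) := by
  have := h.abs_sub_le_piecewise hC hlam hlam' Finset.univ i
  rwa [Finset.piecewise_univ, Finset.card_univ, Fintype.card_fin, ← mul_assoc] at this

/-- Telescoping over coordinates. At each step the derivative at the intermediate point is replaced
by the one at `lam`, at a Hölder cost of at most `N * C`, besides the error `C` of the expansion. -/
lemma abs_expansion_le (h : CoordRegular (cube lam0 T) α C F g) (hC : 0 ≤ C)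
    (hlam : lam ∈ cube lam0 T) (hlam' : lam' ∈ cube lam0 T) :
    |F lam' - F lam - linForm (g lam) (lam' - lam)| ≤
      N * ((N + 1) * C) * (‖lam' - lam‖ * ‖lam' - lam‖ ^ (α : ℝ)) := by
  set t := ‖lam' - lam‖ with ht
  have ht0 : 0 ≤ t := norm_nonneg _
  have key : ∀ A : Finset (Fin N), |F (A.piecewise lam' lam) - F lam -
      ∑ k ∈ A, g lam k * (lam' k - lam k)| ≤ A.card * ((N + 1) * C * (t * t ^ (α : ℝ))) := by
    intro A
    induction A using Finset.induction_on with
    | empty => simp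
    | insert k A hk ih =>
      have hmem := piecewise_mem_cube hlam hlam' A
      have hmem' := piecewise_mem_cube hlam hlam' (insert k A)
      rw [Finset.piecewise_insert] at hmem' ⊢
      have h1 := h.expansion _ hmem k (lam' k) hmem'
      rw [Finset.piecewise_eq_of_notMem _ _ _ hk] at h1
      have h2 : |lam' k - lam k| ≤ t := norm_le_pi_norm (lam' - lam) k
      have h3 : C * (|lam' k - lam k| * |lam' k - lam k| ^ (α : ℝ)) ≤ C * (t * t ^ (α : ℝ)) := by
        gcongr
      have h4 := h.abs_sub_le_piecewise hC hlam hlam' A k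
      have hcard : (A.card : ℝ) ≤ N := by
        have := A.card_le_univ
        rw [Fintype.card_fin] at this
        exact_mod_cast this
      have h5 : |(lam' k - lam k) * (g (A.piecewise lam' lam) k - g lam k)| ≤
          N * C * (t * t ^ (α : ℝ)) := by
        rw [abs_mul]
        calc _ ≤ t * (A.card * (C * t ^ (α : ℝ))) :=
              mul_le_mul h2 h4 (abs_nonneg _) ht0
          _ ≤ t * (N * (C * t ^ (α : ℝ))) := by gcongr
          _ = _ := by ring
      rw [Finset.sum_insert hk, Finset.card_insert_of_notMem hk]
      set F' := F (Function.update (A.piecewise lam' lam) k (lam' k))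
      set Fo := F (A.piecewise lam' lam)
      set go := g (A.piecewise lam' lam) k
      set sA := ∑ k ∈ A, g lam k * (lam' k - lam k)
      have h6 : F' - F lam - (g lam k * (lam' k - lam k) + sA) =
          (F' - Fo - (lam' k - lam k) * go) + (lam' k - lam k) * (go - g lam k) +
            (Fo - F lam - sA) := by ring
      rw [h6]
      push_cast
      refine (abs_add_three _ _ _).trans ?_
      linarith
  have := key Finset.univ
  rw [Finset.piecewise_univ, Finset.card_univ, Fintype.card_fin] at this
  rw [linForm_apply, mul_assoc (N : ℝ)]
  exact this

lemma hasFDerivWithinAt (h : CoordRegular (cube lam0 T) α C F g) (hC : 0 ≤ C) (hα0 : 0 < α)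
    (hlam : lam ∈ cube lam0 T) :
    HasFDerivWithinAt F (linForm (g lam)) (cube lam0 T) lam := by
  refine HasFDerivWithinAt.of_isLittleO (Asymptotics.isLittleO_iff.2 fun c hc => ?_)
  have hα : (α : ℝ) ≠ 0 := NNReal.coe_ne_zero.2 hα0.ne'
  have hcont : Continuous fun x : Fin N → ℝ =>
      N * ((N + 1) * C) * ‖x - lam‖ ^ (α : ℝ) :=
    continuous_const.mul ((continuous_id.sub continuous_const).norm.rpow_const
      fun _ => Or.inr α.coe_nonneg)
  have hev : ∀ᶠ x in 𝓝 lam, N * ((N + 1) * C) * ‖x - lam‖ ^ (α : ℝ) < c := by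
    refine (hcont.tendsto lam).eventually_lt_const ?_
    simpa [Real.zero_rpow hα] using hc
  filter_upwards [self_mem_nhdsWithin, hev.filter_mono nhdsWithin_le_nhds] with x hx hxc
  rw [Real.norm_eq_abs]
  refine (h.abs_expansion_le hC hlam hx).trans ?_
  calc N * ((N + 1) * C) * (‖x - lam‖ * ‖x - lam‖ ^ (α : ℝ))
      = N * ((N + 1) * C) * ‖x - lam‖ ^ (α : ℝ) * ‖x - lam‖ := by ring
    _ ≤ c * ‖x - lam‖ := by gcongr

lemma fderivWithin_eq (h : CoordRegular (cube lam0 T) α C F g) (hC : 0 ≤ C) (hα0 : 0 < α)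
    (hT : 0 < T) (hlam : lam ∈ cube lam0 T) :
    fderivWithin ℝ F (cube lam0 T) lam = linForm (g lam) :=
  (h.hasFDerivWithinAt hC hα0 hlam).fderivWithin (uniqueDiffOn_cube lam0 hT lam hlam)

lemma holderWith (h : CoordRegular (cube lam0 T) α C F g) (hC : 0 ≤ C) (hα0 : 0 < α)
    (hT : 0 < T) :
    HolderWith (N * (N * C)).toNNReal α
      ((cube lam0 T).domRestrict (fderivWithin ℝ F (cube lam0 T))) := by
  rintro ⟨x, hx⟩ ⟨x', hx'⟩
  rw [domRestrict_apply, domRestrict_apply, h.fderivWithin_eq hC hα0 hT hx,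
    h.fderivWithin_eq hC hα0 hT hx', edist_dist, edist_dist,
    ENNReal.ofReal_rpow_of_nonneg dist_nonneg α.coe_nonneg, ENNReal.coe_nnreal_eq,
    Real.coe_toNNReal _ (by positivity), ← ENNReal.ofReal_mul (by positivity)]
  refine ENNReal.ofReal_le_ofReal ?_
  rw [dist_eq_norm, linForm_sub, Subtype.dist_eq, dist_eq_norm, mul_assoc]
  exact norm_linForm_le (by positivity) fun i => h.abs_sub_le hC hx' hx i

lemma isC1HolderOn (h : CoordRegular (cube lam0 T) α C F g) (hC : 0 ≤ C) (hα0 : 0 < α)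
    (hT : 0 < T) : IsC1HolderOn α (cube lam0 T) F := by
  refine ⟨?_, (h.holderWith hC hα0 hT).memHolder⟩
  rw [← zero_add (1 : WithTop ℕ∞), contDiffOn_succ_iff_fderivWithin (uniqueDiffOn_cube lam0 hT)]
  refine ⟨fun x hx => (h.hasFDerivWithinAt hC hα0 hx).differentiableWithinAt, by simp, ?_⟩
  rw [contDiffOn_zero, continuousOn_iff_continuous_domRestrict]
  exact (h.holderWith hC hα0 hT).continuous hα0

lemma c1HolderNorm_le (h : CoordRegular (cube lam0 T) α C F g) (hC : 0 ≤ C) (hα0 : 0 < α)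
    (hT : 0 < T) (hF : ∀ lam ∈ cube lam0 T, |F lam| ≤ 1) :
    c1HolderNorm α (cube lam0 T) F ≤ ((1 + (N * C + N * (N * C))).toNNReal : ℝ≥0∞) := by
  have h0 : (0 : ℝ) ≤ N * C := by positivity
  have h1 : (0 : ℝ) ≤ N * (N * C) := by positivity
  rw [Real.toNNReal_add zero_le_one (by positivity), Real.toNNReal_add h0 h1, ENNReal.coe_add,
    ENNReal.coe_add]
  refine add_le_add (iSup₂_le fun x hx => ?_) (add_le_add (iSup₂_le fun x hx => ?_)
    (h.holderWith hC hα0 hT).eHolderNorm_le)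
  · rw [← ofReal_norm]
    exact ENNReal.ofReal_le_ofReal (hF x hx)
  · rw [← ofReal_norm, h.fderivWithin_eq hC hα0 hT hx]
    exact ENNReal.ofReal_le_ofReal (norm_linForm_le hC (h.bound x hx))

lemma hasLineDerivWithinAt (h : CoordRegular (cube lam0 T) α C F g) (hC : 0 ≤ C) (hα0 : 0 < α)
    (hlam : lam ∈ cube lam0 T) (i : Fin N) :
    HasLineDerivWithinAt ℝ F (g lam i) (cube lam0 T) lam (Pi.single i 1) := by
  rw [← linForm_single (g lam) i]
  exact (h.hasFDerivWithinAt hC hα0 hlam).hasLineDerivWithinAt _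

end CoordRegular

lemma isDensity_of_cHolderNorm_le {X : Set (E d)} {α R : ℝ≥0} {ρ : E d → ℝ}
    (h : cHolderNorm α X ρ ≤ R) : IsDensity X α R ρ := by
  have h1 : ∀ x ∈ X, ‖ρ x‖ₑ ≤ R := fun x hx =>
    (le_iSup₂ (f := fun x (_ : x ∈ X) => ‖ρ x‖ₑ) x hx).trans (le_self_add.trans h)
  have h2 : eHolderNorm α (X.domRestrict ρ) ≤ R := le_add_self.trans h
  have hm : MemHolder α (X.domRestrict ρ) :=
    eHolderNorm_lt_top.1 (h2.trans_lt ENNReal.coe_lt_top)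
  have h3 : nnHolderNorm α (X.domRestrict ρ) ≤ R := by
    rw [← hm.coe_nnHolderNorm_eq_eHolderNorm] at h2
    exact_mod_cast h2
  refine ⟨fun x hx => ?_, fun x hx x' hx' => ?_⟩
  · have := h1 x hx
    rw [← ofReal_norm, ENNReal.ofReal_le_coe] at this
    exact this
  · have h4 := hm.holderWith.dist_le ⟨x, hx⟩ ⟨x', hx'⟩
    rw [Real.dist_eq] at h4
    refine h4.trans ?_
    rw [Subtype.dist_eq]
    have : (nnHolderNorm α (X.domRestrict ρ) : ℝ) ≤ R := h3
    gcongr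

/-- The frontier of a convex set is null, so a convex set without interior cannot carry total mass
one. -/
lemma IsProbDensityOn.interior_nonempty {X : Set (E d)} {ρ : E d → ℝ} (hX : Convex ℝ X)
    (h : IsProbDensityOn ρ X) : (interior X).Nonempty := by
  by_contra hne
  rw [not_nonempty_iff_eq_empty] at hne
  have h0 : volume X = 0 := by
    refine measure_mono_null (fun x hx => ?_) (hX.addHaar_frontier volume)
    exact ⟨subset_closure hx, by rw [hne]; exact notMem_empty x⟩
  have := h.2
  rw [setIntegral_measure_zero _ h0] at this
  exact zero_ne_one this

end LocReg

/-! ### Assembly, with the degenerate cases. -/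

theorem mainTheorem6 (d N : ℕ) (α : ℝ≥0) (hα0 : 0 < α) (hα1 : α ≤ 1)
    (εtr εnd : ℝ) (R D CM CL : ℝ≥0) :
    ∃ C : ℝ≥0, ∀ (X : Set (LocReg.E d)) (f : Fin N → LocReg.E d → ℝ) (ρ : LocReg.E d → ℝ)
      (lam0 : Fin N → ℝ) (T : ℝ),
      IsCompact X → Convex ℝ X → Metric.diam X ≤ D →
      (∀ i, LocReg.IsC11On (f i) X) → (∀ i, QuasiconvexOn ℝ X (f i)) →
      (∀ i, ∀ x ∈ X, ‖gradientWithin (f i) X x‖ ≤ CM) →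
      (∀ i, LipschitzOnWith CL (gradientWithin (f i) X) X) →
      LocReg.NonDegenerate X f εnd → LocReg.Transversal X f lam0 εtr T →
      LocReg.IsProbDensityOn ρ X → LocReg.cHolderNorm α X ρ ≤ R →
      LocReg.IsC1HolderOn α (LocReg.cube lam0 T) (LocReg.G X f ρ) ∧
      (∀ lam ∈ LocReg.cube lam0 T, ∀ i,
        MeasureTheory.IntegrableOn (fun x => ρ x / ‖gradientWithin (f i) X x‖)
          (LocReg.facet X f lam i) μHE[d - 1] ∧
        HasLineDerivWithinAt ℝ (LocReg.G X f ρ)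
          (∫ x in LocReg.facet X f lam i, ρ x / ‖gradientWithin (f i) X x‖ ∂μHE[d - 1])
          (LocReg.cube lam0 T) lam (Pi.single i 1)) ∧
      LocReg.c1HolderNorm α (LocReg.cube lam0 T) (LocReg.G X f ρ) ≤ C := by
  -- If one of these numbers is not positive, no data satisfy the assumptions and any constant
  -- works.
  by_cases hpos : 0 < εtr ∧ 0 < εnd
  swap
  · exact ⟨0, fun X f ρ lam0 T _ _ _ _ _ _ _ hnd htr => (hpos ⟨htr.1, hnd.1⟩).elim⟩
  obtain ⟨C, hC0, hC⟩ : ∃ C : ℝ, 0 ≤ C ∧ ∀ (X : Set (LocReg.E d)) (f : Fin N → LocReg.E d → ℝ)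
      (ρ : LocReg.E d → ℝ) (lam0 : Fin N → ℝ) (T : ℝ),
      LocReg.Setup X f εtr εnd D CL lam0 T → LocReg.IsDensity X α R ρ →
      LocReg.IsProbDensityOn ρ X →
      LocReg.CoordRegular (LocReg.cube lam0 T) α C (LocReg.G X f ρ) (fun lam i =>
        ∫ x in LocReg.facet X f lam i, ρ x / ‖gradientWithin (f i) X x‖ ∂μHE[d - 1]) ∧
      ∀ lam i, MeasureTheory.IntegrableOn (fun x => ρ x / ‖gradientWithin (f i) X x‖)
          (LocReg.facet X f lam i) μHE[d - 1] := by
    cases d with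
    | zero =>
      refine ⟨0, le_rfl, fun X f ρ lam0 T h _ _ => ?_⟩
      -- In dimension zero every gradient vanishes, so nondegeneracy leaves no constraints and all
      -- claims about indices are vacuous.
      have hempty : ∀ _i : Fin N, False := fun i => by
        obtain ⟨x, hx⟩ := h.interior_nonempty
        exact h.gradientWithin_ne_zero i (interior_subset hx) (Subsingleton.elim _ _)
      exact ⟨⟨fun _ _ i => (hempty i).elim, fun _ _ j => (hempty j).elim,
        fun _ _ j => (hempty j).elim⟩, fun _ i => (hempty i).elim⟩
    | succ n =>
      obtain ⟨C, hC⟩ := LocReg.exists_coordRegular n N hα0 hα1 hpos.1 hpos.2 R D CL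
      refine ⟨max C 0, le_max_right _ _, fun X f ρ lam0 T h hρ hρp => ⟨?_, fun lam i =>
        h.integrableOn_facet hρ.bound (LocReg.continuousOn_of_holder hα0 hρ.holder) lam i⟩⟩
      have hreg := hC X f ρ lam0 T h hρ hρp
      have hle : C ≤ max C 0 := le_max_left _ _
      exact ⟨fun lam hlam i => (hreg.bound lam hlam i).trans hle,
        fun lam hlam j s hs i => (hreg.holder lam hlam j s hs i).trans (by gcongr),
        fun lam hlam j s hs => (hreg.expansion lam hlam j s hs).trans (by gcongr)⟩
  refine ⟨(1 + (N * C + N * (N * C))).toNNReal, fun X f ρ lam0 T hXc hXv hXd hf hq _ hlip hnd htr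
    hρp hρ => ?_⟩
  have h : LocReg.Setup X f εtr εnd D CL lam0 T :=
    ⟨hXc, hXv, hρp.interior_nonempty hXv, hXd, fun i => (hf i).1, hq, hlip, hnd, htr⟩
  have hT : 0 < T := htr.2.1
  have hd := LocReg.isDensity_of_cHolderNorm_le hρ
  obtain ⟨hreg, hintg⟩ := hC X f ρ lam0 T h hd hρp
  exact ⟨hreg.isC1HolderOn hC0 hα0 hT, fun lam hlam i =>
    ⟨hintg lam i, hreg.hasLineDerivWithinAt hC0 hα0 hlam i⟩,
    hreg.c1HolderNorm_le hC0 hα0 hT fun lam _ => LocReg.abs_G_le_one hXc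
      (LocReg.continuousOn_of_holder hα0 hd.holder) hρp lam (h.isCompact_K lam).measurableSet⟩
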